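/- Let $\mathbb K=\mathbb R$ or $\mathbb C$, let $\hbar\in\mathbb K$ (the value $\hbar=0$ is allowed), and let $A$ be either the algebra of $\mathbb K$-valued $C^\infty$ functions on an open interval of the real line with coordinate $x$, or the algebra $\mathbb K[[x]]$ of formal power series; put $\partial=\partial_x=d/dx$ on $A$. Let $\mathbf t=(t_1,t_2,\dots)$ and $\partial_k=\partial/\partial t_k$. On formal power series $F(x;\mathbf t)$ in $\mathbf t$ with coefficients in $A$ put $$D(z)=\sum_{k\ge1}\frac{z^{-k}}{k}\partial_k,\qquad \Delta(z)=\frac{e^{\hbar D(z)}-1}{\hbar}=\sum_{l\ge1}\frac{\hbar^{l-1}}{l!}D(z)^l=\sum_{k\ge1}\frac{z^{-k}}{k}\,\partial_k^{\hbar},$$ which defines the $\hbar$-deformed partial derivatives $\partial^\hbar_k$ ($k\ge 1$); thus $\partial_1^\hbar=\partial_1$, $\partial_2^\hbar=\partial_2+\hbar\partial_1^2$, and so on. A formal solution of the $\hbar$-KP hierarchy is such a series $F$ which has the form $F(x;\mathbf t)=\varphi(x)+\hat F(x+t_1,t_2,t_3,\dots)$ (that is, $(\partial_x-\partial_1)(F-\varphi)=0$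 for some $\varphi\in A$) and satisfies $$e^{\Delta(z_1)\Delta(z_2)F}=1-\frac{\Delta(z_1)\partial_1F-\Delta(z_2)\partial_1F}{z_1-z_2}$$ as an identity of formal series in $z_1^{-1},z_2^{-1}$. For a partition (Young diagram) $\lambda=(\lambda_1\ge\dots\ge\lambda_\ell>0)$ with $m_k$ parts equal to $k$, write $|\lambda|=\sum_i\lambda_i$, $\ell(\lambda)=\ell$, $\rho(\lambda)=\lambda_1\cdots\lambda_\ell$, $\sigma(\lambda)=\prod_k m_k!$, $t_\lambda=t_{\lambda_1}\cdots t_{\lambda_\ell}$. Let $L_{\lambda\mu}$ ($|\lambda|=|\mu|$) be the transition matrix $p_\lambda=\sum_\mu L_{\lambda\mu}m_\mu$ from power sums to monomial symmetric functions, i.e. the number of maps $g$ from $\{1,\dots,\ell(\lambda)\}$ to $\{1,\dots,\ell(\mu)\}$ with $\sum_{j:\,g(j)=i}\lambda_j=\mu_i$ for all $i$; it is invertible, and one sets $$t^\hbar_\lambda=\frac{\sigma(\lambda)}{\rho(\lambda)}\sum_{\mu}(L^{-1})_{\lambda\mu}\,\rho(\mu)\,\hbar^{\ell(\lambda)-\ell(\mu)}\,t_\mu$$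 (only $\mu$ with $\ell(\mu)\le\ell(\lambda)$ contribute; for $\hbar\ne0$ this is $\frac{\sigma(\lambda)}{\rho(\lambda)}\hbar^{\ell(\lambda)}m_\lambda(\mathbf t/\hbar)$, where $m_\lambda$ is written in the variables $t_k=p_k/k$). For positive integers let $\tilde P_{ij}(s_1,\dots,s_m)$ be the number of pairs of sequences of positive integers $(i_1,\dots,i_m)$, $(j_1,\dots,j_m)$ with $\sum_a i_a=i$, $\sum_a j_a=j$, $s_a=i_a+j_a-1$, and let $P_{ij}(s_1,\dots,s_m)=\frac{(-1)^{m+1}ij}{m\,s_1\cdots s_m}\tilde P_{ij}(s_1,\dots,s_m)$. Define $P^\hbar_{i_1\dots i_r}\binom{s_1\dots s_m}{l_1\dots l_m}$ ($r\ge2$) recursively. For $r=2$ it equals $P_{i_1i_2}(s_1,\dots,s_m)$ if all $l_a=1$, and $0$ otherwise. For $r\ge3$, $$P^\hbar_{i_1\dots i_r}\binom{x_1\dots x_v}{y_1\dots y_v}=\sum P^\hbar_{i_1\dots i_{r-1}}\binom{s_1\dots s_m}{l_1\dots l_m}\,\frac{\hbar^{\nu(k_1,\dots,k_m)-1}\,i_r}{\prod_a\max(k_a,1)}\,\prod_{a=1}^m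 w_a ,$$ where $\nu$ is the number of nonzero $k_a$, and the sum is over all $m\ge1$, all ways to cut the sequence of columns $(x_b,y_b)$ into $m$ consecutive nonempty blocks, all integers $k_1,\dots,k_m\ge0$ with $\sum_a k_a=i_r$, and all integers $s_a,l_a\ge1$, such that for each $a$, if the $a$-th block is $(x_1^a,y_1^a),\dots,(x_n^a,y_n^a)$: either $k_a=0$, $n=1$, $(s_a,l_a)=(x^a_1,y^a_1)$, and then $w_a=1$; or $k_a\ge1$, $\sum_j x_j^a+n=s_a+k_a$, $\sum_j(y_j^a-1)=l_a$, and then $w_a=\frac{l_a!}{\prod_j(y^a_j-1)!}\,P_{s_ak_a}(x_1^a,\dots,x_n^a)$. Theorem. For every family $f_0,f_1,f_2,\dots$ of elements of $A$ there exists a unique formal solution $F(x;\mathbf t)$ of the $\hbar$-KP hierarchy with $F(x;\mathbf 0)=f_0(x)$ and $\partial_k^\hbar F|_{\mathbf t=0}=f_k(x)$ for all $k\ge1$. This solution has the form $$F(x;\mathbf t)=f_0(x)+\sum_{|\lambda|\ge1}\frac{f^\hbar_\lambda(x)}{\sigma(\lambda)}\,t^\hbar_\lambda,$$ where $f^\hbar_{(k)}=f_k$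 and, for $\ell(\lambda)>1$, $$f^\hbar_\lambda=\sum_{m\ge1}\ \sum_{\substack{s_1+l_1+\dots+s_m+l_m=|\lambda|\\ 1\le s_a,\ 1\le l_a\le\ell(\lambda)-1}}P^\hbar_{\lambda_1\dots\lambda_{\ell(\lambda)}}\binom{s_1\dots s_m}{l_1\dots l_m}\,\partial^{l_1}f_{s_1}\cdots\partial^{l_m}f_{s_m}.$$ -/

import Mathlib

open scoped ContDiff

noncomputable section

namespace HKP

/-! ### Functions of `x`: smooth functions on an open interval -/

section Smooth

variable (𝕜 : Type*) [RCLike 𝕜] (I : TopologicalSpace.Opens ℝ)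

/-- Extension by zero of a function on `I` to the real line. -/
def extendZero {𝕜 : Type*} [RCLike 𝕜] {I : TopologicalSpace.Opens ℝ} (g : I → 𝕜) : ℝ → 𝕜 :=
  open Classical in fun x => if h : x ∈ I then g ⟨x, h⟩ else 0

theorem extendZero_apply {𝕜 : Type*} [RCLike 𝕜] {I : TopologicalSpace.Opens ℝ} (g : I → 𝕜)
    (x : I) : extendZero g x = g x := by
  simp [extendZero]

theorem contDiffOn_of_eq {𝕜 : Type*} [RCLike 𝕜] {I : TopologicalSpace.Opens ℝ} {g : I → 𝕜}
    {f : ℝ → 𝕜} (hf : ContDiffOn ℝ ∞ f I) (h : ∀ x : I, f x = g x) :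
    ContDiffOn ℝ ∞ (extendZero g) I :=
  hf.congr fun x hx => by rw [extendZero_apply g ⟨x, hx⟩, ← h ⟨x, hx⟩]

/-- The algebra of infinitely differentiable `𝕜`-valued functions on the open set `I ⊆ ℝ`. -/
def SmoothFun : Subalgebra 𝕜 (I → 𝕜) where
  carrier := {g | ContDiffOn ℝ ∞ (extendZero g) I}
  mul_mem' {a b} ha hb := contDiffOn_of_eq (f := fun x => extendZero a x * extendZero b x)
    (ha.mul hb) fun x => by simp [extendZero_apply]
  add_mem' {a b} ha hb := contDiffOn_of_eq (f := fun x => extendZero a x + extendZero b x)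
    (ha.add hb) fun x => by simp [extendZero_apply]
  algebraMap_mem' r := contDiffOn_of_eq (f := fun _ => r) contDiffOn_const fun x => by simp

variable {𝕜 I}

theorem differentiableAt_extendZero (g : SmoothFun 𝕜 I) (x : I) :
    DifferentiableAt ℝ (extendZero g.1) x :=
  (ContDiffOn.differentiableOn (n := ∞) g.2 (by simp)).differentiableAt (I.2.mem_nhds x.2)

theorem deriv_extendZero_congr {g : I → 𝕜} {f : ℝ → 𝕜} (h : ∀ x : I, f x = g x) (x : I) :
    deriv (extendZero g) x = deriv f x := by
  apply Filter.EventuallyEq.deriv_eq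
  filter_upwards [I.2.mem_nhds x.2] with y hy
  rw [extendZero_apply g ⟨y, hy⟩, ← h ⟨y, hy⟩]

variable (𝕜 I) in
/-- The derivative `d/dx` on smooth functions on `I`. -/
def smoothDeriv : Derivation 𝕜 (SmoothFun 𝕜 I) (SmoothFun 𝕜 I) :=
  Derivation.mk'
    { toFun := fun g => ⟨fun x => deriv (extendZero g.1) x,
        contDiffOn_of_eq (f := deriv (extendZero g.1))
          (((contDiffOn_infty_iff_deriv_of_isOpen I.2).1 g.2).2) fun _ => rfl⟩
      map_add' := fun a b => Subtype.ext <| funext fun x => by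
        have := deriv_extendZero_congr (g := (a + b).1)
          (f := fun y => extendZero a.1 y + extendZero b.1 y)
          (fun y => by simp [extendZero_apply]) x
        simpa [deriv_fun_add (differentiableAt_extendZero a x) (differentiableAt_extendZero b x)] using this
      map_smul' := fun c a => Subtype.ext <| funext fun x => by
        have := deriv_extendZero_congr (g := (c • a).1)
          (f := fun y => c * extendZero a.1 y)
          (fun y => by simp [extendZero_apply]) x
        simpa [deriv_const_mul c (differentiableAt_extendZero a x)] using this }
    fun a b => Subtype.ext <| funext fun x => by
      have := deriv_extendZero_congr (g := (a * b).1)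
        (f := fun y => extendZero a.1 y * extendZero b.1 y)
        (fun y => by simp [extendZero_apply]) x
      rw [deriv_fun_mul (differentiableAt_extendZero a x) (differentiableAt_extendZero b x)] at this
      simp only [extendZero_apply] at this
      refine Eq.trans this ?_
      change _ = a.1 x * deriv (extendZero b.1) x + b.1 x * deriv (extendZero a.1) x
      ring

end Smooth

/-! ### Formal series in `t₁, t₂, …` and the `ħ`-KP hierarchy

`A` is the algebra of functions of `x` with derivation `d = d/dx`; a formal function `F(x; t)`
is an element of `MvPowerSeries ℕ+ A`, the variable with index `k : ℕ+` being `t_k`. -/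

section Hierarchy

variable {𝕜 : Type*} [RCLike 𝕜] {A : Type*} [CommRing A] [Algebra 𝕜 A]

/-- `∂_x`, acting on the coefficients of a series. -/
def dx (d : Derivation 𝕜 A A) (F : MvPowerSeries ℕ+ A) : MvPowerSeries ℕ+ A :=
  fun n => d (MvPowerSeries.coeff n F)

variable (𝕜 A) in
/-- `∂_k = ∂/∂t_k` as a `𝕜`-linear operator. -/
def dt (k : ℕ+) : Module.End 𝕜 (MvPowerSeries ℕ+ A) :=
  (MvPowerSeries.pderiv A k).toLinearMap.restrictScalars 𝕜

variable (𝕜 A) in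
/-- `D(z) = ∑_{k ≥ 1} (z^{-k} / k) ∂_k`, a power series in `z^{-1}` with operator coefficients. -/
def opD : PowerSeries (Module.End 𝕜 (MvPowerSeries ℕ+ A)) :=
  PowerSeries.mk fun k => if h : 0 < k then (k : 𝕜)⁻¹ • dt 𝕜 A ⟨k, h⟩ else 0

variable (A) in
/-- `Δ(z) = (exp (ħ D(z)) - 1) / ħ = ∑_{l ≥ 1} ħ^{l-1} D(z)^l / l!`, a power series in `z^{-1}`.
Since `D(z)` has no constant term, only `l ≤ k` contribute to the coefficient of `z^{-k}`. -/
def opDelta (ħ : 𝕜) : PowerSeries (Module.End 𝕜 (MvPowerSeries ℕ+ A)) :=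
  PowerSeries.mk fun k =>
    ∑ l ∈ Finset.Icc 1 k, (ħ ^ (l - 1) / (l.factorial : 𝕜)) • PowerSeries.coeff k (opD 𝕜 A ^ l)

variable (A) in
/-- The `ħ`-deformed partial derivative `∂_k^ħ = (k / ħ) h_k(ħ ∂_1, ħ ∂_2 / 2, ħ ∂_3 / 3, …)`,
where `∑_k h_k(t) z^k = exp (∑_k t_k z^k)`; that is, `k` times the coefficient of `z^{-k}`
in `Δ(z)`. -/
def hderiv (ħ : 𝕜) (k : ℕ) : Module.End 𝕜 (MvPowerSeries ℕ+ A) :=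
  (k : 𝕜) • PowerSeries.coeff k (opDelta A ħ)

/-- `Δ(z_a) G` as a power series in `z_0^{-1} = X 0` and `z_1^{-1} = X 1`. -/
def deltaOne (ħ : 𝕜) (a : Fin 2) (G : MvPowerSeries ℕ+ A) :
    MvPowerSeries (Fin 2) (MvPowerSeries ℕ+ A) :=
  fun e => if e = Finsupp.single a (e a) then PowerSeries.coeff (e a) (opDelta A ħ) G else 0

/-- `Δ(z_0) Δ(z_1) F` as a power series in `z_0^{-1} = X 0` and `z_1^{-1} = X 1`. -/
def deltaTwo (ħ : 𝕜) (F : MvPowerSeries ℕ+ A) : MvPowerSeries (Fin 2) (MvPowerSeries ℕ+ A) :=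
  fun e => PowerSeries.coeff (e 0) (opDelta A ħ) (PowerSeries.coeff (e 1) (opDelta A ħ) F)

/-- `F(x; t)` is a formal solution of the `ħ`-KP hierarchy.

* `form`: `F(x; t) = φ(x) + G(x + t₁, t₂, t₃, …)`, i.e. `F - φ` is annihilated by `∂_x - ∂_1`.
* `fay`: the differential Fay identity
  `exp (Δ(z₀) Δ(z₁) F) = 1 - (Δ(z₀) ∂_1 F - Δ(z₁) ∂_1 F) / (z₀ - z₁)`, as an identity of formal
  series in `u = z₀⁻¹`, `v = z₁⁻¹`. As `1 / (z₀ - z₁) = u v / (v - u)`, it is multiplied by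
  the (regular) element `u - v`. -/
structure IsSolution (d : Derivation 𝕜 A A) (ħ : 𝕜) (F : MvPowerSeries ℕ+ A) : Prop where
  form : ∃ φ : A, dx d (F - MvPowerSeries.C φ) = dt 𝕜 A 1 (F - MvPowerSeries.C φ)
  fay : (MvPowerSeries.X 0 - MvPowerSeries.X 1) *
      ((PowerSeries.exp 𝕜).subst (deltaTwo ħ F) - 1) =
    MvPowerSeries.X 0 * MvPowerSeries.X 1 *
      (deltaOne ħ 0 (dt 𝕜 A 1 F) - deltaOne ħ 1 (dt 𝕜 A 1 F))

/-- `F` has the Cauchy-like data `f₀, f₁, f₂, …`: `F(x; 0) = f₀` and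
`∂_k^ħ F |_{t = 0} = f_k` for `k ≥ 1`. -/
def HasCauchyLikeData (ħ : 𝕜) (f : ℕ → A) (F : MvPowerSeries ℕ+ A) : Prop :=
  MvPowerSeries.constantCoeff F = f 0 ∧
    ∀ k, 1 ≤ k → MvPowerSeries.constantCoeff (hderiv A ħ k F) = f k

end Hierarchy

/-! ### The combinatorial constants -/

section Constants

variable (𝕜 : Type*) [RCLike 𝕜]

/-- `P̃_{ij}(s_1, …, s_m)`: the number of pairs of sequences of positive integers `(i_1, …, i_m)`,
`(j_1, …, j_m)` with `∑ i_k = i`, `∑ j_k = j` and `s_k = i_k + j_k - 1`. -/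
def Ptilde (i j : ℕ) (s : List ℕ) : ℕ :=
  ((Fintype.piFinset fun k : Fin s.length => Finset.HasAntidiagonal.antidiagonal (s.get k + 1)).filter
    fun q => (∀ k, 0 < (q k).1 ∧ 0 < (q k).2) ∧ ∑ k, (q k).1 = i ∧ ∑ k, (q k).2 = j).card

/-- `P_{ij}(s_1, …, s_m) = (-1)^{m+1} i j / (m s_1 ⋯ s_m) · P̃_{ij}(s_1, …, s_m)`. -/
def Ptwo (i j : ℕ) (s : List ℕ) : 𝕜 :=
  (-1) ^ (s.length + 1) * (i * j) / (s.length * (s.prod : ℕ)) * Ptilde i j s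

/-- The coefficient `ħ^{ν(k_1, …, k_m) - 1} k / [k_1 … k_m]` of the generalized Leibniz rule, where
`ν` is the number of nonzero `k_a` and `[k_1 … k_m] = ∏ max (k_a, 1)`. -/
def leibnizCoeff {𝕜 : Type*} [RCLike 𝕜] (ħ : 𝕜) (k : ℕ) {m : ℕ} (κ : Fin m → ℕ) : 𝕜 :=
  ħ ^ ((Finset.univ.filter fun a => κ a ≠ 0).card - 1) * k / ((∏ a, max (κ a) 1 : ℕ) : 𝕜)

/-- The column `(s, l)` such that applying `∂_k^ħ` to `∂^l ∂_s^ħ F` produces the block `B` of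
columns `(s_1, l_1 + 1), …, (s_n, l_n + 1)`: `s_1 + ⋯ + s_n + n = s + k` and
`l = l_1 + ⋯ + l_n`. If `k = 0` then `∂_0^ħ` is the identity and `B` consists of `(s, l)` only. -/
def parent (k : ℕ) (B : List (ℕ × ℕ)) : ℕ × ℕ :=
  if k = 0 then B.headD (0, 0)
  else ((B.map Prod.fst).sum + B.length - k, (B.map fun c => c.2 - 1).sum)

/-- The coefficient of the block `B` in `∂_k^ħ ∂^l ∂_s^ħ F`, where `(s, l) = parent k B`: it is
`K_l(l_1, …, l_n) P_{s k}(s_1, …, s_n)` with the multinomial coefficient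
`K_l(l_1, …, l_n) = l! / (l_1! ⋯ l_n!)` if `k > 0`, and `1` if `k = 0` (for a single column). -/
def blockCoeff (k : ℕ) (B : List (ℕ × ℕ)) : 𝕜 :=
  if (∀ c ∈ B, 1 ≤ c.1 ∧ 1 ≤ c.2) ∧ 1 ≤ (parent k B).1 ∧ 1 ≤ (parent k B).2 then
    if k = 0 then (if B.length = 1 then 1 else 0)
    else (Nat.multinomial Finset.univ (fun a : Fin B.length => (B.get a).2 - 1) : 𝕜) *
      Ptwo 𝕜 (parent k B).1 k (B.map Prod.fst)
  else 0

/-- The constants `P^ħ_{i_1 … i_r}(x_1 … x_v; y_1 … y_v)`, with the indices listed in the order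
`i_r, …, i_1` and the columns `(x_b, y_b)` as a list. The recursion (on `r`) sums over all ways to
cut the list of columns into `m` consecutive nonempty blocks and over all `k_1, …, k_m ≥ 0` with
`k_1 + ⋯ + k_m = i_r`. -/
def PhbarRev {𝕜 : Type*} [RCLike 𝕜] (ħ : 𝕜) : List ℕ → List (ℕ × ℕ) → 𝕜
  | [], _ => 0
  | [_], _ => 0
  | [i₂, i₁], xy => if ∀ c ∈ xy, c.2 = 1 then Ptwo 𝕜 i₁ i₂ (xy.map Prod.fst) else 0
  | i :: i' :: i'' :: rest, xy =>
      ∑ c : Composition xy.length,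
        ∑ κ ∈ Finset.piAntidiag
            (Finset.univ : Finset (Fin (xy.splitWrtComposition c).length)) i,
          PhbarRev ħ (i' :: i'' :: rest)
              (List.ofFn fun a => parent (κ a) ((xy.splitWrtComposition c).get a)) *
            leibnizCoeff ħ i κ *
            ∏ a, blockCoeff 𝕜 (κ a) ((xy.splitWrtComposition c).get a)

/-- The constants `P^ħ_{i_1 … i_r}(s_1 … s_m; l_1 … l_m)`, `r ≥ 2`. -/
def Phbar {𝕜 : Type*} [RCLike 𝕜] (ħ : 𝕜) (i : List ℕ) (sl : List (ℕ × ℕ)) : 𝕜 :=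
  PhbarRev ħ i.reverse sl

end Constants

/-! ### Young diagrams and the deformed monomials `t_λ^ħ` -/

section Diagrams

/-- The rows of a diagram `λ_1 ≥ λ_2 ≥ ⋯`. -/
def rows {n : ℕ} (p : n.Partition) : List ℕ := p.parts.sort (· ≥ ·)

/-- The number of rows `ℓ(λ)`. -/
def len {n : ℕ} (p : n.Partition) : ℕ := p.parts.card

/-- `ρ(λ) = λ_1 ⋯ λ_ℓ`. -/
def rho {n : ℕ} (p : n.Partition) : ℕ := p.parts.prod

/-- `σ(λ) = ∏_k m_k!`, `m_k` being the number of rows of length `k`. -/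
def sigma {n : ℕ} (p : n.Partition) : ℕ := ∏ k ∈ p.parts.toFinset, (p.parts.count k).factorial

/-- The transition matrix from power sums to monomial symmetric functions,
`p_λ = ∑_μ L_{λμ} m_μ`: `L_{λμ}` is the number of maps `g` from the rows of `λ` to the rows of `μ`
such that for every `i` the rows of `λ` sent to `i` have total length `μ_i`. -/
def transL (n : ℕ) : Matrix n.Partition n.Partition ℚ := fun p q =>
  Fintype.card {g : Fin (rows p).length → Fin (rows q).length //
    ∀ i, ∑ j ∈ Finset.univ.filter (fun j => g j = i), (rows p).get j = (rows q).get i}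

/-- The monomial `t_λ = t_{λ_1} ⋯ t_{λ_ℓ}`. -/
def tMonomial (𝕜 : Type*) [RCLike 𝕜] {n : ℕ} (p : n.Partition) : MvPolynomial ℕ+ 𝕜 :=
  (p.parts.map fun k => (MvPolynomial.X k.toPNat' : MvPolynomial ℕ+ 𝕜)).prod

/-- The deformed monomial `t_λ^ħ = (σ(λ) / ρ(λ)) ħ^{ℓ(λ)} m_λ(t / ħ)`, where
`m_λ = ∑_μ (L⁻¹)_{λμ} p_μ` is the monomial symmetric function written as a polynomial in the
`t_k = p_k / k`. The powers of `ħ` are combined (the entry `(L⁻¹)_{λμ}` vanishes unless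
`ℓ(μ) ≤ ℓ(λ)`), so that `ħ = 0` is allowed. -/
def tDeformed {𝕜 : Type*} [RCLike 𝕜] (ħ : 𝕜) {n : ℕ} (p : n.Partition) : MvPolynomial ℕ+ 𝕜 :=
  ((sigma p : 𝕜) / (rho p : 𝕜)) •
    ∑ q : n.Partition,
      (((transL n)⁻¹ p q : ℚ) * (rho q : 𝕜) * ħ ^ (len p - len q)) • tMonomial 𝕜 q

end Diagrams

/-! ### The explicit solution -/

section Explicit

variable {𝕜 : Type*} [RCLike 𝕜] {A : Type*} [CommRing A] [Algebra 𝕜 A]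

/-- The functions `f_λ^ħ(x)`: `f_{(k)}^ħ = f_k`, and for `ℓ(λ) > 1` the sum over all `m ≥ 1` and all
`(s_1, l_1), …, (s_m, l_m)` with `s_a ≥ 1`, `1 ≤ l_a ≤ ℓ(λ) - 1` and `∑ (s_a + l_a) = |λ|` of
`P_λ^ħ(s_1 … s_m; l_1 … l_m) ∂^{l_1} f_{s_1} ⋯ ∂^{l_m} f_{s_m}`.
(The bounds `m ≤ |λ|` and `s_a ≤ |λ|` follow from these conditions.) -/
def fLam (d : Derivation 𝕜 A A) (ħ : 𝕜) (f : ℕ → A) {n : ℕ} (p : n.Partition) : A :=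
  if len p = 1 then f n
  else
    ∑ m ∈ Finset.Icc 1 n,
      ∑ sl ∈ (Fintype.piFinset fun _ : Fin m =>
          Finset.Icc 1 n ×ˢ Finset.Icc 1 (len p - 1)).filter
          (fun sl => ∑ a, ((sl a).1 + (sl a).2) = n),
        Phbar ħ (rows p) (List.ofFn sl) • ∏ a, d^[(sl a).2] (f (sl a).1)

/-- The partial sum `f_0 + ∑_{1 ≤ |λ| ≤ N} (f_λ^ħ(x) / σ(λ)) t_λ^ħ`. -/
def partialSum (d : Derivation 𝕜 A A) (ħ : 𝕜) (f : ℕ → A) (N : ℕ) : MvPowerSeries ℕ+ A :=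
  MvPowerSeries.C (f 0) +
    ∑ n ∈ Finset.Icc 1 N, ∑ p : n.Partition,
      MvPowerSeries.C ((sigma p : 𝕜)⁻¹ • fLam d ħ f p) *
        ((MvPolynomial.map (algebraMap 𝕜 A) (tDeformed ħ p) : MvPolynomial ℕ+ A) :
          MvPowerSeries ℕ+ A)

/-- The weight of a monomial in the `t_k`, where `t_k` has weight `k`. -/
def weight (α : ℕ+ →₀ ℕ) : ℕ := α.sum fun k e => (k : ℕ) * e

/-- `F = f_0 + ∑_{|λ| ≥ 1} (f_λ^ħ / σ(λ)) t_λ^ħ` as a formal series: the coefficient at a monomial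
of weight at most `N` is that of the `N`-th partial sum (`t_λ^ħ` being homogeneous
of weight `|λ|`). -/
def IsExpansion (d : Derivation 𝕜 A A) (ħ : 𝕜) (f : ℕ → A) (F : MvPowerSeries ℕ+ A) : Prop :=
  ∀ (N : ℕ) (α : ℕ+ →₀ ℕ), weight α ≤ N →
    MvPowerSeries.coeff α F = MvPowerSeries.coeff α (partialSum d ħ f N)

end Explicit

end HKP

end

/-!
# The formal solutions of the `ħ`-KP hierarchy with given Cauchy-like data

Write `H_{ij} = ∂_i^ħ ∂_j^ħ F`. Taking logarithms, the differential Fay identity says that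
`∑ H_{ij} u^i v^j / (i j) = log (1 + Y)`, where `Y` is linear in the `∂_1 ∂_s^ħ F`; expanding
the logarithm gives `H_{ij} = ∑ P_{ij}(s_1, …, s_m) ∂_1 ∂_{s_1}^ħ F ⋯ ∂_1 ∂_{s_m}^ħ F` (`fay_iff`).

*Formula and uniqueness.* A series in `t` is determined by its deformed derivatives at `t = 0`, and
the basis dual to them is `t_λ^ħ / σ(λ)` up to the factor `ρ(λ)`: a product of power sums is
expanded in monomial symmetric functions by the matrix `L`, and `D_k` is the coefficient of `z^{-k}`
in `Δ(z)`, for which `1 + ħ Δ(z)` is multiplicative (`coeff_expo`, `eq_of_opsD`,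
`isExpansion_of_opsD`). On a solution, the derivatives of order `r ≥ 2` are computed recursively: the
Leibniz rule for `∂_k^ħ` (`hderiv_prod`) together with `fay_iff` expresses `∂_k^ħ` of a product of
factors `∂^l ∂_s^ħ F` by such products, and the coefficients are those of the recursion for `P^ħ`
(`hderiv_sum_colProd`, `prod_hderiv_eq_sum_colProd`). At `t = 0` the operator `∂_1` acts
as `∂_x`, which gives the `f_λ^ħ`.

*Existence.* In the ring of polynomials in symbols for `∂^l F` and `∂^l ∂_k^ħ F`, the equations for
`H_{ij}` define operators `D_k` with the quasi-Leibniz rule. The point is that they commute, that is,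
that `D_a (H_{bc} / (b c))` is symmetric (`apply_logCoeff_comm`). With
`q_{ab} = (u_a - u_b) (1 + Y_{ab})`, which is `u_a - u_b + u_a u_b (s_a - s_b)` for series `s_a` in one variable, the ratio
`X = Δ_0 (1 + Y_{12}) / (1 + Y_{12})` is
`u_1 u_2 (∂q_{01} / q_{01} - ∂q_{02} / q_{02}) / q_{12}`; this is symmetric in the three indices by a
rational identity, and it determines `Δ_0 log (1 + Y_{12})`. As deformed derivatives at `t = 0` can
be prescribed arbitrarily, each element of this ring has a Taylor series in `t`; this is
a homomorphism carrying `D_k` and `∂` to `D_k` and `∂_x` (`univSeriesHom`), so the Taylor series of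
`F` is a solution (`exists_isSolution`). For `∂F = f_1` to hold at `t = 0`, an antiderivative of
`f_1` is needed; it exists for both kinds of functions of `x`.
-/

open scoped ContDiff

noncomputable section

namespace HKP

open Finset hiding antidiagonal mem_antidiagonal
open Finset.HasAntidiagonal (antidiagonal mem_antidiagonal)

/-! ### Sums over triples with a given total -/

section Antidiagonal

variable {N : Type*} [AddCommMonoid N]

theorem sum_antidiagonal_assoc (n : ℕ) (f : ℕ → ℕ → ℕ → N) :
    ∑ p ∈ antidiagonal n, ∑ q ∈ antidiagonal p.2, f p.1 q.1 q.2 =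
      ∑ p ∈ antidiagonal n, ∑ q ∈ antidiagonal p.1, f q.1 q.2 p.2 := by
  simp only [Finset.sum_sigma']
  refine Finset.sum_nbij' (fun x => ⟨(x.1.1 + x.2.1, x.2.2), (x.1.1, x.2.1)⟩)
    (fun x => ⟨(x.2.1, x.2.2 + x.1.2), (x.2.2, x.1.2)⟩) ?_ ?_ ?_ ?_ ?_ <;>
  · rintro ⟨⟨a, b⟩, ⟨c, d⟩⟩ h
    simp only [mem_sigma, mem_antidiagonal] at h
    obtain ⟨rfl, rfl⟩ := h
    simp [add_assoc]

theorem sum_antidiagonal_left_comm (n : ℕ) (f : ℕ → ℕ → ℕ → N) :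
    ∑ p ∈ antidiagonal n, ∑ q ∈ antidiagonal p.2, f p.1 q.1 q.2 =
      ∑ p ∈ antidiagonal n, ∑ q ∈ antidiagonal p.2, f q.1 p.1 q.2 := by
  simp only [Finset.sum_sigma']
  refine Finset.sum_nbij' (fun x => ⟨(x.2.1, x.1.1 + x.2.2), (x.1.1, x.2.2)⟩)
    (fun x => ⟨(x.2.1, x.1.1 + x.2.2), (x.1.1, x.2.2)⟩) ?_ ?_ ?_ ?_ ?_ <;>
  · rintro ⟨⟨a, b⟩, ⟨c, d⟩⟩ h
    simp only [mem_sigma, mem_antidiagonal] at h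
    obtain ⟨rfl, rfl⟩ := h
    simp [add_left_comm]

end Antidiagonal

/-! ### The Euler operator on power series with non-commuting coefficients -/

section Euler

variable {R : Type*} [Ring R]

/-- The Euler operator `u d/du` on power series over a possibly non-commutative ring. -/
def euler (a : PowerSeries R) : PowerSeries R :=
  PowerSeries.mk fun n => n • PowerSeries.coeff n a

theorem euler_mul (a b : PowerSeries R) : euler (a * b) = euler a * b + a * euler b := by
  ext n
  simp only [euler, PowerSeries.coeff_mk, PowerSeries.coeff_mul, map_add, Finset.smul_sum,
    ← Finset.sum_add_distrib]
  refine Finset.sum_congr rfl fun p hp => ?_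
  rw [← mem_antidiagonal.1 hp, add_smul, smul_mul_assoc, mul_smul_comm]

theorem euler_pow_succ {a : PowerSeries R}
    (ha : ∀ i j, Commute (PowerSeries.coeff i a) (PowerSeries.coeff j a)) (l : ℕ) :
    euler (a ^ (l + 1)) = (l + 1) • (euler a * a ^ l) := by
  have hc : Commute (euler a) a := by
    ext n
    simp only [PowerSeries.coeff_mul, euler, PowerSeries.coeff_mk]
    rw [← Finset.Nat.sum_antidiagonal_swap]
    refine Finset.sum_congr rfl fun p _ => ?_
    simpa using ((ha p.2 p.1).smul_left p.2).eq
  induction l with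
  | zero => simp
  | succ l ih =>
    rw [pow_succ', euler_mul, ih, mul_smul_comm, ← mul_assoc, ← hc.eq, mul_assoc, ← pow_succ',
      succ_nsmul' _ (l + 1)]

theorem coeff_pow_eq_zero {a : PowerSeries R} (ha : PowerSeries.coeff 0 a = 0) :
    ∀ (l : ℕ) {k : ℕ}, k < l → PowerSeries.coeff k (a ^ l) = 0
  | 0, _, h => absurd h (Nat.not_lt_zero _)
  | l + 1, k, h => by
    rw [pow_succ', PowerSeries.coeff_mul]
    refine Finset.sum_eq_zero fun p hp => ?_
    have hp := mem_antidiagonal.1 hp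
    rcases Nat.eq_zero_or_pos p.1 with h0 | h0
    · rw [h0, ha, zero_mul]
    · rw [coeff_pow_eq_zero ha l (by omega), mul_zero]

end Euler

/-! ### The deformed derivatives -/

section Operators

variable {𝕜 : Type*} [RCLike 𝕜] {A : Type*} [CommRing A] [Algebra 𝕜 A]

variable (𝕜 A) in
/-- The operator `∂/∂t_k` for `k ≥ 1`, and `0` for `k = 0`. -/
def dtn (k : ℕ) : Module.End 𝕜 (MvPowerSeries ℕ+ A) :=
  if h : 0 < k then dt 𝕜 A ⟨k, h⟩ else 0

variable (A) in
/-- The coefficient `D_k` of `z^{-k}` in `Δ(z)`, so that `∂_k^ħ = k D_k`. -/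
def hD (ħ : 𝕜) (k : ℕ) : Module.End 𝕜 (MvPowerSeries ℕ+ A) :=
  PowerSeries.coeff k (opDelta A ħ)

theorem hderiv_eq (ħ : 𝕜) (k : ℕ) : hderiv A ħ k = (k : 𝕜) • hD A ħ k := rfl

@[simp] theorem dtn_zero : dtn 𝕜 A 0 = 0 := by simp [dtn]

@[simp] theorem hD_zero (ħ : 𝕜) : hD A ħ 0 = 0 := by simp [hD, opDelta]

theorem dt_apply (k : ℕ+) (G : MvPowerSeries ℕ+ A) :
    dt 𝕜 A k G = MvPowerSeries.pderiv A k G := rfl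

theorem dt_mul (k : ℕ+) (G H : MvPowerSeries ℕ+ A) :
    dt 𝕜 A k (G * H) = dt 𝕜 A k G * H + G * dt 𝕜 A k H := by
  simp only [dt_apply, Derivation.leibniz, smul_eq_mul]; ring

theorem dt_C (k : ℕ+) (a : A) : dt 𝕜 A k (MvPowerSeries.C a) = 0 := by
  simp [dt_apply]

theorem coeff_dt (k : ℕ+) (G : MvPowerSeries ℕ+ A) (n : ℕ+ →₀ ℕ) :
    MvPowerSeries.coeff n (dt 𝕜 A k G) =
      MvPowerSeries.coeff (n + Finsupp.single k 1) G * (n k + 1) := by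
  rw [dt_apply, MvPowerSeries.coeff_pderiv]

theorem commute_dt (i j : ℕ+) : Commute (dt 𝕜 A i) (dt 𝕜 A j) := by
  refine LinearMap.ext fun G => MvPowerSeries.ext fun n => ?_
  rw [Module.End.mul_apply, Module.End.mul_apply]
  simp only [coeff_dt, Finsupp.add_apply]
  rcases eq_or_ne i j with rfl | h
  · ring
  · rw [Finsupp.single_eq_of_ne h, Finsupp.single_eq_of_ne h.symm, add_right_comm]
    push_cast
    ring

theorem dtn_mul (k : ℕ) (G H : MvPowerSeries ℕ+ A) :
    dtn 𝕜 A k (G * H) = dtn 𝕜 A k G * H + G * dtn 𝕜 A k H := by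
  unfold dtn
  split_ifs
  · exact dt_mul _ _ _
  · simp

theorem dtn_C (k : ℕ) (a : A) : dtn 𝕜 A k (MvPowerSeries.C a) = 0 := by
  unfold dtn
  split_ifs
  · exact dt_C _ _
  · simp

theorem commute_dtn_of_forall {T : Module.End 𝕜 (MvPowerSeries ℕ+ A)}
    (hT : ∀ i, Commute T (dt 𝕜 A i)) (k : ℕ) : Commute T (dtn 𝕜 A k) := by
  unfold dtn
  split_ifs
  · exact hT _
  · exact Commute.zero_right T

theorem commute_dtn (i j : ℕ) : Commute (dtn 𝕜 A i) (dtn 𝕜 A j) :=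
  commute_dtn_of_forall (fun _ => (commute_dtn_of_forall (fun _ => commute_dt _ _) i).symm) j

theorem nsmul_coeff_opD (k : ℕ) : k • PowerSeries.coeff k (opD 𝕜 A) = dtn 𝕜 A k := by
  simp only [opD, PowerSeries.coeff_mk, dtn]
  split_ifs with h
  · rw [← Nat.cast_smul_eq_nsmul 𝕜, smul_smul, mul_inv_cancel₀ (by exact_mod_cast h.ne'), one_smul]
  · simp

theorem coeff_opD (k : ℕ) : PowerSeries.coeff k (opD 𝕜 A) = (k : 𝕜)⁻¹ • dtn 𝕜 A k := by
  simp only [opD, PowerSeries.coeff_mk, dtn]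
  split_ifs with h
  · rfl
  · simp

theorem coeff_opD_zero : PowerSeries.coeff 0 (opD 𝕜 A) = 0 := by simp [coeff_opD]

theorem hD_eq_sum_range (ħ : 𝕜) {k N : ℕ} (h : k ≤ N) :
    hD A ħ k = ∑ l ∈ range N,
      (ħ ^ l / ((l + 1).factorial : 𝕜)) • PowerSeries.coeff k (opD 𝕜 A ^ (l + 1)) := by
  have h1 : hD A ħ k = ∑ l ∈ range k,
      (ħ ^ l / ((l + 1).factorial : 𝕜)) • PowerSeries.coeff k (opD 𝕜 A ^ (l + 1)) := by
    rw [hD, opDelta, PowerSeries.coeff_mk, ← Finset.Ico_succ_right_eq_Icc,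
      Finset.sum_Ico_eq_sum_range]
    refine Finset.sum_congr (by simp) fun l _ => ?_
    rw [add_comm 1 l, Nat.add_sub_cancel]
  rw [h1]
  refine Finset.sum_subset (range_mono h) fun l _ hl => ?_
  rw [coeff_pow_eq_zero coeff_opD_zero _ (by simpa [Nat.lt_succ_iff] using hl), smul_zero]

/-- The coefficientwise form of `z d/dz exp (ħ D(z)) = ħ (z dD/dz) exp (ħ D(z))`, divided by `ħ`.
It determines the operators `D_k` recursively, also for `ħ = 0`. -/
theorem smul_hD (ħ : 𝕜) (k : ℕ) :
    (k : 𝕜) • hD A ħ k =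
      dtn 𝕜 A k + ħ • ∑ p ∈ antidiagonal k, dtn 𝕜 A p.1 * hD A ħ p.2 := by
  have hpow (l : ℕ) : (k : 𝕜) • PowerSeries.coeff k (opD 𝕜 A ^ (l + 1)) =
      ((l + 1 : ℕ) : 𝕜) • ∑ p ∈ antidiagonal k,
        dtn 𝕜 A p.1 * PowerSeries.coeff p.2 (opD 𝕜 A ^ l) := by
    have := congrArg (PowerSeries.coeff k) (euler_pow_succ (a := opD 𝕜 A) (fun i j => by
      rw [coeff_opD, coeff_opD]
      exact ((commute_dtn i j).smul_left _).smul_right _) l)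
    simp only [euler, PowerSeries.coeff_mk, map_nsmul, PowerSeries.coeff_mul,
      nsmul_coeff_opD] at this
    rw [Nat.cast_smul_eq_nsmul, Nat.cast_smul_eq_nsmul, this]
  rcases k with _ | k
  · simp
  rw [hD_eq_sum_range ħ le_rfl, Finset.smul_sum]
  have hfac (l : ℕ) : ((k + 1 : ℕ) : 𝕜) • (ħ ^ l / ((l + 1).factorial : 𝕜)) •
      PowerSeries.coeff (k + 1) (opD 𝕜 A ^ (l + 1)) = (ħ ^ l / (l.factorial : 𝕜)) •
        ∑ p ∈ antidiagonal (k + 1), dtn 𝕜 A p.1 * PowerSeries.coeff p.2 (opD 𝕜 A ^ l) := by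
    rw [smul_comm, hpow, smul_smul, Nat.factorial_succ]
    congr 1
    have h1 : ((l + 1 : ℕ) : 𝕜) ≠ 0 := by exact_mod_cast l.succ_ne_zero
    have h2 : (l.factorial : 𝕜) ≠ 0 := by exact_mod_cast l.factorial_ne_zero
    push_cast at h1 ⊢
    field_simp
  rw [Finset.sum_congr rfl fun l _ => hfac l, Finset.sum_range_succ', add_comm]
  congr 1
  · rw [Finset.sum_eq_single (k + 1, 0)]
    · simp
    · intro p hp hne
      rw [pow_zero, PowerSeries.coeff_one, if_neg, mul_zero]
      intro h0
      exact hne (Prod.ext (by simpa [h0] using mem_antidiagonal.1 hp) h0)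
    · simp
  · have (p) (hp : p ∈ antidiagonal (k + 1)) : dtn 𝕜 A p.1 * hD A ħ p.2 =
        ∑ l ∈ range k, (ħ ^ l / ((l + 1).factorial : 𝕜)) •
          (dtn 𝕜 A p.1 * PowerSeries.coeff p.2 (opD 𝕜 A ^ (l + 1))) := by
      rcases Nat.eq_zero_or_pos p.1 with h0 | h0
      · simp [h0]
      · rw [hD_eq_sum_range ħ (N := k) (by have := mem_antidiagonal.1 hp; omega), Finset.mul_sum]
        simp only [mul_smul_comm]
    rw [Finset.sum_congr rfl this, Finset.sum_comm, Finset.smul_sum]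
    refine Finset.sum_congr rfl fun l _ => ?_
    rw [← Finset.smul_sum, smul_smul, pow_succ']
    congr 1
    ring

theorem commute_hD_of_forall {T : Module.End 𝕜 (MvPowerSeries ℕ+ A)}
    (hT : ∀ k, Commute T (dt 𝕜 A k)) (ħ : 𝕜) (k : ℕ) : Commute T (hD A ħ k) := by
  induction k using Nat.strong_induction_on with
  | _ k ih =>
    rcases Nat.eq_zero_or_pos k with rfl | hk
    · rw [hD_zero]; exact Commute.zero_right T
    · have h : Commute T ((k : 𝕜) • hD A ħ k) := by
        rw [smul_hD]
        refine (commute_dtn_of_forall hT k).add_right (Commute.smul_right ?_ ħ)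
        refine Commute.sum_right _ _ _ fun p hp => ?_
        rcases Nat.eq_zero_or_pos p.1 with h0 | h0
        · simp [h0]
        · exact (commute_dtn_of_forall hT _).mul_right
            (ih _ (by have := mem_antidiagonal.1 hp; omega))
      have hk' : (k : 𝕜) ≠ 0 := by exact_mod_cast hk.ne'
      have := h.smul_right (k : 𝕜)⁻¹
      rwa [smul_smul, inv_mul_cancel₀ hk', one_smul] at this

theorem commute_dt_hD (ħ : 𝕜) (i : ℕ+) (k : ℕ) : Commute (dt 𝕜 A i) (hD A ħ k) :=
  commute_hD_of_forall (fun _ => commute_dt _ _) ħ k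

theorem commute_hD (ħ : 𝕜) (i k : ℕ) : Commute (hD A ħ i) (hD A ħ k) :=
  commute_hD_of_forall (fun j => (commute_dt_hD ħ j i).symm) ħ k

theorem commute_hderiv (ħ : 𝕜) (i k : ℕ) : Commute (hderiv A ħ i) (hderiv A ħ k) := by
  rw [hderiv_eq, hderiv_eq]
  exact ((commute_hD ħ i k).smul_left _).smul_right _

theorem commute_dt_hderiv (ħ : 𝕜) (i : ℕ+) (k : ℕ) : Commute (dt 𝕜 A i) (hderiv A ħ k) := by
  rw [hderiv_eq]
  exact (commute_dt_hD ħ i k).smul_right _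

theorem hD_one (ħ : 𝕜) : hD A ħ 1 = dt 𝕜 A 1 := by
  have := smul_hD (A := A) ħ 1
  simp only [Nat.cast_one, one_smul, Finset.Nat.antidiagonal_succ, Finset.sum_cons] at this
  simpa [dtn] using this

theorem hD_C (ħ : 𝕜) (k : ℕ) (a : A) : hD A ħ k (MvPowerSeries.C a) = 0 := by
  have h : (k : 𝕜) • hD A ħ k (MvPowerSeries.C a) = 0 := by
    rw [← LinearMap.smul_apply, smul_hD]
    simp only [LinearMap.add_apply, dtn_C, LinearMap.smul_apply, LinearMap.sum_apply, zero_add]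
    refine smul_eq_zero_of_right _ (Finset.sum_eq_zero fun p _ => ?_)
    rw [((commute_hD_of_forall (fun j => (commute_dtn_of_forall
      (fun i => commute_dt j i) p.1).symm) ħ p.2)).eq, Module.End.mul_apply, dtn_C, map_zero]
  rcases Nat.eq_zero_or_pos k with rfl | hk
  · simp
  · rwa [smul_eq_zero_iff_right (by exact_mod_cast hk.ne')] at h

/-- The generating series `Δ(z) G` as a power series in `z^{-1}`. -/
def deltaSeries (ħ : 𝕜) (G : MvPowerSeries ℕ+ A) : PowerSeries (MvPowerSeries ℕ+ A) :=
  PowerSeries.mk fun k => hD A ħ k G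

variable (𝕜) in
/-- The derivation `∑_{k ≥ 1} u^k ∂_k` of power series in `u = z^{-1}`. -/
def opP (H : PowerSeries (MvPowerSeries ℕ+ A)) : PowerSeries (MvPowerSeries ℕ+ A) :=
  PowerSeries.mk fun n => ∑ p ∈ antidiagonal n, dtn 𝕜 A p.1 (PowerSeries.coeff p.2 H)

theorem opP_mul (H K : PowerSeries (MvPowerSeries ℕ+ A)) :
    opP 𝕜 (H * K) = opP 𝕜 H * K + H * opP 𝕜 K := by
  ext1 n
  simp only [opP, PowerSeries.coeff_mk, PowerSeries.coeff_mul, map_add, map_sum, dtn_mul,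
    Finset.sum_add_distrib, Finset.sum_mul, Finset.mul_sum]
  congr 1
  · exact sum_antidiagonal_assoc n fun a b c =>
      dtn 𝕜 A a (PowerSeries.coeff b H) * PowerSeries.coeff c K
  · exact sum_antidiagonal_left_comm n fun a b c =>
      PowerSeries.coeff b H * dtn 𝕜 A a (PowerSeries.coeff c K)

theorem opP_add (H K : PowerSeries (MvPowerSeries ℕ+ A)) :
    opP 𝕜 (H + K) = opP 𝕜 H + opP 𝕜 K := by
  ext1 n
  simp [opP, Finset.sum_add_distrib]

theorem opP_smul (c : 𝕜) (H : PowerSeries (MvPowerSeries ℕ+ A)) :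
    opP 𝕜 (c • H) = c • opP 𝕜 H := by
  ext1 n
  simp [opP, Finset.smul_sum]

theorem euler_deltaSeries (ħ : 𝕜) (G : MvPowerSeries ℕ+ A) :
    euler (deltaSeries ħ G) = opP 𝕜 (PowerSeries.C G) + ħ • opP 𝕜 (deltaSeries ħ G) := by
  ext1 n
  have := congrArg (fun T => T G) (smul_hD (A := A) ħ n)
  simp only [LinearMap.smul_apply, LinearMap.add_apply, LinearMap.sum_apply,
    Module.End.mul_apply] at this
  simp only [euler, deltaSeries, opP, PowerSeries.coeff_mk, map_add, PowerSeries.coeff_smul]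
  rw [← Nat.cast_smul_eq_nsmul 𝕜, this]
  congr 1
  rw [Finset.sum_eq_single (n, 0)]
  · simp
  · intro p hp hne
    rw [PowerSeries.coeff_C, if_neg, map_zero]
    intro h0
    exact hne (Prod.ext (by simpa [h0] using mem_antidiagonal.1 hp) h0)
  · simp

theorem eq_deltaSeries_of_euler {ħ : 𝕜} {G : MvPowerSeries ℕ+ A}
    {w : PowerSeries (MvPowerSeries ℕ+ A)} (h0 : PowerSeries.coeff 0 w = 0)
    (h : euler w = opP 𝕜 (PowerSeries.C G) + ħ • opP 𝕜 w) : w = deltaSeries ħ G := by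
  ext1 n
  induction n using Nat.strong_induction_on with
  | _ n ih =>
    rcases Nat.eq_zero_or_pos n with rfl | hn
    · simp [h0, deltaSeries]
    · have h1 := congrArg (PowerSeries.coeff n) h
      have h2 := congrArg (PowerSeries.coeff n) (euler_deltaSeries ħ G)
      have h3 : PowerSeries.coeff n (opP 𝕜 w) = PowerSeries.coeff n (opP 𝕜 (deltaSeries ħ G)) := by
        simp only [opP, PowerSeries.coeff_mk]
        refine Finset.sum_congr rfl fun p hp => ?_
        rcases Nat.eq_zero_or_pos p.1 with hp0 | hp0
        · simp [hp0]
        · rw [ih _ (by have := mem_antidiagonal.1 hp; omega)]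
      rw [map_add, PowerSeries.coeff_smul, h3, ← PowerSeries.coeff_smul, ← map_add, ← h2] at h1
      simp only [euler, PowerSeries.coeff_mk] at h1
      rw [← Nat.cast_smul_eq_nsmul 𝕜, ← Nat.cast_smul_eq_nsmul 𝕜] at h1
      exact (smul_right_injective _ (by exact_mod_cast hn.ne' : (n : 𝕜) ≠ 0)) h1

theorem deltaSeries_mul (ħ : 𝕜) (G H : MvPowerSeries ℕ+ A) :
    deltaSeries ħ (G * H) = deltaSeries ħ G * PowerSeries.C H + PowerSeries.C G * deltaSeries ħ H +
      ħ • (deltaSeries ħ G * deltaSeries ħ H) := by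
  symm
  refine eq_deltaSeries_of_euler ?_ ?_
  · simp [deltaSeries]
  · have hadd (a b : PowerSeries (MvPowerSeries ℕ+ A)) : euler (a + b) = euler a + euler b := by
      ext1; simp [euler]
    have hsmul (a : PowerSeries (MvPowerSeries ℕ+ A)) : euler (ħ • a) = ħ • euler a := by
      ext1 n; simp [euler]
    have hC (a : MvPowerSeries ℕ+ A) : euler (PowerSeries.C a) = 0 := by
      ext1 n
      rcases n with _ | n <;> simp [euler, PowerSeries.coeff_C]
    simp only [hadd, hsmul, euler_mul, euler_deltaSeries, hC, opP_add, opP_smul, opP_mul, map_mul]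
    simp only [Algebra.smul_def]
    ring

/-- The deformed Leibniz rule. -/
theorem hD_mul (ħ : 𝕜) (k : ℕ) (G H : MvPowerSeries ℕ+ A) :
    hD A ħ k (G * H) = hD A ħ k G * H + G * hD A ħ k H +
      ħ • ∑ p ∈ antidiagonal k, hD A ħ p.1 G * hD A ħ p.2 H := by
  have := congrArg (PowerSeries.coeff k) (deltaSeries_mul ħ G H)
  rw [map_add, map_add, PowerSeries.coeff_smul, PowerSeries.coeff_mul_C, PowerSeries.coeff_C_mul,
    PowerSeries.coeff_mul] at this
  simpa only [deltaSeries, PowerSeries.coeff_mk] using this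

theorem hD_X (ħ : 𝕜) {k : ℕ} (hk : 0 < k) (j : ℕ+) :
    hD A ħ k (MvPowerSeries.X j) = if k = j then (k : 𝕜)⁻¹ • 1 else 0 := by
  have hdt (i : ℕ) : dtn 𝕜 A i (MvPowerSeries.X j) = MvPowerSeries.C (if i = j then 1 else 0) := by
    rcases Nat.eq_zero_or_pos i with rfl | hi
    · simp [(j.pos.ne : 0 ≠ (j : ℕ))]
    · lift i to ℕ+ using hi
      rw [show dtn 𝕜 A i = dt 𝕜 A i from dif_pos i.pos, dt_apply]
      split_ifs with h
      · obtain rfl : i = j := PNat.coe_injective h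
        simp
      · rw [MvPowerSeries.pderiv_X_of_ne (by rintro rfl; exact h rfl), map_zero]
  have hk' : (k : 𝕜) ≠ 0 := by exact_mod_cast hk.ne'
  have h : (k : 𝕜) • hD A ħ k (MvPowerSeries.X j) = if k = j then 1 else 0 := by
    rw [← LinearMap.smul_apply, smul_hD]
    simp only [LinearMap.add_apply, hdt, LinearMap.smul_apply, LinearMap.sum_apply]
    rw [Finset.sum_eq_zero, smul_zero, add_zero]
    · split_ifs <;> simp
    · intro p _
      rw [((commute_hD_of_forall (fun j => (commute_dtn_of_forall
        (fun i => commute_dt j i) p.1).symm) ħ p.2)).eq, Module.End.mul_apply, hdt, hD_C]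
  rw [← inv_smul_smul₀ hk' (hD A ħ k (MvPowerSeries.X j)), h]
  split_ifs <;> simp

end Operators

/-! ### Maps with prescribed fibre sums -/

section Fibers

/-- The maps `g` from `ι` to the positions of the list `l` for which the fibre over every
position `i` has total weight `l_i`. -/
def fiberMaps {ι : Type} [Fintype ι] [DecidableEq ι] (ν : ι → ℕ) (l : List ℕ) :
    Finset (ι → Fin l.length) :=
  univ.filter fun g => ∀ i, ∑ j ∈ univ.filter (fun j => g j = i), ν j = l.get i

variable {ι : Type} [Fintype ι] [DecidableEq ι]

theorem mem_fiberMaps {ν : ι → ℕ} {l : List ℕ} {g : ι → Fin l.length} :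
    g ∈ fiberMaps ν l ↔ ∀ i, ∑ j ∈ univ.filter (fun j => g j = i), ν j = l.get i := by
  simp [fiberMaps]

theorem surjective_of_mem_fiberMaps {ν : ι → ℕ} {l : List ℕ} (hl : ∀ k ∈ l, 0 < k)
    {g : ι → Fin l.length} (hg : g ∈ fiberMaps ν l) : Function.Surjective g := by
  intro i
  by_contra h
  have h1 := mem_fiberMaps.1 hg i
  rw [Finset.filter_false_of_mem (fun j _ hj => h ⟨j, hj⟩), Finset.sum_empty] at h1
  exact (hl _ (l.get_mem i)).ne h1

theorem card_fiberMaps_cons (ν : ι → ℕ) (k : ℕ) (l : List ℕ) :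
    (fiberMaps ν (k :: l)).card = ∑ S : Finset ι,
      if ∑ j ∈ S, ν j = k then (fiberMaps (fun j : {j // j ∉ S} => ν j) l).card else 0 := by
  rw [Finset.card_eq_sum_card_fiberwise (f := fun g => univ.filter fun j => g j = 0)
    (t := univ) (fun _ _ => by simp)]
  refine Finset.sum_congr rfl fun S _ => ?_
  -- a map with zero fibre `S` is a map on the complement of `S`
  have key (g : ι → Fin (k :: l).length) (hg : (univ.filter fun j => g j = 0) = S)
      (g' : {j // j ∉ S} → Fin l.length) (h : ∀ j : {j // j ∉ S}, g j = (g' j).succ) :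
      g ∈ fiberMaps ν (k :: l) ↔ ∑ j ∈ S, ν j = k ∧ g' ∈ fiberMaps (fun j : {j // j ∉ S} => ν j) l := by
    have hsum (i : Fin l.length) : ∑ j ∈ univ.filter (fun j => g j = i.succ), ν j =
        ∑ j ∈ univ.filter (fun j => g' j = i), ν j := by
      symm
      refine Finset.sum_bij (fun j _ => j.1) ?_ ?_ ?_ ?_
      · intro j hj
        simpa [h] using hj
      · intro a _ b _ hab
        exact Subtype.ext hab
      · intro j hj
        have hj : g j = i.succ := by simpa using hj
        have hjS : j ∉ S := by
          rw [← hg]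
          simp [hj]
        refine ⟨⟨j, hjS⟩, ?_, rfl⟩
        simpa [h ⟨j, hjS⟩] using hj
      · intro _ _
        rfl
    rw [mem_fiberMaps, mem_fiberMaps]
    constructor
    · intro H
      refine ⟨?_, fun i => ?_⟩
      · have := H ⟨0, by simp⟩
        rw [← hg]
        exact this
      · rw [← hsum]
        exact H i.succ
    · rintro ⟨H0, H⟩ i
      refine Fin.cases ?_ (fun i => ?_) i
      · rw [hg, H0]
        rfl
      · rw [hsum, H]
        rfl
  split_ifs with hS
  · refine Finset.card_bij' (i := fun g hg j => (g j).pred (by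
        have hj : (j : ι) ∉ univ.filter fun j => g j = 0 := (Finset.mem_filter.1 hg).2.symm ▸ j.2
        simpa using hj))
      (j := fun g' _ j => if h : j ∈ S then 0 else (g' ⟨j, h⟩).succ) ?_ ?_ ?_ ?_
    · intro g hg
      obtain ⟨h1, h2⟩ := Finset.mem_filter.1 hg
      exact ((key g h2 _ (fun j => by simp)).1 h1).2
    · intro g' hg'
      have h2 : (univ.filter fun j => (if h : j ∈ S then (0 : Fin (k :: l).length)
          else (g' ⟨j, h⟩).succ) = 0) = S := by
        ext j
        by_cases h : j ∈ S <;> simp [h, Fin.succ_ne_zero]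
      exact Finset.mem_filter.2 ⟨(key _ h2 g' (fun j => by simp [j.2])).2 ⟨hS, hg'⟩, h2⟩
    · intro g hg
      obtain ⟨h1, h2⟩ := Finset.mem_filter.1 hg
      funext j
      by_cases h : j ∈ S
      · simp only [h, dite_true]
        rw [← h2] at h
        exact (by simpa using h : g j = 0).symm
      · simp [h]
    · intro g' hg'
      funext j
      simp [j.2]
  · rw [Finset.card_eq_zero, Finset.filter_eq_empty_iff]
    intro g hg h2
    apply hS
    rw [← h2]
    exact mem_fiberMaps.1 hg 0

end Fibers

/-! ### Deformed derivatives of monomials -/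

section Monomials

variable {𝕜 : Type*} [RCLike 𝕜] {A : Type*} [CommRing A] [Algebra 𝕜 A]

theorem hD_prod_X (ħ : 𝕜) {ι : Type} [DecidableEq ι] (ν : ι → ℕ+) (s : Finset ι) (k : ℕ) :
    hD A ħ k (∏ j ∈ s, MvPowerSeries.X (ν j)) =
      ∑ S ∈ s.powerset, if S.Nonempty ∧ ∑ j ∈ S, (ν j : ℕ) = k then
        (ħ ^ (S.card - 1) * ∏ j ∈ S, ((ν j : ℕ) : 𝕜)⁻¹) •
          ∏ j ∈ s \ S, (MvPowerSeries.X (ν j) : MvPowerSeries ℕ+ A) else 0 := by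
  induction s using Finset.induction_on generalizing k with
  | empty =>
    have := hD_C (A := A) ħ k 1
    rw [map_one] at this
    simpa using this
  | insert a s ha ih =>
    rw [Finset.prod_insert ha, hD_mul, Finset.sum_powerset_insert ha, add_comm (hD A ħ k _ * _),
      add_assoc]
    congr 1
    · rw [ih, Finset.mul_sum]
      refine Finset.sum_congr rfl fun S hS => ?_
      have haS : a ∉ S := fun h => ha (Finset.mem_powerset.1 hS h)
      rw [Finset.insert_sdiff_of_notMem _ haS, Finset.prod_insert (by simp [ha]), mul_ite,
        mul_smul_comm, mul_zero]
    · have hX (i : ℕ) : hD A ħ i (MvPowerSeries.X (ν a)) =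
          if i = ν a then ((ν a : ℕ) : 𝕜)⁻¹ • 1 else 0 := by
        rcases Nat.eq_zero_or_pos i with rfl | hi
        · simp [(ν a).pos.ne]
        · rw [hD_X ħ hi]
          split_ifs with h
          · rw [h]
          · rfl
      rw [← Finset.sum_erase_add _ _ (Finset.empty_mem_powerset s), add_comm]
      congr 1
      · -- the subsets other than `{a}` that contain `a`
        have hsum : ∑ p ∈ antidiagonal k, hD A ħ p.1 (MvPowerSeries.X (ν a)) *
            hD A ħ p.2 (∏ j ∈ s, MvPowerSeries.X (ν j)) =
            if (ν a : ℕ) ≤ k then ((ν a : ℕ) : 𝕜)⁻¹ •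
              hD A ħ (k - ν a) (∏ j ∈ s, MvPowerSeries.X (ν j)) else 0 := by
          split_ifs with hk
          · rw [Finset.sum_eq_single ((ν a : ℕ), k - ν a)]
            · simp [hX]
            · intro p hp hne
              rw [hX, if_neg, zero_mul]
              intro h
              have := mem_antidiagonal.1 hp
              exact hne (Prod.ext h (by simp only; omega))
            · intro h
              exact absurd (mem_antidiagonal.2 (by simp only; omega)) h
          · refine Finset.sum_eq_zero fun p hp => ?_
            rw [hX, if_neg, zero_mul]
            have := mem_antidiagonal.1 hp
            omega
        rw [hsum]
        have herase : ∀ S ∈ s.powerset.erase ∅, S.Nonempty ∧ a ∉ S := fun S hS =>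
          ⟨Finset.nonempty_iff_ne_empty.2 (Finset.mem_erase.1 hS).1,
            fun h => ha (Finset.mem_powerset.1 (Finset.mem_erase.1 hS).2 h)⟩
        split_ifs with hk
        · rw [ih, ← Finset.sum_erase_add _ _ (Finset.empty_mem_powerset s), if_neg (by simp),
            add_zero, smul_smul, Finset.smul_sum]
          refine Finset.sum_congr rfl fun S hS => ?_
          obtain ⟨hne, haS⟩ := herase S hS
          have hcard : S.card ≠ 0 := Finset.card_ne_zero.2 hne
          have hiff : (∑ j ∈ S, (ν j : ℕ) = k - ν a) ↔ ((ν a : ℕ) + ∑ j ∈ S, (ν j : ℕ) = k) := by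
            omega
          simp only [hne, true_and, Finset.insert_nonempty, Finset.sum_insert haS, hiff]
          rw [smul_ite, smul_zero]
          split_ifs
          · rw [smul_smul, Finset.prod_insert haS, Finset.card_insert_of_notMem haS,
              Finset.insert_sdiff_insert, Finset.sdiff_insert_of_notMem ha, Nat.add_sub_cancel]
            congr 1
            obtain ⟨c, hc⟩ := Nat.exists_eq_succ_of_ne_zero hcard
            rw [hc, Nat.succ_sub_one, pow_succ]
            ring
          · rfl
        · rw [smul_zero]
          symm
          refine Finset.sum_eq_zero fun S hS => if_neg ?_
          rw [Finset.sum_insert (herase S hS).2]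
          omega
      · rw [hX]
        simp only [insert_empty_eq, Finset.singleton_nonempty, true_and, Finset.sum_singleton,
          eq_comm (a := k)]
        split_ifs
        · simp [Finset.sdiff_singleton_eq_erase, Finset.erase_insert ha]
        · simp

variable (A) in
/-- The composite `D_{l_1} ⋯ D_{l_r}`. -/
def opsD (ħ : 𝕜) (l : List ℕ) : Module.End 𝕜 (MvPowerSeries ℕ+ A) := (l.map (hD A ħ)).prod

@[simp] theorem opsD_nil (ħ : 𝕜) : opsD A ħ [] = 1 := rfl

theorem opsD_cons (ħ : 𝕜) (k : ℕ) (l : List ℕ) : opsD A ħ (k :: l) = hD A ħ k * opsD A ħ l := by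
  simp [opsD]

theorem opsD_append (ħ : 𝕜) (l l' : List ℕ) :
    opsD A ħ (l ++ l') = opsD A ħ l * opsD A ħ l' := by
  simp [opsD]

theorem opsD_perm (ħ : 𝕜) {l l' : List ℕ} (h : l.Perm l') : opsD A ħ l = opsD A ħ l' := by
  refine (h.map _).prod_eq' ?_
  refine List.Pairwise.imp_of_mem (R := fun _ _ => True) ?_ ?_
  · intro a b ha hb _
    obtain ⟨i, -, rfl⟩ := List.mem_map.1 ha
    obtain ⟨j, -, rfl⟩ := List.mem_map.1 hb
    exact commute_hD ħ i j
  · exact List.pairwise_of_forall fun _ _ => trivial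

theorem opsD_cons' (ħ : 𝕜) (k : ℕ) (l : List ℕ) :
    opsD A ħ (k :: l) = opsD A ħ l * hD A ħ k := by
  have h : (k :: l).Perm (l ++ [k]) := List.perm_append_comm (l₁ := [k])
  rw [opsD_perm ħ h, opsD_append, opsD_cons, opsD_nil, mul_one]

/-- Pairing of `D_{l_1} ⋯ D_{l_r}` with the monomial `∏ t_{ν_j}`: up to the powers of `ħ` and the
factors `1 / ν_j`, it counts the maps `g` whose fibre sums are the `l_i`. -/
theorem constantCoeff_opsD_prod_X (ħ : 𝕜) (l : List ℕ) (hl : ∀ k ∈ l, 0 < k) {ι : Type}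
    [Fintype ι] [DecidableEq ι] (ν : ι → ℕ+) :
    MvPowerSeries.constantCoeff (opsD A ħ l (∏ j, MvPowerSeries.X (ν j))) =
      algebraMap 𝕜 A (ħ ^ (Fintype.card ι - l.length) * (∏ j, ((ν j : ℕ) : 𝕜)⁻¹) *
        (fiberMaps (fun j => (ν j : ℕ)) l).card) := by
  induction l generalizing ι with
  | nil =>
    rw [opsD_nil, Module.End.one_apply]
    rcases isEmpty_or_nonempty ι with h | ⟨⟨i⟩⟩
    · have : (fiberMaps (fun j => (ν j : ℕ)) []).card = 1 := by
        rw [Finset.card_eq_one]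
        refine ⟨fun i => (h.false i).elim, ?_⟩
        ext g
        simp only [mem_fiberMaps, Finset.mem_singleton]
        exact ⟨fun _ => Subsingleton.elim _ _, fun _ i => i.elim0⟩
      rw [this]
      simp
    · have : (fiberMaps (fun j => (ν j : ℕ)) []).card = 0 := by
        rw [Finset.card_eq_zero, Finset.eq_empty_iff_forall_notMem]
        intro g
        exact (g i).elim0
      rw [this, map_prod, Finset.prod_eq_zero (Finset.mem_univ i)]
      · simp
      · simp
  | cons k l ih =>
    have hk : 0 < k := hl k (by simp)
    have hl' : ∀ k ∈ l, 0 < k := fun k hk => hl k (by simp [hk])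
    rw [opsD_cons', Module.End.mul_apply, hD_prod_X, map_sum, map_sum, Finset.powerset_univ,
      card_fiberMaps_cons, Nat.cast_sum, Finset.mul_sum, map_sum]
    refine Finset.sum_congr rfl fun S _ => ?_
    by_cases hS : ∑ j ∈ S, (ν j : ℕ) = k
    · have hne : S.Nonempty := by
        rw [Finset.nonempty_iff_ne_empty]
        rintro rfl
        simp at hS
        omega
      rw [if_pos ⟨hne, hS⟩, if_pos hS, LinearMap.map_smul_of_tower, MvPowerSeries.constantCoeff_smul,
        Finset.prod_subtype (univ \ S) (p := fun j => j ∉ S) (by simp), ih hl', Algebra.smul_def, ← map_mul]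
      congr 1
      have hprod : (∏ j, ((ν j : ℕ) : 𝕜)⁻¹) =
          (∏ j ∈ S, ((ν j : ℕ) : 𝕜)⁻¹) * ∏ j : {j // j ∉ S}, ((ν j : ℕ) : 𝕜)⁻¹ := by
        rw [← Finset.prod_mul_prod_compl S]
        congr 1
        exact Finset.prod_subtype _ (by simp) _
      rcases Nat.eq_zero_or_pos (fiberMaps (fun j : {j // j ∉ S} => (ν j : ℕ)) l).card with h0 | h0
      · rw [h0]
        simp
      · obtain ⟨g, hg⟩ := Finset.card_pos.1 h0
        have h1 := Fintype.card_le_of_surjective g (surjective_of_mem_fiberMaps hl' hg)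
        have h2 : Fintype.card {j // j ∉ S} = Fintype.card ι - S.card := by
          rw [Fintype.card_subtype_compl]
          simp
        have h3 : S.card ≤ Fintype.card ι := Finset.card_le_univ S
        have h4 : 0 < S.card := Finset.card_pos.2 hne
        rw [Fintype.card_fin] at h1
        have h5 : Fintype.card ι - (k :: l).length =
            S.card - 1 + (Fintype.card {j // j ∉ S} - l.length) := by
          rw [List.length_cons]
          omega
        rw [hprod, h5, pow_add]
        ring
    · rw [if_neg (fun h => hS h.2), if_neg hS]
      simp

end Monomials

/-! ### Partitions and exponents -/

section Exponents

variable {n : ℕ}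

/-- The exponent of the monomial `t_λ`. -/
def expo (q : n.Partition) : ℕ+ →₀ ℕ := Multiset.toFinsupp (q.parts.map Nat.toPNat')

theorem coe_rows (q : n.Partition) : (rows q : Multiset ℕ) = q.parts := Multiset.sort_eq _ _

theorem mem_rows {q : n.Partition} {k : ℕ} : k ∈ rows q ↔ k ∈ q.parts := Multiset.mem_sort _

theorem rows_pos {q : n.Partition} {k : ℕ} (h : k ∈ rows q) : 0 < k :=
  q.parts_pos (mem_rows.1 h)

theorem length_rows (q : n.Partition) : (rows q).length = len q := by
  rw [len, ← coe_rows, Multiset.coe_card]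

theorem sum_rows (q : n.Partition) : (rows q).sum = n := by
  have := q.parts_sum
  rwa [← coe_rows, Multiset.sum_coe] at this

theorem prod_rows (q : n.Partition) : (rows q).prod = rho q := by
  rw [rho, ← coe_rows, Multiset.prod_coe]

theorem rho_ne_zero (𝕜 : Type*) [RCLike 𝕜] (q : n.Partition) : (rho q : 𝕜) ≠ 0 := by
  rw [Nat.cast_ne_zero, rho]
  exact Multiset.prod_ne_zero fun h => (q.parts_pos h).ne rfl

theorem sigma_ne_zero (𝕜 : Type*) [RCLike 𝕜] (q : n.Partition) : (sigma q : 𝕜) ≠ 0 := by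
  rw [Nat.cast_ne_zero, sigma]
  exact Finset.prod_ne_zero_iff.2 fun k _ => Nat.factorial_ne_zero _

theorem map_coe_map_toPNat' {s : Multiset ℕ} (hs : ∀ k ∈ s, 0 < k) :
    (s.map Nat.toPNat').map ((↑) : ℕ+ → ℕ) = s := by
  rw [Multiset.map_map]
  conv_rhs => rw [← Multiset.map_id s]
  refine Multiset.map_congr rfl fun k hk => ?_
  simp [Nat.toPNat'_coe, hs k hk]

theorem expo_injective : Function.Injective (expo (n := n)) := by
  intro p q h
  refine Nat.Partition.ext ?_
  have := congrArg (Multiset.map ((↑) : ℕ+ → ℕ)) (Multiset.toFinsupp.injective h)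
  rwa [map_coe_map_toPNat' fun _ => p.parts_pos, map_coe_map_toPNat' fun _ => q.parts_pos] at this

theorem weight_eq (α : ℕ+ →₀ ℕ) :
    weight α = ((Finsupp.toMultiset α).map ((↑) : ℕ+ → ℕ)).sum := by
  induction α using Finsupp.induction_linear with
  | zero => simp [weight]
  | add α β hα hβ =>
    rw [map_add, Multiset.map_add, Multiset.sum_add, ← hα, ← hβ]
    exact Finsupp.sum_add_index' (by simp) (by intros; ring)
  | single k e => simp [weight, mul_comm, Multiset.map_nsmul, Multiset.sum_nsmul]

theorem weight_add (α β : ℕ+ →₀ ℕ) : weight (α + β) = weight α + weight β := by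
  simp [weight_eq]

theorem weight_single (k : ℕ+) : weight (Finsupp.single k 1) = k := by
  simp [weight]

theorem weight_eq_zero {α : ℕ+ →₀ ℕ} (h : weight α = 0) : α = 0 := by
  ext k
  by_contra hk
  have := (Finset.sum_eq_zero_iff.1 h) k (Finsupp.mem_support_iff.2 hk)
  simp at this
  exact hk this

theorem weight_expo (q : n.Partition) : weight (expo q) = n := by
  rw [weight_eq, expo, Multiset.toFinsupp_toMultiset, map_coe_map_toPNat' fun _ => q.parts_pos,
    q.parts_sum]

theorem exists_expo {α : ℕ+ →₀ ℕ} (h : weight α = n) : ∃ q : n.Partition, expo q = α := by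
  refine ⟨⟨(Finsupp.toMultiset α).map (↑), ?_, ?_⟩, ?_⟩
  · intro i hi
    obtain ⟨k, -, rfl⟩ := Multiset.mem_map.1 hi
    exact k.pos
  · rw [← weight_eq, h]
  · simp [expo, Multiset.map_map]

theorem tMonomial_eq {𝕜 : Type*} [RCLike 𝕜] (q : n.Partition) :
    tMonomial 𝕜 q = MvPolynomial.monomial (expo q) 1 := by
  rw [tMonomial, expo]
  induction q.parts using Multiset.induction_on with
  | empty => simp
  | cons a s ih =>
    rw [Multiset.map_cons, Multiset.prod_cons, ih, Multiset.map_cons,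
      ← Multiset.singleton_add, Multiset.toFinsupp_add, Multiset.toFinsupp_singleton,
      MvPolynomial.X, MvPolynomial.monomial_mul, one_mul]

theorem monomial_expo {A : Type*} [CommRing A] (q : n.Partition) :
    (MvPowerSeries.monomial (expo q) 1 : MvPowerSeries ℕ+ A) =
      ∏ j : Fin (rows q).length, MvPowerSeries.X ((rows q).get j).toPNat' := by
  have h1 : ∏ j : Fin (rows q).length, (MvPowerSeries.X ((rows q).get j).toPNat') =
      (q.parts.map fun k => (MvPowerSeries.X k.toPNat' : MvPowerSeries ℕ+ A)).prod := by
    rw [← coe_rows, Multiset.map_coe, Multiset.prod_coe, ← Fin.prod_univ_fun_getElem]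
    rfl
  rw [h1, expo]
  induction q.parts using Multiset.induction_on with
  | empty => simp
  | cons a s ih =>
    rw [Multiset.map_cons, Multiset.map_cons, Multiset.prod_cons, ← ih,
      ← Multiset.singleton_add, Multiset.toFinsupp_add, Multiset.toFinsupp_singleton,
      MvPowerSeries.X, MvPowerSeries.monomial_mul_monomial, one_mul]

end Exponents

/-! ### The transition matrix -/

section Transition

variable {n : ℕ}

theorem transL_eq (p q : n.Partition) :
    transL n p q = ((fiberMaps (rows p).get (rows q)).card : ℚ) := by
  rw [transL, fiberMaps, Fintype.card_subtype]

theorem transL_eq_zero {p q : n.Partition} (h : len p < len q) : transL n p q = 0 := by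
  rw [transL_eq, Nat.cast_eq_zero, Finset.card_eq_zero, Finset.eq_empty_iff_forall_notMem]
  intro g hg
  have := Fintype.card_le_of_surjective g (surjective_of_mem_fiberMaps (fun _ => rows_pos) hg)
  rw [Fintype.card_fin, Fintype.card_fin, length_rows, length_rows] at this
  omega

theorem transL_self_ne_zero (p : n.Partition) : transL n p p ≠ 0 := by
  rw [transL_eq, Nat.cast_ne_zero]
  refine Finset.card_ne_zero_of_mem (a := id) ?_
  rw [mem_fiberMaps]
  intro i
  simp [Finset.filter_eq']

theorem eq_of_transL_ne_zero {p q : n.Partition} (h : transL n p q ≠ 0) (hlen : len p = len q) :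
    p = q := by
  rw [transL_eq, Nat.cast_ne_zero] at h
  obtain ⟨g, hg⟩ := Finset.card_pos.1 (Nat.pos_of_ne_zero h)
  have hsurj := surjective_of_mem_fiberMaps (fun _ => rows_pos) hg
  have hbij : Function.Bijective g :=
    (Fintype.bijective_iff_surjective_and_card g).2 ⟨hsurj, by simp [length_rows, hlen]⟩
  have hval (j) : (rows q).get (g j) = (rows p).get j := by
    rw [← mem_fiberMaps.1 hg (g j)]
    simp only [hbij.1.eq_iff, Finset.filter_eq', Finset.mem_univ, if_true, Finset.sum_singleton]
  have hget (l : List ℕ) : (l : Multiset ℕ) = (univ : Finset (Fin l.length)).val.map l.get := by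
    rw [Fin.univ_val_map, List.ofFn_get]
  refine Nat.Partition.ext ?_
  rw [← coe_rows, ← coe_rows, hget (rows p), hget (rows q),
    ← Finset.map_univ_equiv (Equiv.ofBijective g hbij), Finset.map_val, Multiset.map_map]
  exact Multiset.map_congr rfl fun j _ => (hval j).symm

/-- The transition matrix is triangular with respect to the number of rows, with non-zero
diagonal, hence invertible. -/
theorem isUnit_transL : IsUnit (transL n) := by
  rw [← Matrix.mulVec_injective_iff_isUnit, ← Matrix.coe_mulVecLin, injective_iff_map_eq_zero]
  intro v hv
  have key : ∀ m, ∀ p : n.Partition, len p = m → v p = 0 := by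
    intro m
    induction m using Nat.strong_induction_on with
    | _ m ih =>
      intro p hp
      have h := congrFun hv p
      rw [Matrix.mulVecLin_apply, Matrix.mulVec, dotProduct, Finset.sum_eq_single p] at h
      · exact (mul_eq_zero.1 h).resolve_left (transL_self_ne_zero p)
      · intro q _ hq
        by_cases h0 : transL n p q = 0
        · rw [h0, zero_mul]
        · have h1 : len q ≤ len p := not_lt.1 fun h => h0 (transL_eq_zero h)
          have h2 : len q ≠ len p := fun h => hq (eq_of_transL_ne_zero h0 h.symm).symm
          rw [ih (len q) (by omega) q rfl, mul_zero]
      · simp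
  funext p
  exact key _ p rfl

theorem inv_transL_eq_zero {p q : n.Partition} (h : len p < len q) : (transL n)⁻¹ p q = 0 := by
  have hM : (transL n).BlockTriangular fun p => OrderDual.toDual (len p) := fun _ _ h =>
    transL_eq_zero h
  let := isUnit_transL (n := n).invertible
  exact Matrix.blockTriangular_inv_of_blockTriangular hM h

variable {𝕜 : Type*} [RCLike 𝕜]

/-- The matrix of the pairing of `D_μ` with `t_λ`. -/
def pairing (ħ : 𝕜) (n : ℕ) : Matrix n.Partition n.Partition 𝕜 := fun p q =>
  ħ ^ (len p - len q) * (rho p : 𝕜)⁻¹ * (transL n p q : ℚ)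

/-- The inverse of `pairing`, whose rows are the coefficients of `t_λ^ħ` up to normalization. -/
def coPairing (ħ : 𝕜) (n : ℕ) : Matrix n.Partition n.Partition 𝕜 := fun p q =>
  ((transL n)⁻¹ p q : ℚ) * (rho q : 𝕜) * ħ ^ (len p - len q)

theorem pairing_mul_coPairing (ħ : 𝕜) (n : ℕ) : pairing ħ n * coPairing ħ n = 1 := by
  ext p q
  have h1 (r) : pairing ħ n p r * coPairing ħ n r q = ħ ^ (len p - len q) * (rho p : 𝕜)⁻¹ *
      (rho q : 𝕜) * ((transL n p r * (transL n)⁻¹ r q : ℚ) : 𝕜) := by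
    rw [pairing, coPairing]
    rcases lt_or_ge (len p) (len r) with h | h
    · simp [transL_eq_zero h]
    rcases lt_or_ge (len r) (len q) with h' | h'
    · simp [inv_transL_eq_zero h']
    rw [show len p - len q = (len p - len r) + (len r - len q) by omega, pow_add, Rat.cast_mul]
    ring
  rw [Matrix.mul_apply, Finset.sum_congr rfl fun r _ => h1 r, ← Finset.mul_sum, ← Rat.cast_sum,
    ← Matrix.mul_apply, Matrix.mul_nonsing_inv _
      ((Matrix.isUnit_iff_isUnit_det _).1 isUnit_transL)]
  rcases eq_or_ne p q with rfl | h
  · simp [inv_mul_cancel₀ (rho_ne_zero 𝕜 p)]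
  · simp [h]

theorem coPairing_mul_pairing (ħ : 𝕜) (n : ℕ) : coPairing ħ n * pairing ħ n = 1 :=
  mul_eq_one_comm.1 (pairing_mul_coPairing ħ n)

theorem coeff_tDeformed (ħ : 𝕜) (p q : n.Partition) :
    MvPolynomial.coeff (expo q) (tDeformed ħ p) =
      (sigma p : 𝕜) / (rho p : 𝕜) * coPairing ħ n p q := by
  rw [tDeformed, MvPolynomial.coeff_smul, MvPolynomial.coeff_sum, smul_eq_mul,
    Finset.sum_eq_single q]
  · rw [MvPolynomial.coeff_smul, tMonomial_eq, MvPolynomial.coeff_monomial, if_pos rfl,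
      smul_eq_mul, mul_one, coPairing]
  · intro r _ hr
    rw [MvPolynomial.coeff_smul, tMonomial_eq, MvPolynomial.coeff_monomial,
      if_neg fun h => hr (expo_injective h), smul_zero]
  · simp

theorem coeff_tDeformed_of_weight_ne (ħ : 𝕜) (p : n.Partition) {α : ℕ+ →₀ ℕ}
    (hα : weight α ≠ n) : MvPolynomial.coeff α (tDeformed ħ p) = 0 := by
  rw [tDeformed, MvPolynomial.coeff_smul, MvPolynomial.coeff_sum, Finset.sum_eq_zero, smul_zero]
  intro r _
  rw [MvPolynomial.coeff_smul, tMonomial_eq, MvPolynomial.coeff_monomial, if_neg, smul_zero]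
  rintro rfl
  exact hα (weight_expo r)

end Transition

/-! ### The deformed Taylor formula -/

section Taylor

variable {𝕜 : Type*} [RCLike 𝕜] {A : Type*} [CommRing A] [Algebra 𝕜 A]

/-- The component of weight `n` of the series `G` is zero. -/
def VanishesAt (n : ℕ) (G : MvPowerSeries ℕ+ A) : Prop :=
  ∀ α, weight α = n → MvPowerSeries.coeff α G = 0

theorem VanishesAt.dtn {n k : ℕ} {G : MvPowerSeries ℕ+ A} (h : VanishesAt (n + k) G) :
    VanishesAt n (dtn 𝕜 A k G) := by
  intro α hα
  rcases Nat.eq_zero_or_pos k with rfl | hk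
  · simp
  · lift k to ℕ+ using hk
    rw [show HKP.dtn 𝕜 A k = dt 𝕜 A k from dif_pos k.pos, coeff_dt, h, zero_mul]
    rw [weight_add, weight_single, hα]

theorem VanishesAt.hD {ħ : 𝕜} {n k : ℕ} {G : MvPowerSeries ℕ+ A} (h : VanishesAt (n + k) G) :
    VanishesAt n (hD A ħ k G) := by
  induction k using Nat.strong_induction_on generalizing n with
  | _ k ih =>
    intro α hα
    rcases Nat.eq_zero_or_pos k with rfl | hk
    · simp
    · have h1 := congrArg (fun T => MvPowerSeries.coeff α (T G)) (smul_hD (A := A) ħ k)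
      simp only [LinearMap.smul_apply, LinearMap.add_apply, LinearMap.sum_apply,
        Module.End.mul_apply, map_add, LinearMap.map_smul_of_tower, map_sum] at h1
      rw [h.dtn α hα, Finset.sum_eq_zero, smul_zero, add_zero] at h1
      · exact (smul_eq_zero_iff_right (by exact_mod_cast hk.ne' : (k : 𝕜) ≠ 0)).1 h1
      · intro p hp
        have hp := mem_antidiagonal.1 hp
        rcases Nat.eq_zero_or_pos p.1 with h0 | h0
        · simp [h0]
        · refine VanishesAt.dtn (n := n) (ih p.2 (by omega) ?_) α hα
          rwa [add_assoc, hp]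

theorem VanishesAt.constantCoeff_opsD {ħ : 𝕜} {l : List ℕ} {G : MvPowerSeries ℕ+ A}
    (h : VanishesAt l.sum G) : MvPowerSeries.constantCoeff (opsD A ħ l G) = 0 := by
  have key : ∀ (l : List ℕ) (n : ℕ), VanishesAt (n + l.sum) G → VanishesAt n (opsD A ħ l G) := by
    intro l
    induction l with
    | nil => intro n h; simpa using h
    | cons k l ih =>
      intro n h
      rw [opsD_cons, Module.End.mul_apply]
      refine VanishesAt.hD (ih _ ?_)
      rwa [add_assoc, ← List.sum_cons]
  exact key l 0 (by simpa using h) 0 (by simp [weight])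

theorem hD_C_mul (ħ : 𝕜) (k : ℕ) (a : A) (G : MvPowerSeries ℕ+ A) :
    hD A ħ k (MvPowerSeries.C a * G) = MvPowerSeries.C a * hD A ħ k G := by
  simp [hD_mul, hD_C]

theorem opsD_C_mul (ħ : 𝕜) (l : List ℕ) (a : A) (G : MvPowerSeries ℕ+ A) :
    opsD A ħ l (MvPowerSeries.C a * G) = MvPowerSeries.C a * opsD A ħ l G := by
  induction l with
  | nil => rfl
  | cons k l ih => rw [opsD_cons, Module.End.mul_apply, ih, hD_C_mul]; rfl

theorem constantCoeff_opsD_rows (ħ : 𝕜) {n : ℕ} (p : n.Partition) (G : MvPowerSeries ℕ+ A) :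
    MvPowerSeries.constantCoeff (opsD A ħ (rows p) G) =
      ∑ q : n.Partition, pairing ħ n q p • MvPowerSeries.coeff (expo q) G := by
  have h0 : VanishesAt (rows p).sum (G - ∑ q : n.Partition,
      MvPowerSeries.C (MvPowerSeries.coeff (expo q) G) * MvPowerSeries.monomial (expo q) 1) := by
    intro α hα
    rw [sum_rows] at hα
    obtain ⟨r, rfl⟩ := exists_expo hα
    rw [map_sub, map_sum, Finset.sum_eq_single r]
    · simp
    · intro q _ hq
      rw [MvPowerSeries.coeff_C_mul, MvPowerSeries.coeff_monomial,
        if_neg fun h => hq (expo_injective h).symm, mul_zero]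
    · simp
  have h1 := h0.constantCoeff_opsD (ħ := ħ)
  rw [map_sub, map_sub, sub_eq_zero] at h1
  rw [h1, map_sum, map_sum]
  refine Finset.sum_congr rfl fun q _ => ?_
  rw [opsD_C_mul, map_mul, MvPowerSeries.constantCoeff_C, monomial_expo,
    constantCoeff_opsD_prod_X ħ _ (fun _ => rows_pos), mul_comm, ← Algebra.smul_def]
  congr 1
  have h2 (j : Fin (rows q).length) : (((rows q).get j).toPNat' : ℕ) = (rows q).get j := by
    rw [Nat.toPNat'_coe, if_pos (rows_pos ((rows q).get_mem j))]
  simp only [h2]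
  have h3 : ∏ j : Fin (rows q).length, (rows q).get j = rho q := by
    rw [← prod_rows, ← List.prod_ofFn, List.ofFn_get]
  rw [pairing, transL_eq, Fintype.card_fin, Finset.prod_inv_distrib, ← Nat.cast_prod, h3,
    ← length_rows, ← length_rows, Rat.cast_natCast]

/-- The deformed Taylor formula: the coefficients of `G` in terms of its deformed derivatives
at `t = 0`. -/
theorem coeff_expo (ħ : 𝕜) {n : ℕ} (q : n.Partition) (G : MvPowerSeries ℕ+ A) :
    MvPowerSeries.coeff (expo q) G = ∑ p : n.Partition,
      coPairing ħ n p q • MvPowerSeries.constantCoeff (opsD A ħ (rows p) G) := by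
  simp only [constantCoeff_opsD_rows, Finset.smul_sum, smul_smul]
  rw [Finset.sum_comm]
  simp only [← Finset.sum_smul, mul_comm (coPairing ħ n _ q), ← Matrix.mul_apply,
    pairing_mul_coPairing]
  rw [Finset.sum_eq_single q]
  · simp
  · intro r _ hr
    simp [hr]
  · simp

theorem eq_of_opsD (ħ : 𝕜) {G H : MvPowerSeries ℕ+ A}
    (h : ∀ l : List ℕ, (∀ k ∈ l, 0 < k) → MvPowerSeries.constantCoeff (opsD A ħ l G) =
      MvPowerSeries.constantCoeff (opsD A ħ l H)) : G = H := by
  ext α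
  obtain ⟨q, hq⟩ := exists_expo (α := α) rfl
  rw [← hq, coeff_expo ħ, coeff_expo ħ]
  exact Finset.sum_congr rfl fun p _ => by rw [h _ fun _ => rows_pos]

/-- The deformed derivatives at `t = 0` can be prescribed arbitrarily. -/
theorem exists_opsD_eq (ħ : 𝕜) (c : Multiset ℕ → A) : ∃ G : MvPowerSeries ℕ+ A,
    ∀ l : List ℕ, (∀ k ∈ l, 0 < k) → MvPowerSeries.constantCoeff (opsD A ħ l G) = c l := by
  let part (α : ℕ+ →₀ ℕ) : (weight α).Partition := (exists_expo (α := α) rfl).choose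
  let G : MvPowerSeries ℕ+ A := fun α =>
    ∑ p : (weight α).Partition, coPairing ħ _ p (part α) • c p.parts
  have hG {α : ℕ+ →₀ ℕ} {m : ℕ} (hm : weight α = m) (q : m.Partition) (hq : expo q = α) :
      MvPowerSeries.coeff α G = ∑ p : m.Partition, coPairing ħ m p q • c p.parts := by
    subst hm
    have : part α = q := expo_injective (((exists_expo (α := α) rfl).choose_spec).trans hq.symm)
    rw [← this]
    rfl
  refine ⟨G, fun l hl => ?_⟩
  let p : l.sum.Partition := ⟨l, fun {k} hk => hl k (by simpa using hk), by simp⟩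
  have hp : (rows p).Perm l := Multiset.coe_eq_coe.1 (coe_rows p)
  rw [← opsD_perm ħ hp, constantCoeff_opsD_rows]
  simp only [fun q : l.sum.Partition => hG (weight_expo q) q rfl, Finset.smul_sum, smul_smul]
  rw [Finset.sum_comm]
  simp only [← Finset.sum_smul, mul_comm (pairing ħ _ _ p), ← Matrix.mul_apply,
    coPairing_mul_pairing]
  rw [Finset.sum_eq_single p]
  · simp [p]
  · intro r _ hr
    simp [hr]
  · simp

/-- A series whose deformed derivatives at `t = 0` are the `f_λ^ħ` is the sum of the explicit
expansion. -/
theorem isExpansion_of_opsD (d : Derivation 𝕜 A A) (ħ : 𝕜) (f : ℕ → A) (G : MvPowerSeries ℕ+ A)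
    (h0 : MvPowerSeries.constantCoeff G = f 0)
    (h : ∀ n, 1 ≤ n → ∀ p : n.Partition,
      (rho p : 𝕜) • MvPowerSeries.constantCoeff (opsD A ħ (rows p) G) = fLam d ħ f p) :
    IsExpansion d ħ f G := by
  intro N α hα
  have hcoef {m : ℕ} (a : A) (p : m.Partition) : MvPowerSeries.coeff α (MvPowerSeries.C a *
      ((MvPolynomial.map (algebraMap 𝕜 A) (tDeformed ħ p) : MvPolynomial ℕ+ A) :
        MvPowerSeries ℕ+ A)) = MvPolynomial.coeff α (tDeformed ħ p) • a := by
    rw [MvPowerSeries.coeff_C_mul, MvPolynomial.coeff_coe, MvPolynomial.coeff_map,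
      Algebra.smul_def, mul_comm]
  simp only [partialSum, map_add, map_sum, hcoef]
  rcases Nat.eq_zero_or_pos (weight α) with hα0 | hα0
  · obtain rfl := weight_eq_zero hα0
    rw [Finset.sum_eq_zero, add_zero]
    · simpa using h0
    · intro m hm
      have := (Finset.mem_Icc.1 hm).1
      refine Finset.sum_eq_zero fun p _ => ?_
      rw [coeff_tDeformed_of_weight_ne ħ p (by omega), zero_smul]
  · have hne : α ≠ 0 := by
      rintro rfl
      simp [weight] at hα0
    rw [MvPowerSeries.coeff_C, if_neg hne, zero_add, Finset.sum_eq_single (weight α)]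
    · obtain ⟨q, hq⟩ := exists_expo (α := α) rfl
      conv_lhs => rw [← hq, coeff_expo ħ]
      refine Finset.sum_congr rfl fun p _ => ?_
      have hq' := coeff_tDeformed ħ p q
      rw [hq] at hq'
      rw [hq', ← h _ hα0 p, smul_smul, smul_smul]
      congr 1
      have h1 := rho_ne_zero 𝕜 p
      have h2 := sigma_ne_zero 𝕜 p
      field_simp
    · intro m _ hm
      refine Finset.sum_eq_zero fun p _ => ?_
      rw [coeff_tDeformed_of_weight_ne ħ p hm.symm, zero_smul]
    · intro hm
      exact absurd (Finset.mem_Icc.2 ⟨hα0, hα⟩) hm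

end Taylor

/-! ### Exponential and logarithm as inverse power series -/

section ExpLog

variable (𝕜 : Type*) [RCLike 𝕜]

theorem log_subst_exp_sub_one :
    (PowerSeries.log 𝕜).subst (PowerSeries.exp 𝕜 - 1) = (PowerSeries.X : PowerSeries 𝕜) := by
  have hE : PowerSeries.HasSubst (PowerSeries.exp 𝕜 - 1) := PowerSeries.HasSubst.exp_sub_one
  have h1 : (1 + PowerSeries.X) * PowerSeries.derivative 𝕜 (PowerSeries.log 𝕜) = 1 := by
    rw [PowerSeries.deriv_log]
    ext n
    rcases n with _ | n
    · simp
    · rw [add_mul, one_mul, map_add, PowerSeries.coeff_succ_X_mul]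
      simp [pow_succ, PowerSeries.coeff_one]
  have h2 := congrArg (PowerSeries.subst (PowerSeries.exp 𝕜 - 1)) h1
  rw [PowerSeries.subst_mul hE, PowerSeries.subst_add hE, PowerSeries.subst_X hE,
    ← PowerSeries.coe_substAlgHom hE, map_one, add_sub_cancel] at h2
  refine PowerSeries.derivative.ext ?_ ?_
  · rw [PowerSeries.derivative_subst hE, map_sub, PowerSeries.derivative_exp,
      PowerSeries.derivative_one, sub_zero, PowerSeries.derivative_X, mul_comm,
      ← PowerSeries.coe_substAlgHom hE, h2]
  · rw [PowerSeries.constantCoeff_X]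
    have h0 : (PowerSeries.exp 𝕜 - 1).constantCoeff = 0 := by simp
    exact PowerSeries.constantCoeff_subst_eq_zero h0 _ PowerSeries.constantCoeff_log

theorem exp_sub_one_subst_log :
    (PowerSeries.exp 𝕜 - 1).subst (PowerSeries.log 𝕜) = (PowerSeries.X : PowerSeries 𝕜) := by
  have h0 : (PowerSeries.exp 𝕜 - 1).constantCoeff = 0 := by simp
  have h1 : IsUnit ((PowerSeries.exp 𝕜 - 1).coeff 1) := by
    simp [PowerSeries.coeff_one]
  have hr := PowerSeries.subst_substInvOfIsUnit_right (PowerSeries.exp 𝕜 - 1) h0 h1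
  have hQ := PowerSeries.HasSubst.substInvOfIsUnit (PowerSeries.exp 𝕜 - 1) h1
  have hE : PowerSeries.HasSubst (PowerSeries.exp 𝕜 - 1) := PowerSeries.HasSubst.exp_sub_one
  have := PowerSeries.subst_comp_subst_apply hE hQ (PowerSeries.log 𝕜)
  rw [hr, log_subst_exp_sub_one, PowerSeries.subst_X hQ, PowerSeries.X_subst] at this
  rw [← this, hr]

variable {𝕜} {B : Type*} [CommRing B] [Algebra 𝕜 B] {τ : Type*}

theorem exp_subst_sub_one_eq_iff {a b : MvPowerSeries τ B}
    (ha : MvPowerSeries.constantCoeff a = 0) (hb : MvPowerSeries.constantCoeff b = 0) :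
    (PowerSeries.exp 𝕜).subst a - 1 = b ↔ a = (PowerSeries.log 𝕜).subst b := by
  have ha' := PowerSeries.HasSubst.of_constantCoeff_zero ha
  have hb' := PowerSeries.HasSubst.of_constantCoeff_zero hb
  have h1 : (PowerSeries.exp 𝕜).subst a - 1 = (PowerSeries.exp 𝕜 - 1).subst a := by
    rw [PowerSeries.subst_sub ha', ← PowerSeries.coe_substAlgHom ha', map_one]
  rw [h1]
  constructor
  · rintro rfl
    rw [← PowerSeries.subst_comp_subst_apply PowerSeries.HasSubst.exp_sub_one ha',
      log_subst_exp_sub_one, PowerSeries.subst_X ha']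
  · rintro rfl
    rw [← PowerSeries.subst_comp_subst_apply PowerSeries.HasSubst.log hb',
      exp_sub_one_subst_log, PowerSeries.subst_X hb']

end ExpLog

/-! ### The expansion of the logarithm of the Fay identity -/

section Lists

variable {α : Type*} [DecidableEq α]

/-- The lists of length at most `N` with entries in the finite set `S`. -/
def listsIn (S : Finset α) (N : ℕ) : Finset (List α) :=
  (range (N + 1)).biUnion fun m => (Fintype.piFinset fun _ : Fin m => S).image List.ofFn

theorem mem_listsIn {S : Finset α} {N : ℕ} {l : List α} :
    l ∈ listsIn S N ↔ l.length ≤ N ∧ ∀ a ∈ l, a ∈ S := by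
  simp only [listsIn, Finset.mem_biUnion, Finset.mem_range, Finset.mem_image,
    Fintype.mem_piFinset]
  constructor
  · rintro ⟨m, hm, s, hs, rfl⟩
    refine ⟨by simpa [Nat.lt_succ_iff] using hm, fun a ha => ?_⟩
    obtain ⟨i, rfl⟩ := List.mem_ofFn.1 ha
    exact hs i
  · rintro ⟨h1, h2⟩
    exact ⟨l.length, by omega, l.get, fun i => h2 _ (l.get_mem i), List.ofFn_get l⟩

/-- The lists of positive integers `s_1, …, s_m` with `∑ (s_a + 1) = n`. -/
def sLists (n : ℕ) : Finset (List ℕ) :=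
  (listsIn (Icc 1 n) n).filter fun l => (l.map (· + 1)).sum = n

theorem mem_sLists {n : ℕ} {l : List ℕ} :
    l ∈ sLists n ↔ (∀ s ∈ l, 1 ≤ s) ∧ (l.map (· + 1)).sum = n := by
  simp only [sLists, Finset.mem_filter, mem_listsIn, Finset.mem_Icc]
  constructor
  · rintro ⟨⟨-, h⟩, h'⟩
    exact ⟨fun s hs => (h s hs).1, h'⟩
  · rintro ⟨h, rfl⟩
    refine ⟨⟨?_, fun s hs => ⟨h s hs, ?_⟩⟩, rfl⟩
    · have := List.length_le_sum_of_one_le (l.map (· + 1)) (by simp)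
      simpa only [List.length_map] using this
    · exact (Nat.le_succ s).trans (List.single_le_sum (by simp) _ (List.mem_map_of_mem hs))

end Lists

section Fay

variable {𝕜 : Type*} [RCLike 𝕜] {B : Type*} [CommRing B] [Algebra 𝕜 B]

variable (𝕜) in
/-- The series `Y = ∑_s (g_s / s) ∑_{i + j = s + 1} u^i v^j` (with `i, j ≥ 1`), so that the right
hand side of the Fay identity is `1 + Y` for `g_s = ∂_1 ∂_s^ħ F`. -/
def faySeries (g : ℕ → B) : MvPowerSeries (Fin 2) B := fun e =>
  if 1 ≤ e 0 ∧ 1 ≤ e 1 then ((e 0 + e 1 - 1 : ℕ) : 𝕜)⁻¹ • g (e 0 + e 1 - 1) else 0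

theorem coeff_faySeries (g : ℕ → B) (e : Fin 2 →₀ ℕ) :
    MvPowerSeries.coeff e (faySeries 𝕜 g) = if 1 ≤ e 0 ∧ 1 ≤ e 1 then
      ((e 0 + e 1 - 1 : ℕ) : 𝕜)⁻¹ • g (e 0 + e 1 - 1) else 0 := rfl

theorem constantCoeff_faySeries (g : ℕ → B) :
    MvPowerSeries.constantCoeff (faySeries 𝕜 g) = 0 := by
  rw [← MvPowerSeries.coeff_zero_eq_constantCoeff_apply, coeff_faySeries, if_neg (by simp)]

/-- The exponent `(i, j)` of the monomial `u^i v^j`. -/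
def exp2 (i j : ℕ) : Fin 2 →₀ ℕ := Finsupp.equivFunOnFinite.symm ![i, j]

@[simp] theorem exp2_zero (i j : ℕ) : exp2 i j 0 = i := rfl
@[simp] theorem exp2_one (i j : ℕ) : exp2 i j 1 = j := rfl

theorem exp2_eta (e : Fin 2 →₀ ℕ) : exp2 (e 0) (e 1) = e := by
  ext i
  fin_cases i <;> rfl

/-- The sequences of `m` pairs of positive integers with sums `i` and `j`. -/
def pairSeqs (m i j : ℕ) : Finset (Fin m → ℕ × ℕ) :=
  (Fintype.piFinset fun _ => Icc 1 i ×ˢ Icc 1 j).filter fun q =>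
    ∑ k, (q k).1 = i ∧ ∑ k, (q k).2 = j

theorem mem_pairSeqs {m i j : ℕ} {q : Fin m → ℕ × ℕ} :
    q ∈ pairSeqs m i j ↔ (∀ k, 0 < (q k).1 ∧ 0 < (q k).2) ∧ ∑ k, (q k).1 = i ∧ ∑ k, (q k).2 = j := by
  simp only [pairSeqs, Finset.mem_filter, Fintype.mem_piFinset, Finset.mem_product, Finset.mem_Icc]
  constructor
  · rintro ⟨h, h'⟩
    exact ⟨fun k => ⟨(h k).1.1, (h k).2.1⟩, h'⟩
  · rintro ⟨h, rfl, rfl⟩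
    exact ⟨fun k => ⟨⟨(h k).1, Finset.single_le_sum (f := fun k => (q k).1) (fun _ _ => Nat.zero_le _) (mem_univ k)⟩,
      ⟨(h k).2, Finset.single_le_sum (f := fun k => (q k).2) (fun _ _ => Nat.zero_le _) (mem_univ k)⟩⟩, rfl, rfl⟩

theorem coeff_faySeries_pow_eq_sum_pairSeqs (g : ℕ → B) (m i j : ℕ) :
    MvPowerSeries.coeff (exp2 i j) (faySeries 𝕜 g ^ m) =
      ∑ q ∈ pairSeqs m i j, ∏ k, (((q k).1 + (q k).2 - 1 : ℕ) : 𝕜)⁻¹ •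
        g ((q k).1 + (q k).2 - 1) := by
  have hpow : faySeries 𝕜 g ^ m = ∏ _k : Fin m, faySeries 𝕜 g := by simp
  rw [hpow, MvPowerSeries.coeff_prod]
  have h1 : ∀ l ∈ finsuppAntidiag (univ : Finset (Fin m)) (exp2 i j),
      l ∉ (finsuppAntidiag (univ : Finset (Fin m)) (exp2 i j)).filter
        (fun l => ∀ k, 0 < l k 0 ∧ 0 < l k 1) →
      ∏ k, MvPowerSeries.coeff (l k) (faySeries 𝕜 g) = 0 := by
    intro l hl hl'
    simp only [Finset.mem_filter, hl, true_and, not_forall] at hl'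
    obtain ⟨k, hk⟩ := hl'
    refine Finset.prod_eq_zero (mem_univ k) ?_
    rw [coeff_faySeries]
    exact if_neg hk
  rw [← Finset.sum_subset (Finset.filter_subset _ _) h1]
  refine Finset.sum_bij' (fun l _ k => (l k 0, l k 1))
    (fun q _ => Finsupp.equivFunOnFinite.symm fun k => exp2 (q k).1 (q k).2) ?_ ?_ ?_ ?_ ?_
  · intro l hl
    obtain ⟨h1, h2⟩ := Finset.mem_filter.1 hl
    have h3 := (Finset.mem_finsuppAntidiag.1 h1).1
    rw [mem_pairSeqs]
    refine ⟨h2, ?_, ?_⟩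
    · rw [← Finsupp.finsetSum_apply, h3, exp2_zero]
    · rw [← Finsupp.finsetSum_apply, h3, exp2_one]
  · intro q hq
    obtain ⟨h1, h2, h3⟩ := mem_pairSeqs.1 hq
    rw [Finset.mem_filter, Finset.mem_finsuppAntidiag]
    refine ⟨⟨?_, by simp⟩, by simpa using h1⟩
    ext a
    rw [Finsupp.finsetSum_apply]
    fin_cases a
    · simpa using h2
    · simpa using h3
  · intro l _
    ext k : 1
    simp [exp2_eta]
  · intro q _
    funext k
    simp
  · intro l hl
    refine Finset.prod_congr rfl fun k _ => ?_
    rw [coeff_faySeries]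
    exact if_pos ((Finset.mem_filter.1 hl).2 k)

theorem coeff_faySeries_pow (g : ℕ → B) (m i j : ℕ) :
    MvPowerSeries.coeff (exp2 i j) (faySeries 𝕜 g ^ m) =
      ∑ l ∈ (sLists (i + j)).filter (fun l => l.length = m),
        Ptilde i j l • (l.map fun s : ℕ => (s : 𝕜)⁻¹ • g s).prod := by
  rw [coeff_faySeries_pow_eq_sum_pairSeqs]
  have hmaps : ∀ q ∈ pairSeqs m i j, List.ofFn (fun k => (q k).1 + (q k).2 - 1) ∈
      (sLists (i + j)).filter (fun l => l.length = m) := by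
    intro q hq
    obtain ⟨h1, h2, h3⟩ := mem_pairSeqs.1 hq
    rw [Finset.mem_filter, mem_sLists, List.length_ofFn, List.map_ofFn, List.sum_ofFn,
      List.forall_mem_ofFn_iff]
    refine ⟨⟨fun k => by have := h1 k; omega, ?_⟩, rfl⟩
    rw [← h2, ← h3, ← Finset.sum_add_distrib]
    exact Finset.sum_congr rfl fun k _ => by have := h1 k; simp only [Function.comp]; omega
  rw [← Finset.sum_fiberwise_of_maps_to hmaps]
  refine Finset.sum_congr rfl fun l hl => ?_
  obtain ⟨hl, rfl⟩ := Finset.mem_filter.1 hl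
  have hval : ∀ q ∈ (pairSeqs l.length i j).filter
      (fun q => List.ofFn (fun k => (q k).1 + (q k).2 - 1) = l),
      (∏ k, (((q k).1 + (q k).2 - 1 : ℕ) : 𝕜)⁻¹ • g ((q k).1 + (q k).2 - 1)) =
        (l.map fun s : ℕ => (s : 𝕜)⁻¹ • g s).prod := by
    intro q hq
    conv_rhs => rw [← (Finset.mem_filter.1 hq).2]
    rw [List.map_ofFn, List.prod_ofFn]
    rfl
  rw [Finset.sum_congr rfl hval, Finset.sum_const]
  congr 1
  rw [Ptilde]
  congr 1
  ext q
  rw [Finset.mem_filter, Finset.mem_filter, mem_pairSeqs, Fintype.mem_piFinset]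
  have hiff : List.ofFn (fun k => (q k).1 + (q k).2 - 1) = l ↔
      ∀ k, (q k).1 + (q k).2 - 1 = l.get k :=
    (List.ofFn_injective.eq_iff' (List.ofFn_get l)).trans funext_iff
  rw [hiff, and_comm]
  refine and_congr_left fun h => forall_congr' fun k => ?_
  have := h.1 k
  rw [mem_antidiagonal]
  omega

theorem length_le_of_mem_sLists {n : ℕ} {l : List ℕ} (h : l ∈ sLists n) : l.length ≤ n :=
  (mem_listsIn.1 (Finset.mem_filter.1 h).1).1

theorem coeff_log_faySeries (g : ℕ → B) (i j : ℕ) :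
    MvPowerSeries.coeff (exp2 i j) ((PowerSeries.log 𝕜).subst (faySeries 𝕜 g)) =
      ∑ l ∈ sLists (i + j), ((-1) ^ (l.length + 1) / (l.length : 𝕜) * Ptilde i j l) •
        (l.map fun s : ℕ => (s : 𝕜)⁻¹ • g s).prod := by
  rw [PowerSeries.coeff_subst
    (PowerSeries.HasSubst.of_constantCoeff_zero (constantCoeff_faySeries g)),
    finsum_eq_sum_of_support_subset (s := range (i + j + 1))]
  · rw [← Finset.sum_fiberwise_of_maps_to (s := sLists (i + j)) (t := range (i + j + 1))
      (g := List.length)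
      (fun l hl => Finset.mem_range.2 (Nat.lt_succ_of_le (length_le_of_mem_sLists hl)))]
    refine Finset.sum_congr rfl fun m _ => ?_
    rw [coeff_faySeries_pow, Finset.smul_sum]
    refine Finset.sum_congr rfl fun l hl => ?_
    obtain ⟨hl, rfl⟩ := Finset.mem_filter.1 hl
    rw [← Nat.cast_smul_eq_nsmul 𝕜, smul_smul, PowerSeries.coeff_log]
    congr 2
    split_ifs with h
    · simp [h]
    · simp
  · intro m hm
    by_contra h
    refine hm ?_
    simp only [Finset.coe_range, Set.mem_Iio, not_lt] at h
    simp only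
    rw [coeff_faySeries_pow, Finset.sum_eq_zero, smul_zero]
    intro l hl
    obtain ⟨hl', rfl⟩ := Finset.mem_filter.1 hl
    have := length_le_of_mem_sLists hl'
    omega

theorem list_prod_smul (g : ℕ → B) (l : List ℕ) :
    (l.map fun s : ℕ => (s : 𝕜)⁻¹ • g s).prod = ((l.prod : ℕ) : 𝕜)⁻¹ • (l.map g).prod := by
  induction l with
  | nil => simp
  | cons a l ih =>
    simp only [List.map_cons, List.prod_cons, ih, smul_mul_smul_comm, Nat.cast_mul, mul_inv]

variable (𝕜) in
/-- The polynomial `∑ P_{ij}(s_1, …, s_m) g_{s_1} ⋯ g_{s_m}` in the `g_s`; for `g_s = ∂_1 ∂_s^ħ F`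
it is the value of `∂_i^ħ ∂_j^ħ F` on solutions. -/
def hPoly (g : ℕ → B) (i j : ℕ) : B := ∑ l ∈ sLists (i + j), Ptwo 𝕜 i j l • (l.map g).prod

theorem smul_coeff_log_faySeries (g : ℕ → B) (i j : ℕ) :
    ((i : 𝕜) * j) • MvPowerSeries.coeff (exp2 i j)
      ((PowerSeries.log 𝕜).subst (faySeries 𝕜 g)) = hPoly 𝕜 g i j := by
  rw [coeff_log_faySeries, hPoly, Finset.smul_sum]
  refine Finset.sum_congr rfl fun l _ => ?_
  rw [list_prod_smul, smul_smul, smul_smul, Ptwo]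
  congr 1
  rw [div_eq_mul_inv, div_eq_mul_inv, mul_inv]
  ring

theorem Ptilde_eq_zero {i j : ℕ} (h : i = 0 ∨ j = 0) {l : List ℕ} (hl : l ≠ []) :
    Ptilde i j l = 0 := by
  rw [Ptilde, Finset.card_eq_zero, Finset.filter_eq_empty_iff]
  rintro q - ⟨h1, h2, h3⟩
  have hpos : 0 < l.length := List.length_pos_iff.2 hl
  rcases h with rfl | rfl
  · have := Finset.sum_eq_zero_iff.1 h2 ⟨0, hpos⟩ (mem_univ _)
    have := (h1 ⟨0, hpos⟩).1
    omega
  · have := Finset.sum_eq_zero_iff.1 h3 ⟨0, hpos⟩ (mem_univ _)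
    have := (h1 ⟨0, hpos⟩).2
    omega

theorem coeff_log_faySeries_eq_zero (g : ℕ → B) {i j : ℕ} (h : i = 0 ∨ j = 0) :
    MvPowerSeries.coeff (exp2 i j) ((PowerSeries.log 𝕜).subst (faySeries 𝕜 g)) = 0 := by
  rw [coeff_log_faySeries]
  refine Finset.sum_eq_zero fun l _ => ?_
  rcases eq_or_ne l [] with rfl | hl
  · simp
  · simp [Ptilde_eq_zero h hl]

theorem coeff_X_zero_mul_succ (G : MvPowerSeries (Fin 2) B) (i j : ℕ) :
    MvPowerSeries.coeff (exp2 (i + 1) j) (MvPowerSeries.X 0 * G) =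
      MvPowerSeries.coeff (exp2 i j) G := by
  have hs : exp2 (i + 1) j = Finsupp.single 0 1 + exp2 i j := by
    ext a; fin_cases a <;> simp [add_comm]
  rw [hs, MvPowerSeries.X, MvPowerSeries.coeff_add_monomial_mul, one_mul]

theorem coeff_X_one_mul_succ (G : MvPowerSeries (Fin 2) B) (i j : ℕ) :
    MvPowerSeries.coeff (exp2 i (j + 1)) (MvPowerSeries.X 1 * G) =
      MvPowerSeries.coeff (exp2 i j) G := by
  have hs : exp2 i (j + 1) = Finsupp.single 1 1 + exp2 i j := by
    ext a; fin_cases a <;> simp [add_comm]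
  rw [hs, MvPowerSeries.X, MvPowerSeries.coeff_add_monomial_mul, one_mul]

theorem coeff_X_zero_mul_zero (G : MvPowerSeries (Fin 2) B) (j : ℕ) :
    MvPowerSeries.coeff (exp2 0 j) (MvPowerSeries.X 0 * G) = 0 := by
  classical
  rw [MvPowerSeries.X, MvPowerSeries.coeff_monomial_mul, if_neg]
  exact fun h => by simpa using h 0

theorem coeff_X_one_mul_zero (G : MvPowerSeries (Fin 2) B) (i : ℕ) :
    MvPowerSeries.coeff (exp2 i 0) (MvPowerSeries.X 1 * G) = 0 := by
  classical
  rw [MvPowerSeries.X, MvPowerSeries.coeff_monomial_mul, if_neg]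
  exact fun h => by simpa using h 1

theorem eq_of_X_sub_X_mul_eq {G H : MvPowerSeries (Fin 2) B}
    (h : (MvPowerSeries.X 0 - MvPowerSeries.X 1) * G =
      (MvPowerSeries.X 0 - MvPowerSeries.X 1) * H) : G = H := by
  rw [← sub_eq_zero, ← mul_sub] at h
  rw [← sub_eq_zero]
  set K := G - H
  have key (j : ℕ) : ∀ i, MvPowerSeries.coeff (exp2 i j) K = 0 := by
    induction j with
    | zero =>
      intro i
      have := congrArg (MvPowerSeries.coeff (exp2 (i + 1) 0)) h
      rwa [sub_mul, map_sub, coeff_X_zero_mul_succ, coeff_X_one_mul_zero, sub_zero,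
        map_zero] at this
    | succ j ih =>
      intro i
      have := congrArg (MvPowerSeries.coeff (exp2 (i + 1) (j + 1))) h
      rwa [sub_mul, map_sub, coeff_X_zero_mul_succ, coeff_X_one_mul_succ, ih, sub_zero,
        map_zero] at this
  ext e
  rw [← exp2_eta e, key, map_zero]

/-- The telescoping identity `(u - v) ∑_{i + j = s + 1} u^i v^j = u v (u^s - v^s)`. -/
theorem X_sub_X_mul_faySeries (g : ℕ → B) (δ : Fin 2 → MvPowerSeries (Fin 2) B)
    (h0 : ∀ i j, MvPowerSeries.coeff (exp2 i j) (δ 0) = if j = 0 then (i : 𝕜)⁻¹ • g i else 0)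
    (h1 : ∀ i j, MvPowerSeries.coeff (exp2 i j) (δ 1) = if i = 0 then (j : 𝕜)⁻¹ • g j else 0) :
    (MvPowerSeries.X 0 - MvPowerSeries.X 1) * faySeries 𝕜 g =
      MvPowerSeries.X 0 * MvPowerSeries.X 1 * (δ 0 - δ 1) := by
  have hY (i j : ℕ) : MvPowerSeries.coeff (exp2 i j) (faySeries 𝕜 g) = if 1 ≤ i ∧ 1 ≤ j then
      ((i + j - 1 : ℕ) : 𝕜)⁻¹ • g (i + j - 1) else 0 := coeff_faySeries g _
  ext e
  rw [← exp2_eta e, sub_mul, map_sub, mul_assoc]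
  generalize e 0 = i
  generalize e 1 = j
  rcases i with _ | i
  · rw [coeff_X_zero_mul_zero, coeff_X_zero_mul_zero]
    rcases j with _ | j
    · rw [coeff_X_one_mul_zero, sub_zero]
    · rw [coeff_X_one_mul_succ, hY]
      simp
  · rw [coeff_X_zero_mul_succ, coeff_X_zero_mul_succ, hY]
    rcases j with _ | j
    · rw [coeff_X_one_mul_zero, coeff_X_one_mul_zero]
      simp
    · rw [coeff_X_one_mul_succ, coeff_X_one_mul_succ, map_sub, h0, h1, hY]
      rw [show i + (j + 1) - 1 = i + j by omega, show i + 1 + j - 1 = i + j by omega]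
      rcases i with _ | i <;> rcases j with _ | j <;> simp

end Fay

section FayIff

variable {𝕜 : Type*} [RCLike 𝕜] {A : Type*} [CommRing A] [Algebra 𝕜 A]

theorem coeff_deltaTwo (ħ : 𝕜) (F : MvPowerSeries ℕ+ A) (i j : ℕ) :
    MvPowerSeries.coeff (exp2 i j) (deltaTwo ħ F) = hD A ħ i (hD A ħ j F) := rfl

theorem coeff_deltaOne_zero (ħ : 𝕜) (G : MvPowerSeries ℕ+ A) (i j : ℕ) :
    MvPowerSeries.coeff (exp2 i j) (deltaOne ħ 0 G) = if j = 0 then hD A ħ i G else 0 := by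
  change (if exp2 i j = Finsupp.single 0 i then hD A ħ i G else 0) = _
  refine if_congr ⟨fun h => by simpa using DFunLike.congr_fun h 1, ?_⟩ rfl rfl
  rintro rfl
  ext a
  fin_cases a <;> simp

theorem coeff_deltaOne_one (ħ : 𝕜) (G : MvPowerSeries ℕ+ A) (i j : ℕ) :
    MvPowerSeries.coeff (exp2 i j) (deltaOne ħ 1 G) = if i = 0 then hD A ħ j G else 0 := by
  change (if exp2 i j = Finsupp.single 1 j then hD A ħ j G else 0) = _
  refine if_congr ⟨fun h => by simpa using DFunLike.congr_fun h 0, ?_⟩ rfl rfl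
  rintro rfl
  ext a
  fin_cases a <;> simp

theorem hD_eq_smul_hderiv (ħ : 𝕜) (k : ℕ) : hD A ħ k = (k : 𝕜)⁻¹ • hderiv A ħ k := by
  rcases Nat.eq_zero_or_pos k with rfl | hk
  · simp
  · rw [hderiv_eq, smul_smul, inv_mul_cancel₀ (by exact_mod_cast hk.ne'), one_smul]

/-- The differential Fay identity is equivalent to the equations
`∂_i^ħ ∂_j^ħ F = ∑ P_{ij}(s_1, …, s_m) ∂_1 ∂_{s_1}^ħ F ⋯ ∂_1 ∂_{s_m}^ħ F`, obtained by
taking logarithms. -/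
theorem fay_iff (ħ : 𝕜) (F : MvPowerSeries ℕ+ A) :
    (MvPowerSeries.X 0 - MvPowerSeries.X 1) * ((PowerSeries.exp 𝕜).subst (deltaTwo ħ F) - 1) =
      MvPowerSeries.X 0 * MvPowerSeries.X 1 *
        (deltaOne ħ 0 (dt 𝕜 A 1 F) - deltaOne ħ 1 (dt 𝕜 A 1 F)) ↔
    ∀ i j, hderiv A ħ i (hderiv A ħ j F) =
      hPoly 𝕜 (fun s => dt 𝕜 A 1 (hderiv A ħ s F)) i j := by
  set g : ℕ → MvPowerSeries ℕ+ A := fun s => dt 𝕜 A 1 (hderiv A ħ s F) with hg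
  have hgs (s : ℕ) : hD A ħ s (dt 𝕜 A 1 F) = (s : 𝕜)⁻¹ • g s := by
    rw [hD_eq_smul_hderiv, hg, LinearMap.smul_apply, ← Module.End.mul_apply,
      ← (commute_dt_hderiv ħ 1 s).eq, Module.End.mul_apply]
  rw [← X_sub_X_mul_faySeries (𝕜 := 𝕜) g (fun a => deltaOne ħ a (dt 𝕜 A 1 F))
    (fun i j => by rw [coeff_deltaOne_zero, hgs]) (fun i j => by rw [coeff_deltaOne_one, hgs])]
  have h0 : MvPowerSeries.constantCoeff (deltaTwo ħ F) = 0 := by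
    have := coeff_deltaTwo ħ F 0 0
    rw [hD_zero] at this
    rw [← MvPowerSeries.coeff_zero_eq_constantCoeff_apply, ← exp2_eta 0]
    exact this
  have h1 : (MvPowerSeries.X 0 - MvPowerSeries.X 1) *
      ((PowerSeries.exp 𝕜).subst (deltaTwo ħ F) - 1) =
        (MvPowerSeries.X 0 - MvPowerSeries.X 1) * faySeries 𝕜 g ↔
      (PowerSeries.exp 𝕜).subst (deltaTwo ħ F) - 1 = faySeries 𝕜 g :=
    ⟨eq_of_X_sub_X_mul_eq, fun h => by rw [h]⟩
  rw [h1, exp_subst_sub_one_eq_iff h0 (constantCoeff_faySeries g)]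
  have h2 (i j : ℕ) : hderiv A ħ i (hderiv A ħ j F) =
      ((i : 𝕜) * j) • MvPowerSeries.coeff (exp2 i j) (deltaTwo ħ F) := by
    rw [coeff_deltaTwo, hderiv_eq, hderiv_eq, LinearMap.smul_apply, LinearMap.smul_apply,
      map_smul, smul_smul]
  constructor
  · intro h i j
    rw [h2, h, smul_coeff_log_faySeries]
  · intro h
    ext1 e
    rw [← exp2_eta e]
    generalize e 0 = i
    generalize e 1 = j
    by_cases hij : i = 0 ∨ j = 0
    · rw [coeff_log_faySeries_eq_zero g hij, coeff_deltaTwo]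
      rcases hij with rfl | rfl <;> simp
    · have h3 := h i j
      rw [h2, ← smul_coeff_log_faySeries] at h3
      refine smul_right_injective _ (r := (i : 𝕜) * j) ?_ h3
      rw [not_or] at hij
      exact mul_ne_zero (by exact_mod_cast hij.1) (by exact_mod_cast hij.2)

end FayIff

/-! ### Leibniz rules for products of several factors -/

section Leibniz

variable {M N : Type*} [CommRing M] [CommRing N]

/-- A family of operators that is multiplicative as a generating series satisfies the Leibniz rule
for products of several factors. -/
theorem leibniz_prod {T : ℕ → M → N} (h1 : ∀ k, T k 1 = if k = 0 then 1 else 0)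
    (hmul : ∀ k a b, T k (a * b) = ∑ p ∈ antidiagonal k, T p.1 a * T p.2 b)
    {m : ℕ} (u : Fin m → M) (k : ℕ) :
    T k (∏ a, u a) = ∑ κ ∈ Finset.piAntidiag (univ : Finset (Fin m)) k, ∏ a, T (κ a) (u a) := by
  induction m generalizing k with
  | zero =>
    rw [Finset.univ_eq_empty, Finset.prod_empty, h1]
    rcases k with _ | k <;> simp
  | succ m ih =>
    rw [Fin.prod_univ_succ, hmul]
    simp only [ih, Finset.mul_sum, Finset.sum_sigma']
    refine Finset.sum_bij' (fun x _ => Fin.cons x.1.1 x.2)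
      (fun κ _ => ⟨(κ 0, ∑ a, Fin.tail κ a), Fin.tail κ⟩) ?_ ?_ ?_ ?_ ?_
    · rintro ⟨p, κ⟩ h
      simp only [Finset.mem_sigma, Finset.mem_piAntidiag, mem_antidiagonal] at h ⊢
      refine ⟨?_, by simp⟩
      rw [Fin.sum_univ_succ]
      simp only [Fin.cons_zero, Fin.cons_succ]
      rw [h.2.1, h.1]
    · intro κ h
      simp only [Finset.mem_sigma, Finset.mem_piAntidiag, mem_antidiagonal] at h ⊢
      refine ⟨?_, trivial, by simp⟩
      rw [← h.1, Fin.sum_univ_succ]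
      rfl
    · rintro ⟨⟨p1, p2⟩, κ⟩ h
      simp only [Finset.mem_sigma, Finset.mem_piAntidiag, mem_antidiagonal] at h
      obtain ⟨-, rfl, -⟩ := h
      simp
    · intro κ _
      simp
    · rintro ⟨p, κ⟩ _
      rw [Fin.prod_univ_succ]
      simp

/-- The `l`-th divided power `∂^l / l!` of a derivation satisfies the Leibniz rule for products of
several factors, with multinomial coefficients when written in terms of `∂^l`. -/
theorem iterate_prod {𝕜 : Type*} [Field 𝕜] [CharZero 𝕜] [Algebra 𝕜 M] (δ : Derivation 𝕜 M M)
    {m : ℕ} (u : Fin m → M) (l : ℕ) :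
    δ^[l] (∏ a, u a) = ∑ κ ∈ Finset.piAntidiag (univ : Finset (Fin m)) l,
      (Nat.multinomial univ κ : 𝕜) • ∏ a, δ^[κ a] (u a) := by
  have hfac (n : ℕ) : (n.factorial : 𝕜) ≠ 0 := by exact_mod_cast n.factorial_ne_zero
  have h := leibniz_prod (T := fun l x => ((l.factorial : 𝕜)⁻¹) • δ^[l] x) (M := M) (N := M)
    (fun k => by
      rcases k with _ | k
      · simp
      · simp [Function.iterate_succ_apply])
    (fun k a b => by
      have : δ^[k] (a * b) = ∑ p ∈ antidiagonal k, k.choose p.1 • (δ^[p.1] a * δ^[p.2] b) := by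
        induction k with
        | zero => simp
        | succ k ih =>
          rw [Function.iterate_succ_apply', ih, map_sum,
            Finset.sum_antidiagonal_choose_succ_nsmul (fun i j => δ^[i] a * δ^[j] b) k,
            ← Finset.sum_add_distrib]
          refine Finset.sum_congr rfl fun p hp => ?_
          rw [map_nsmul, Derivation.leibniz, smul_eq_mul, smul_eq_mul,
            ← Function.iterate_succ_apply' (f := δ), ← Function.iterate_succ_apply' (f := δ),
            smul_add, mul_comm (δ^[p.2] b), Nat.choose_symm_of_eq_add (mem_antidiagonal.1 hp).symm]
      rw [this, Finset.smul_sum]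
      refine Finset.sum_congr rfl fun p hp => ?_
      rw [← Nat.cast_smul_eq_nsmul 𝕜, smul_smul, smul_mul_smul_comm]
      congr 1
      have h1 := hfac k
      have h2 := hfac p.1
      have h3 := hfac p.2
      have h4 := Nat.add_choose_mul_factorial_mul_factorial p.1 p.2
      rw [mem_antidiagonal.1 hp] at h4
      have h5 : (k.choose p.1 : 𝕜) * p.1.factorial * p.2.factorial = k.factorial := by
        rw [Nat.choose_symm_of_eq_add (mem_antidiagonal.1 hp).symm]
        exact_mod_cast h4
      field_simp
      linear_combination h5) u l
  have h6 := congrArg (fun x => (l.factorial : 𝕜) • x) h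
  simp only [smul_smul, mul_inv_cancel₀ (hfac l), one_smul] at h6
  rw [h6, Finset.smul_sum]
  refine Finset.sum_congr rfl fun κ hκ => ?_
  rw [Finset.prod_smul, smul_smul]
  congr 1
  have h7 := Nat.multinomial_spec (univ : Finset (Fin m)) κ
  rw [(Finset.mem_piAntidiag.1 hκ).1] at h7
  rw [← h7, Finset.prod_inv_distrib]
  push_cast
  have h8 : ∏ a, ((κ a).factorial : 𝕜) ≠ 0 := Finset.prod_ne_zero_iff.2 fun a _ => hfac _
  field_simp

/-- A sequence of operators with the quasi-Leibniz rule of the coefficients of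
`Δ(z) = (e^{ħ D(z)} - 1) / ħ`. In the quadratic algebra `M[ω]`, `ω² = ħ ω`, it says that
`1 + ω Δ(z)` is multiplicative. -/
theorem quasi_prod {𝕜 : Type*} [CommRing 𝕜] [Algebra 𝕜 M] (ħ : 𝕜) {D : ℕ → M → M}
    (h0 : ∀ a, D 0 a = 0) (h1 : ∀ k, D k 1 = 0)
    (hmul : ∀ k a b, D k (a * b) = D k a * b + a * D k b +
      ħ • ∑ p ∈ antidiagonal k, D p.1 a * D p.2 b)
    {m : ℕ} (u : Fin m → M) {k : ℕ} (hk : k ≠ 0) :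
    D k (∏ a, u a) = ∑ κ ∈ Finset.piAntidiag (univ : Finset (Fin m)) k,
      ħ ^ ((univ.filter fun a => κ a ≠ 0).card - 1) •
        ∏ a, if κ a = 0 then u a else D (κ a) (u a) := by
  obtain ⟨c, hc⟩ : ∃ c, c = algebraMap 𝕜 M ħ := ⟨_, rfl⟩
  obtain ⟨w, hw0⟩ : ∃ w : QuadraticAlgebra M 0 c, w = ⟨0, 1⟩ := ⟨_, rfl⟩
  have hw (n : ℕ) : w ^ (n + 1) = ⟨0, c ^ n⟩ := by
    induction n with
    | zero => simp [hw0]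
    | succ n ih =>
      rw [pow_succ, ih]
      ext <;> simp [hw0, pow_succ, mul_comm]
  have h := leibniz_prod (T := fun k a => (⟨if k = 0 then a else 0, D k a⟩ : QuadraticAlgebra M 0 c))
    (fun k => by
      ext
      · by_cases hk : k = 0 <;> simp [hk, QuadraticAlgebra.re_one]
      · by_cases hk : k = 0 <;> simp [hk, h1, QuadraticAlgebra.im_one])
    (fun k a b => by
      have hsum (f : ℕ × ℕ → QuadraticAlgebra M 0 c) (s : Finset (ℕ × ℕ)) :
          ∑ p ∈ s, f p = (⟨∑ p ∈ s, (f p).re, ∑ p ∈ s, (f p).im⟩ : QuadraticAlgebra M 0 c) := by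
        induction s using Finset.cons_induction with
        | empty => rfl
        | cons a s ha ih => rw [Finset.sum_cons, Finset.sum_cons, Finset.sum_cons, ih]; rfl
      rw [hsum]
      ext
      · rcases k with _ | k
        · simp
        · simp only [QuadraticAlgebra.re_mul, zero_mul, add_zero]
          rw [if_neg k.succ_ne_zero, Finset.sum_eq_zero]
          intro p hp
          have := mem_antidiagonal.1 hp
          by_cases hp1 : p.1 = 0
          · rw [if_neg (by omega : p.2 ≠ 0), mul_zero]
          · rw [if_neg hp1, zero_mul]
      · simp only [QuadraticAlgebra.im_mul, Finset.sum_add_distrib, hmul, Finset.smul_sum]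
        congr 1
        · rw [add_comm]
          congr 1
          · rw [Finset.sum_eq_single (0, k)]
            · simp
            · intro p hp hne
              rw [if_neg, zero_mul]
              intro hp1
              have := mem_antidiagonal.1 hp
              exact hne (Prod.ext hp1 (by simpa [hp1] using this))
            · simp
          · rw [Finset.sum_eq_single (k, 0)]
            · simp
            · intro p hp hne
              rw [if_neg, mul_zero]
              intro hp1
              have := mem_antidiagonal.1 hp
              exact hne (Prod.ext (by simpa [hp1] using this) hp1)
            · simp
        · exact Finset.sum_congr rfl fun p _ => by rw [Algebra.smul_def, hc, mul_assoc]) u k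
  have h' := congrArg QuadraticAlgebra.im h
  have hsum (f : (Fin m → ℕ) → QuadraticAlgebra M 0 c) (s : Finset (Fin m → ℕ)) :
      (∑ p ∈ s, f p).im = ∑ p ∈ s, (f p).im := by
    induction s using Finset.cons_induction with
    | empty => rfl
    | cons a s ha ih => rw [Finset.sum_cons, Finset.sum_cons, ← ih]; rfl
  rw [hsum] at h'
  refine h'.trans (Finset.sum_congr rfl fun κ hκ => ?_)
  have hT (a : Fin m) : (⟨if κ a = 0 then u a else 0, D (κ a) (u a)⟩ : QuadraticAlgebra M 0 c) =
      (if κ a ≠ 0 then w else 1) *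
        algebraMap M (QuadraticAlgebra M 0 c) (if κ a = 0 then u a else D (κ a) (u a)) := by
    by_cases hκ : κ a = 0
    · ext <;> simp [hκ, h0]
    · ext <;> simp [hκ, hw0]
  rw [Finset.prod_congr rfl fun a _ => hT a, Finset.prod_mul_distrib, ← map_prod,
    Finset.prod_ite, Finset.prod_const, Finset.prod_const_one, mul_one]
  obtain ⟨n, hn⟩ : ∃ n, (univ.filter fun a => κ a ≠ 0).card = n + 1 := by
    refine Nat.exists_eq_succ_of_ne_zero fun hc => hk ?_
    rw [← (Finset.mem_piAntidiag.1 hκ).1]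
    refine Finset.sum_eq_zero fun a _ => ?_
    by_contra ha
    exact (Finset.filter_eq_empty_iff.1 (Finset.card_eq_zero.1 hc)) (mem_univ a) ha
  rw [hn, hw, Nat.add_sub_cancel, Algebra.smul_def, map_pow, QuadraticAlgebra.im_mul,
    QuadraticAlgebra.algebraMap_re, QuadraticAlgebra.algebraMap_im, hc]
  ring

end Leibniz

section Operators

variable {𝕜 : Type*} [RCLike 𝕜] {A : Type*} [CommRing A] [Algebra 𝕜 A]

variable (A) in
/-- The operator `∂_k^ħ` for `k ≥ 1`, and the identity for `k = 0`. -/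
def hderivOrId (ħ : 𝕜) (k : ℕ) : Module.End 𝕜 (MvPowerSeries ℕ+ A) :=
  if k = 0 then 1 else hderiv A ħ k

theorem hderiv_prod (ħ : 𝕜) {m : ℕ} (u : Fin m → MvPowerSeries ℕ+ A) {k : ℕ} (hk : k ≠ 0) :
    hderiv A ħ k (∏ a, u a) = ∑ κ ∈ Finset.piAntidiag (univ : Finset (Fin m)) k,
      leibnizCoeff ħ k κ • ∏ a, hderivOrId A ħ (κ a) (u a) := by
  rw [hderiv_eq, LinearMap.smul_apply, quasi_prod ħ (D := fun k => hD A ħ k) (by simp)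
    (fun k => hD_C ħ k 1) (hD_mul ħ) u hk, Finset.smul_sum]
  refine Finset.sum_congr rfl fun κ _ => ?_
  have hT (a : Fin m) : (if κ a = 0 then u a else hD A ħ (κ a) (u a)) =
      ((max (κ a) 1 : ℕ) : 𝕜)⁻¹ • hderivOrId A ħ (κ a) (u a) := by
    by_cases h : κ a = 0
    · simp [h, hderivOrId]
    · rw [if_neg h, hderivOrId, if_neg h, hD_eq_smul_hderiv, max_eq_left (by omega),
        LinearMap.smul_apply]
  rw [Finset.prod_congr rfl fun a _ => hT a, Finset.prod_smul, smul_smul, smul_smul, leibnizCoeff,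
    Finset.prod_inv_distrib]
  congr 1
  rw [div_eq_mul_inv]
  push_cast
  ring

end Operators

/-! ### Lists of columns and the action of a deformed derivative on one column -/

section Columns

/-- The lists of columns `(s_1, l_1), …, (s_m, l_m)` of positive integers with
`∑ (s_a + l_a) = n`. -/
def colLists (n : ℕ) : Finset (List (ℕ × ℕ)) :=
  (listsIn (Icc 1 n ×ˢ Icc 1 n) n).filter fun l => (l.map fun c => c.1 + c.2).sum = n

theorem mem_colLists {n : ℕ} {l : List (ℕ × ℕ)} :
    l ∈ colLists n ↔ (∀ c ∈ l, 1 ≤ c.1 ∧ 1 ≤ c.2) ∧ (l.map fun c => c.1 + c.2).sum = n := by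
  simp only [colLists, Finset.mem_filter, mem_listsIn, Finset.mem_Icc, Finset.mem_product]
  constructor
  · rintro ⟨⟨-, h⟩, h'⟩
    exact ⟨fun s hs => ⟨(h s hs).1.1, (h s hs).2.1⟩, h'⟩
  · rintro ⟨h, rfl⟩
    refine ⟨⟨?_, fun c hc => ?_⟩, rfl⟩
    · have := List.length_le_sum_of_one_le (l.map fun c => c.1 + c.2) (fun i hi => by
        obtain ⟨c, hc, rfl⟩ := List.mem_map.1 hi
        have := h c hc
        omega)
      simpa only [List.length_map] using this
    · have h1 := List.single_le_sum (l := l.map fun c => c.1 + c.2) (by simp) _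
        (List.mem_map_of_mem hc)
      have h2 := h c hc
      omega

/-- The blocks `B` of columns that occur when `∂_k^ħ` is applied to the column `c`. -/
def blocks (k : ℕ) (c : ℕ × ℕ) : Finset (List (ℕ × ℕ)) :=
  (colLists (c.1 + c.2 + k)).filter fun B => parent k B = c

theorem blocks_zero {c : ℕ × ℕ} (hc : 1 ≤ c.1 ∧ 1 ≤ c.2) : blocks 0 c = {[c]} := by
  ext B
  simp only [blocks, Finset.mem_filter, mem_colLists, Finset.mem_singleton, parent, if_true]
  constructor
  · rintro ⟨⟨h1, h2⟩, h3⟩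
    match B, h1, h2, h3 with
    | [], _, h2, _ => simp at h2; omega
    | [a], _, _, h3 => simpa using h3
    | a :: b :: t, h1, h2, h3 =>
      have := h1 b (by simp)
      simp only [List.headD_cons] at h3
      subst h3
      simp at h2
      omega
  · rintro rfl
    simpa using hc

theorem sum_map_add_length (B : List (ℕ × ℕ)) :
    (B.map fun c => c.1 + 1).sum = (B.map Prod.fst).sum + B.length := by
  induction B with
  | nil => rfl
  | cons a B ih => simp only [List.map_cons, List.sum_cons, ih, List.length_cons]; omega

theorem sum_map_columns {B : List (ℕ × ℕ)} (h : ∀ c ∈ B, 1 ≤ c.1 ∧ 1 ≤ c.2) :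
    (B.map fun c => c.1 + c.2).sum =
      (B.map fun c => c.1 + 1).sum + (B.map fun c => c.2 - 1).sum := by
  induction B with
  | nil => rfl
  | cons a B ih =>
    have := h a (by simp)
    simp only [List.map_cons, List.sum_cons, ih fun c hc => h c (by simp [hc])]
    omega

theorem mem_blocks {k : ℕ} (hk : k ≠ 0) {c : ℕ × ℕ} (hc : 1 ≤ c.1) {B : List (ℕ × ℕ)} :
    B ∈ blocks k c ↔ (∀ c ∈ B, 1 ≤ c.1 ∧ 1 ≤ c.2) ∧ (B.map fun c => c.1 + 1).sum = c.1 + k ∧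
      (B.map fun c => c.2 - 1).sum = c.2 := by
  simp only [blocks, Finset.mem_filter, mem_colLists, parent, if_neg hk, Prod.ext_iff]
  constructor
  · rintro ⟨⟨h1, h2⟩, h3, h4⟩
    rw [← sum_map_add_length] at h3
    exact ⟨h1, by omega, h4⟩
  · rintro ⟨h1, h2, h3⟩
    rw [sum_map_columns h1, ← sum_map_add_length]
    exact ⟨⟨h1, by omega⟩, by omega, h3⟩

theorem mem_blocks_parent {𝕜 : Type*} [RCLike 𝕜] {k : ℕ} {B : List (ℕ × ℕ)}
    (h : blockCoeff 𝕜 k B ≠ 0) :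
    (1 ≤ (parent k B).1 ∧ 1 ≤ (parent k B).2) ∧ B ∈ blocks k (parent k B) := by
  unfold blockCoeff at h
  split_ifs at h with h1 h2 h3
  · subst h2
    obtain ⟨c, rfl⟩ := List.length_eq_one_iff.1 h3
    refine ⟨h1.2, ?_⟩
    rw [blocks_zero h1.2]
    simp [parent]
  · exact absurd rfl h
  · refine ⟨h1.2, (mem_blocks h2 h1.2.1).2 ⟨h1.1, ?_, ?_⟩⟩
    · have := h1.2.1
      rw [parent, if_neg h2] at this ⊢
      rw [sum_map_add_length]
      simp only at this ⊢
      omega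
    · rw [parent, if_neg h2]
  · exact absurd rfl h

theorem ne_nil_of_mem_blocks {k : ℕ} {c : ℕ × ℕ} (hc : 1 ≤ c.2) {B : List (ℕ × ℕ)}
    (h : B ∈ blocks k c) : B ≠ [] := by
  rintro rfl
  have := (Finset.mem_filter.1 h).2
  unfold parent at this
  split_ifs at this <;> subst this <;> simp at hc

theorem multinomial_get {α : Type*} (B : List α) (f : α → ℕ) :
    Nat.multinomial univ (fun a : Fin B.length => f (B.get a)) =
      (B.map f).sum.factorial / (B.map fun a => (f a).factorial).prod := by
  have h (g : α → ℕ) : List.ofFn (fun a : Fin B.length => g (B.get a)) = B.map g := by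
    conv_rhs => rw [← List.ofFn_get B, List.map_ofFn]
    rfl
  rw [Nat.multinomial, ← List.sum_ofFn, ← List.prod_ofFn, h f, h fun a => (f a).factorial]

variable {𝕜 : Type*} [RCLike 𝕜] {A : Type*} [CommRing A] [Algebra 𝕜 A]

/-- The product `∂^{l_1} ∂_{s_1}^ħ F ⋯ ∂^{l_m} ∂_{s_m}^ħ F` for the columns `(s_a, l_a)`,
where `∂ = ∂_1`. -/
def colProd (ħ : 𝕜) (F : MvPowerSeries ℕ+ A) (B : List (ℕ × ℕ)) : MvPowerSeries ℕ+ A :=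
  (B.map fun c => (dt 𝕜 A 1)^[c.2] (hderiv A ħ c.1 F)).prod

theorem dt_iterate_prod {m : ℕ} (u : Fin m → MvPowerSeries ℕ+ A) (l : ℕ) :
    (dt 𝕜 A 1)^[l] (∏ a, u a) = ∑ κ ∈ Finset.piAntidiag (univ : Finset (Fin m)) l,
      (Nat.multinomial univ κ : 𝕜) • ∏ a, (dt 𝕜 A 1)^[κ a] (u a) :=
  iterate_prod ((MvPowerSeries.pderiv A 1).restrictScalars 𝕜) u l

/-- `∂_k^ħ` applied to one column, for a solution `F`: expand `∂_k^ħ ∂_s^ħ F` by the Fay identity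
and `∂^l` of the products by the Leibniz rule. -/
theorem hderivOrId_column {ħ : 𝕜} {F : MvPowerSeries ℕ+ A}
    (hF : ∀ i j, hderiv A ħ i (hderiv A ħ j F) =
      hPoly 𝕜 (fun s => dt 𝕜 A 1 (hderiv A ħ s F)) i j)
    (k : ℕ) {c : ℕ × ℕ} (hc : 1 ≤ c.1 ∧ 1 ≤ c.2) :
    hderivOrId A ħ k ((dt 𝕜 A 1)^[c.2] (hderiv A ħ c.1 F)) =
      ∑ B ∈ blocks k c, blockCoeff 𝕜 k B • colProd ħ F B := by
  rcases eq_or_ne k 0 with rfl | hk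
  · rw [blocks_zero hc, Finset.sum_singleton]
    simp [hderivOrId, blockCoeff, parent, colProd, hc.1, hc.2]
  rw [hderivOrId, if_neg hk, ← Module.End.pow_apply, ← Module.End.mul_apply,
    ← ((commute_dt_hderiv ħ 1 k).pow_left c.2).eq, Module.End.mul_apply,
    ← Module.End.mul_apply (hderiv A ħ k), (commute_hderiv ħ k c.1).eq, Module.End.mul_apply, hF, hPoly, map_sum]
  have hmaps : ∀ B ∈ blocks k c, B.map Prod.fst ∈ sLists (c.1 + k) := by
    intro B hB
    obtain ⟨h1, h2, -⟩ := (mem_blocks hk hc.1).1 hB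
    rw [mem_sLists]
    refine ⟨fun s hs => ?_, by simpa [Function.comp_def] using h2⟩
    obtain ⟨c, hc, rfl⟩ := List.mem_map.1 hs
    exact (h1 c hc).1
  rw [← Finset.sum_fiberwise_of_maps_to hmaps]
  refine Finset.sum_congr rfl fun x hx => ?_
  have hprod : (x.map fun s => dt 𝕜 A 1 (hderiv A ħ s F)).prod =
      ∏ a : Fin x.length, dt 𝕜 A 1 (hderiv A ħ (x.get a) F) := by
    conv_lhs => rw [← List.ofFn_get x, List.map_ofFn, List.prod_ofFn]
    rfl
  rw [map_smul, hprod, Module.End.pow_apply, dt_iterate_prod, Finset.smul_sum]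
  obtain ⟨hx1, hx2⟩ := mem_sLists.1 hx
  refine Finset.sum_bij (fun κ _ => List.ofFn fun a => (x.get a, κ a + 1)) ?_ ?_ ?_ ?_
  · intro κ hκ
    rw [Finset.mem_filter, mem_blocks hk hc.1, List.forall_mem_ofFn_iff, List.map_ofFn,
      List.map_ofFn, List.map_ofFn, List.sum_ofFn, List.sum_ofFn]
    refine ⟨⟨fun a => ⟨hx1 _ (x.get_mem a), by simp⟩, ?_, ?_⟩, List.ofFn_get x⟩
    · rw [← hx2]
      conv_rhs => rw [← List.ofFn_get x, List.map_ofFn, List.sum_ofFn]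
      rfl
    · simpa using (Finset.mem_piAntidiag.1 hκ).1
  · intro κ _ κ' _ h
    have := List.ofFn_injective h
    funext a
    simpa using congrFun this a
  · intro B hB
    obtain ⟨hB1, rfl⟩ := Finset.mem_filter.1 hB
    obtain ⟨h1, h2, h3⟩ := (mem_blocks hk hc.1).1 hB1
    have hlist : List.ofFn (fun a : Fin (B.map Prod.fst).length => B.get (a.cast (by simp))) =
        B := by
      apply List.ext_getElem <;> simp
    refine ⟨fun a => (B.get (a.cast (by simp))).2 - 1, ?_, ?_⟩
    · rw [Finset.mem_piAntidiag]
      refine ⟨?_, by simp⟩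
      rw [← h3]
      conv_rhs => rw [← hlist, List.map_ofFn, List.sum_ofFn]
      rfl
    · conv_rhs => rw [← hlist]
      congr 1
      funext a
      ext
      · simp
      · have := (h1 _ (B.get_mem (a.cast (by simp)))).2
        simp only
        omega
  · intro κ hκ
    generalize hBdef : (List.ofFn fun a => (x.get a, κ a + 1)) = B
    have hBx : B.map Prod.fst = x := by
      rw [← hBdef, List.map_ofFn]
      exact List.ofFn_get x
    have hB2 : (B.map fun c => c.2 - 1).sum = c.2 := by
      rw [← hBdef, List.map_ofFn, List.sum_ofFn]
      simpa using (Finset.mem_piAntidiag.1 hκ).1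
    have hB1 : ∀ c ∈ B, 1 ≤ c.1 ∧ 1 ≤ c.2 := by
      rw [← hBdef, List.forall_mem_ofFn_iff]
      exact fun a => ⟨hx1 _ (x.get_mem a), by simp⟩
    have hBk : B ∈ blocks k c := by
      rw [mem_blocks hk hc.1]
      refine ⟨hB1, ?_, hB2⟩
      rw [← hx2, ← hBx, List.map_map]
      rfl
    have hpar : parent k B = c := (Finset.mem_filter.1 hBk).2
    rw [smul_smul, blockCoeff, hpar, if_pos ⟨hB1, hc⟩, if_neg hk, hBx, mul_comm]
    congr 1
    · congr 2
      rw [multinomial_get B fun c => c.2 - 1, Nat.multinomial, ← hBdef, List.map_ofFn,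
        List.map_ofFn, List.sum_ofFn, List.prod_ofFn]
      rfl
    · rw [colProd, ← hBdef, List.map_ofFn, List.prod_ofFn]
      rfl

end Columns

/-! ### The recursion for the constants `P^ħ` -/

section Chain

variable {𝕜 : Type*} [RCLike 𝕜] {A : Type*} [CommRing A] [Algebra 𝕜 A]

/-- The summand of the recursion for `P^ħ`, for a sequence of pairs `(k_a, B_a)` of an order of
differentiation and a block of columns; `P` stands for the constants of the previous step. -/
def stepTerm (ħ : 𝕜) (F : MvPowerSeries ℕ+ A) (P : List (ℕ × ℕ) → 𝕜) (i : ℕ)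
    (w : Σ m, Fin m → ℕ × List (ℕ × ℕ)) : MvPowerSeries ℕ+ A :=
  (P (List.ofFn fun a => parent (w.2 a).1 (w.2 a).2) * leibnizCoeff ħ i (fun a => (w.2 a).1) *
    ∏ a, blockCoeff 𝕜 (w.2 a).1 (w.2 a).2) • ∏ a, colProd ħ F (w.2 a).2

theorem sum_map_eq_sum_get {α : Type*} (l : List α) (f : α → ℕ) :
    (l.map f).sum = ∑ a : Fin l.length, f (l.get a) := by
  conv_lhs => rw [← List.ofFn_get l, List.map_ofFn, List.sum_ofFn]
  rfl

theorem exists_sigma_eq {L : List (List (ℕ × ℕ))} {m : ℕ} (κ : Fin m → ℕ)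
    {B : Fin m → List (ℕ × ℕ)} (h : L = List.ofFn B) :
    ∃ κ' : Fin L.length → ℕ, ∑ a, κ' a = ∑ a, κ a ∧
      (⟨L.length, fun a => (κ' a, L.get a)⟩ : Σ m, Fin m → ℕ × List (ℕ × ℕ)) =
        ⟨m, fun a => (κ a, B a)⟩ := by
  subst h
  have hlen : (List.ofFn B).length = m := List.length_ofFn
  refine ⟨fun a => κ (a.cast hlen), ?_, ?_⟩
  · exact Fintype.sum_equiv (finCongr hlen) _ _ fun a => rfl
  · rw [← List.ofFn_inj']
    apply List.ext_getElem <;> simp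

theorem colProd_flatten (ħ : 𝕜) (F : MvPowerSeries ℕ+ A) (L : List (List (ℕ × ℕ))) :
    colProd ħ F L.flatten = ∏ a : Fin L.length, colProd ħ F (L.get a) := by
  have h : ∏ a : Fin L.length, colProd ħ F (L.get a) = (L.map (colProd ħ F)).prod := by
    conv_rhs => rw [← List.ofFn_get L, List.map_ofFn, List.prod_ofFn]
    rfl
  rw [h]
  simp only [colProd, List.map_flatten, List.prod_flatten, List.map_map]
  rfl

/-- The sequence of pairs (order, block) for a list of columns cut into blocks. -/
def cutTerm (x : Σ (xy : List (ℕ × ℕ)) (c : Composition xy.length),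
    Fin (xy.splitWrtComposition c).length → ℕ) : Σ m, Fin m → ℕ × List (ℕ × ℕ) :=
  ⟨(x.1.splitWrtComposition x.2.1).length,
    fun a => (x.2.2 a, (x.1.splitWrtComposition x.2.1).get a)⟩

theorem cutTerm_injective : Function.Injective cutTerm := by
  rintro ⟨xy, c, κ⟩ ⟨xy', c', κ'⟩ h
  have hs : xy.splitWrtComposition c = xy'.splitWrtComposition c' := by
    have := congrArg (fun w : Σ m, Fin m → ℕ × List (ℕ × ℕ) => List.ofFn fun a => (w.2 a).2) h
    simpa only [cutTerm, List.ofFn_get] using this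
  have hxy : xy = xy' := by
    rw [← List.flatten_splitWrtComposition xy c, hs, List.flatten_splitWrtComposition]
  subst hxy
  have hc : c = c' := by
    ext1
    rw [← List.map_length_splitWrtComposition xy c, hs, List.map_length_splitWrtComposition]
  subst hc
  have hκ : κ = κ' := List.ofFn_injective
    (congrArg (fun w : Σ m, Fin m → ℕ × List (ℕ × ℕ) => List.ofFn fun a => (w.2 a).1) h)
  rw [hκ]

theorem sum_columns_blocks {k : ℕ} {c : ℕ × ℕ} {B : List (ℕ × ℕ)} (h : B ∈ blocks k c) :
    (B.map fun c => c.1 + c.2).sum = c.1 + c.2 + k :=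
  (mem_colLists.1 (Finset.mem_filter.1 h).1).2

/-- One step of the recursion: `∂_i^ħ` applied to a combination of products of columns. -/
theorem hderiv_sum_colProd {ħ : 𝕜} {F : MvPowerSeries ℕ+ A}
    (hF : ∀ i j, hderiv A ħ i (hderiv A ħ j F) =
      hPoly 𝕜 (fun s => dt 𝕜 A 1 (hderiv A ħ s F)) i j)
    (P : List (ℕ × ℕ) → 𝕜) {i : ℕ} (hi : i ≠ 0) (n : ℕ) :
    hderiv A ħ i (∑ sl ∈ colLists n, P sl • colProd ħ F sl) =
      ∑ xy ∈ colLists (i + n), (∑ c : Composition xy.length,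
        ∑ κ ∈ Finset.piAntidiag
            (Finset.univ : Finset (Fin (xy.splitWrtComposition c).length)) i,
          P (List.ofFn fun a => parent (κ a) ((xy.splitWrtComposition c).get a)) *
            leibnizCoeff ħ i κ *
            ∏ a, blockCoeff 𝕜 (κ a) ((xy.splitWrtComposition c).get a)) • colProd ħ F xy := by
  classical
  -- the left hand side as a sum over sequences of blocks
  let Y : Finset (Σ (sl : List (ℕ × ℕ)) (_ : Fin sl.length → ℕ),
      Fin sl.length → List (ℕ × ℕ)) :=
    (colLists n).sigma fun sl => (Finset.piAntidiag univ i).sigma fun κ =>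
      Fintype.piFinset fun a => blocks (κ a) (sl.get a)
  let eY (y : Σ (sl : List (ℕ × ℕ)) (_ : Fin sl.length → ℕ), Fin sl.length → List (ℕ × ℕ)) :
      Σ m, Fin m → ℕ × List (ℕ × ℕ) := ⟨y.1.length, fun a => (y.2.1 a, y.2.2 a)⟩
  have hYmem {y} (hy : y ∈ Y) : y.1 ∈ colLists n ∧ ∑ a, y.2.1 a = i ∧
      ∀ a, y.2.2 a ∈ blocks (y.2.1 a) (y.1.get a) := by
    simp only [Y, Finset.mem_sigma, Finset.mem_piAntidiag, Fintype.mem_piFinset] at hy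
    exact ⟨hy.1, hy.2.1.1, hy.2.2⟩
  have hYpar {y} (hy : y ∈ Y) :
      (List.ofFn fun a => parent ((eY y).2 a).1 ((eY y).2 a).2) = y.1 := by
    conv_rhs => rw [← List.ofFn_get y.1]
    congr 1
    funext a
    exact (Finset.mem_filter.1 ((hYmem hy).2.2 a)).2
  have hYinj : Set.InjOn eY Y := by
    rintro ⟨sl, κ, B⟩ hy ⟨sl', κ', B'⟩ hy' h
    have h1 : sl = sl' := (hYpar hy).symm.trans
      ((congrArg (fun w : Σ m, Fin m → ℕ × List (ℕ × ℕ) =>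
        List.ofFn fun a => parent (w.2 a).1 (w.2 a).2) h).trans (hYpar hy'))
    subst h1
    have h2 := eq_of_heq (Sigma.mk.inj h).2
    have h3 : κ = κ' := funext fun a => congrArg Prod.fst (congrFun h2 a)
    have h4 : B = B' := funext fun a => congrArg Prod.snd (congrFun h2 a)
    rw [h3, h4]
  have hL : hderiv A ħ i (∑ sl ∈ colLists n, P sl • colProd ħ F sl) =
      ∑ w ∈ Y.image eY, stepTerm ħ F P i w := by
    rw [Finset.sum_image hYinj, Finset.sum_sigma, map_sum]
    refine Finset.sum_congr rfl fun sl hsl => ?_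
    have hcol : colProd ħ F sl = ∏ a : Fin sl.length,
        (dt 𝕜 A 1)^[(sl.get a).2] (hderiv A ħ (sl.get a).1 F) := by
      rw [colProd]
      conv_lhs => rw [← List.ofFn_get sl, List.map_ofFn, List.prod_ofFn]
      rfl
    rw [map_smul, hcol, hderiv_prod ħ _ hi, Finset.sum_sigma, Finset.smul_sum]
    refine Finset.sum_congr rfl fun κ hκ => ?_
    rw [Finset.prod_congr rfl fun a _ => hderivOrId_column hF (κ a)
      ((mem_colLists.1 hsl).1 _ (sl.get_mem a)), Finset.prod_univ_sum, Finset.smul_sum,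
      Finset.smul_sum]
    refine Finset.sum_congr rfl fun B hB => ?_
    have hy : (⟨sl, κ, B⟩ : Σ (sl : List (ℕ × ℕ)) (_ : Fin sl.length → ℕ),
        Fin sl.length → List (ℕ × ℕ)) ∈ Y :=
      Finset.mem_sigma.2 ⟨hsl, Finset.mem_sigma.2 ⟨hκ, hB⟩⟩
    rw [stepTerm, hYpar hy, Finset.prod_smul, smul_smul, smul_smul, mul_assoc]
  -- the right hand side as a sum over sequences of blocks
  let X : Finset (Σ (xy : List (ℕ × ℕ)) (c : Composition xy.length),
      Fin (xy.splitWrtComposition c).length → ℕ) :=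
    (colLists (i + n)).sigma fun xy => univ.sigma fun c => Finset.piAntidiag univ i
  have hR : ∑ xy ∈ colLists (i + n), (∑ c : Composition xy.length,
        ∑ κ ∈ Finset.piAntidiag
            (Finset.univ : Finset (Fin (xy.splitWrtComposition c).length)) i,
          P (List.ofFn fun a => parent (κ a) ((xy.splitWrtComposition c).get a)) *
            leibnizCoeff ħ i κ *
            ∏ a, blockCoeff 𝕜 (κ a) ((xy.splitWrtComposition c).get a)) • colProd ħ F xy =
      ∑ w ∈ X.image cutTerm, stepTerm ħ F P i w := by
    rw [Finset.sum_image cutTerm_injective.injOn, Finset.sum_sigma]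
    refine Finset.sum_congr rfl fun xy _ => ?_
    rw [Finset.sum_sigma, Finset.sum_smul]
    refine Finset.sum_congr rfl fun c _ => ?_
    rw [Finset.sum_smul]
    refine Finset.sum_congr rfl fun κ _ => ?_
    have hcol : colProd ħ F xy = ∏ a, colProd ħ F ((xy.splitWrtComposition c).get a) := by
      conv_lhs => rw [← List.flatten_splitWrtComposition xy c]
      rw [colProd_flatten]
    rw [hcol]
    rfl
  rw [hL, hR]
  refine Finset.sum_subset ?_ ?_
  · -- concatenating the blocks
    intro w hw
    obtain ⟨⟨sl, κ, B⟩, hy, rfl⟩ := Finset.mem_image.1 hw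
    obtain ⟨h1, h2, h3⟩ := hYmem hy
    obtain ⟨h4, h5⟩ := mem_colLists.1 h1
    simp only at h2 h3
    let c : Composition (List.ofFn B).flatten.length :=
      ⟨(List.ofFn B).map List.length, by
        intro j hj
        simp only [List.map_ofFn, List.mem_ofFn] at hj
        obtain ⟨a, rfl⟩ := hj
        exact List.length_pos_iff.2
          (ne_nil_of_mem_blocks (h4 _ (sl.get_mem a)).2 (h3 a)), List.length_flatten.symm⟩
    obtain ⟨κ', hκ', heq⟩ := exists_sigma_eq κ (List.splitWrtComposition_flatten (List.ofFn B) c rfl)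
    refine Finset.mem_image.2 ⟨⟨(List.ofFn B).flatten, c, κ'⟩, ?_, heq⟩
    refine Finset.mem_sigma.2 ⟨mem_colLists.2 ⟨?_, ?_⟩, Finset.mem_sigma.2 ⟨mem_univ _, ?_⟩⟩
    · intro d hd
      obtain ⟨b, hb, hdb⟩ := List.mem_flatten.1 hd
      obtain ⟨a, rfl⟩ := List.mem_ofFn.1 hb
      exact (mem_colLists.1 (Finset.mem_filter.1 (h3 a)).1).1 d hdb
    · simp only [List.map_flatten, List.sum_flatten, List.map_ofFn, List.sum_ofFn]
      refine (Finset.sum_congr rfl fun a _ => sum_columns_blocks (h3 a)).trans ?_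
      rw [Finset.sum_add_distrib, h2, add_comm, ← h5]
      exact congrArg (i + ·) (sum_map_eq_sum_get sl fun c => c.1 + c.2).symm
    · exact Finset.mem_piAntidiag.2 ⟨hκ'.trans h2, by simp⟩
  · -- the blocks with nonzero coefficient
    intro w hw hw'
    obtain ⟨⟨xy, c, κ⟩, hx, rfl⟩ := Finset.mem_image.1 hw
    obtain ⟨h1, h2⟩ := Finset.mem_sigma.1 hx
    have h3 := (Finset.mem_piAntidiag.1 (Finset.mem_sigma.1 h2).2).1
    obtain ⟨-, h5⟩ := mem_colLists.1 h1
    simp only at h3 h5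
    by_contra hne
    refine hw' ?_
    have hb (a) : blockCoeff 𝕜 (κ a) ((xy.splitWrtComposition c).get a) ≠ 0 := by
      intro h0
      refine hne ?_
      exact smul_eq_zero_of_left (mul_eq_zero_of_right _ (Finset.prod_eq_zero (mem_univ a) h0)) _
    let sl := List.ofFn fun a => parent (κ a) ((xy.splitWrtComposition c).get a)
    have hlen : sl.length = (xy.splitWrtComposition c).length := List.length_ofFn
    refine Finset.mem_image.2 ⟨⟨sl, fun a => κ (a.cast hlen),
      fun a => (xy.splitWrtComposition c).get (a.cast hlen)⟩, ?_, ?_⟩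
    · refine Finset.mem_sigma.2 ⟨mem_colLists.2 ⟨?_, ?_⟩, Finset.mem_sigma.2 ⟨?_, ?_⟩⟩
      · exact List.forall_mem_ofFn_iff.2 fun a => (mem_blocks_parent (hb a)).1
      · have h6 : (xy.map fun c => c.1 + c.2).sum = ∑ a : Fin (xy.splitWrtComposition c).length,
            (((xy.splitWrtComposition c).get a).map fun c => c.1 + c.2).sum := by
          conv_lhs => rw [← List.flatten_splitWrtComposition xy c, List.map_flatten,
            List.sum_flatten, List.map_map, ← List.ofFn_get (xy.splitWrtComposition c),
            List.map_ofFn, List.sum_ofFn]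
          rfl
        rw [Finset.sum_congr rfl fun a _ => sum_columns_blocks (mem_blocks_parent (hb a)).2,
          Finset.sum_add_distrib, h3, h5] at h6
        rw [List.map_ofFn, List.sum_ofFn]
        simp only [Function.comp_def]
        omega
      · refine Finset.mem_piAntidiag.2 ⟨?_, by simp⟩
        rw [← h3]
        exact Fintype.sum_equiv (finCongr hlen) _ _ fun a => rfl
      · refine Fintype.mem_piFinset.2 fun a => ?_
        have := (mem_blocks_parent (hb (a.cast hlen))).2
        convert this using 2
        simp only [sl, List.get_eq_getElem, List.getElem_ofFn]
        rfl
    · simp only [eY, cutTerm]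
      rw [← List.ofFn_inj']
      apply List.ext_getElem <;> simp [sl]

/-- The derivatives `∂_{i_r}^ħ ⋯ ∂_{i_1}^ħ F` of a solution, `r ≥ 2`. -/
theorem prod_hderiv_eq_sum_colProd {ħ : 𝕜} {F : MvPowerSeries ℕ+ A}
    (hF : ∀ i j, hderiv A ħ i (hderiv A ħ j F) =
      hPoly 𝕜 (fun s => dt 𝕜 A 1 (hderiv A ħ s F)) i j) :
    ∀ {is : List ℕ}, 2 ≤ is.length → (∀ i ∈ is, i ≠ 0) →
      (is.map (hderiv A ħ)).prod F =
        ∑ xy ∈ colLists is.sum, PhbarRev ħ is xy • colProd ħ F xy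
  | [], h, _ => by simp at h
  | [_], h, _ => by simp at h
  | [i₂, i₁], _, _ => by
    simp only [List.map_cons, List.map_nil, List.prod_cons, List.prod_nil, mul_one, PhbarRev,
      List.sum_cons, List.sum_nil, add_zero]
    rw [(commute_hderiv ħ i₂ i₁).eq, Module.End.mul_apply, hF, hPoly, add_comm i₂]
    simp only [ite_smul, zero_smul]
    rw [← Finset.sum_filter]
    refine Finset.sum_nbij' (List.map fun s => (s, 1)) (List.map Prod.fst) ?_ ?_ ?_ ?_ ?_
    · intro l hl
      obtain ⟨h1, h2⟩ := mem_sLists.1 hl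
      rw [Finset.mem_filter, mem_colLists]
      refine ⟨⟨by simpa using h1, ?_⟩, by simp⟩
      rw [List.map_map]
      exact h2
    · intro xy h
      obtain ⟨h1, h3⟩ := Finset.mem_filter.1 h
      obtain ⟨h1, h2⟩ := mem_colLists.1 h1
      rw [mem_sLists]
      refine ⟨fun s hs => ?_, ?_⟩
      · obtain ⟨c, hc, rfl⟩ := List.mem_map.1 hs
        exact (h1 c hc).1
      · rw [← h2, List.map_map]
        congr 1
        exact List.map_congr_left fun c hc => by simp [h3 c hc]
    · intro l _
      simp [Function.comp_def]
    · intro xy h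
      rw [List.map_map]
      conv_rhs => rw [← List.map_id xy]
      refine List.map_congr_left fun c hc => ?_
      ext
      · rfl
      · exact ((Finset.mem_filter.1 h).2 c hc).symm
    · intro l _
      simp [colProd, Function.comp_def]
  | i :: i' :: i'' :: rest, _, h => by
    rw [List.map_cons, List.prod_cons, Module.End.mul_apply,
      prod_hderiv_eq_sum_colProd hF (is := i' :: i'' :: rest) (by simp)
        (fun j hj => h j (List.mem_cons_of_mem _ hj)),
      hderiv_sum_colProd hF _ (h i (by simp)), List.sum_cons]
    rfl

/-- The columns with nonzero constant have `l_a ≤ r - 1`. -/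
theorem le_of_PhbarRev_ne_zero {ħ : 𝕜} :
    ∀ {is : List ℕ} {xy : List (ℕ × ℕ)}, PhbarRev ħ is xy ≠ 0 → ∀ c ∈ xy, c.2 ≤ is.length - 1
  | [], _, h => absurd rfl h
  | [_], _, h => absurd rfl h
  | [i₂, i₁], xy, h => by
    intro c hc
    rw [PhbarRev] at h
    split_ifs at h with h1
    · simp [h1 c hc]
    · exact absurd rfl h
  | i :: i' :: i'' :: rest, xy, h => by
    intro c hc
    rw [PhbarRev] at h
    obtain ⟨K, -, h⟩ := Finset.exists_ne_zero_of_sum_ne_zero h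
    obtain ⟨κ, -, h⟩ := Finset.exists_ne_zero_of_sum_ne_zero h
    have h1 := left_ne_zero_of_mul (left_ne_zero_of_mul h)
    have h2 (a) := Finset.prod_ne_zero_iff.1 (right_ne_zero_of_mul h) a (mem_univ a)
    rw [← List.flatten_splitWrtComposition xy K] at hc
    obtain ⟨B, hB, hc⟩ := List.mem_flatten.1 hc
    obtain ⟨a, rfl⟩ := List.mem_iff_get.1 hB
    have h3 := le_of_PhbarRev_ne_zero h1 _ (List.mem_ofFn.2 ⟨a, rfl⟩)
    obtain ⟨h4, h5⟩ := mem_blocks_parent (h2 a)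
    simp only [List.length_cons] at h3 ⊢
    rcases eq_or_ne (κ a) 0 with h0 | h0
    · rw [h0] at h3 h4 h5
      rw [blocks_zero h4, Finset.mem_singleton] at h5
      rw [h5, List.mem_singleton] at hc
      rw [← hc] at h3
      omega
    · have h6 := ((mem_blocks h0 h4.1).1 h5).2.2
      have h7 := List.single_le_sum
        (l := ((xy.splitWrtComposition K).get a).map fun c => c.2 - 1) (by simp) _
        (List.mem_map_of_mem hc)
      omega

end Chain

/-! ### Solutions are given by the explicit formula -/

section Solution

variable {𝕜 : Type*} [RCLike 𝕜] {A : Type*} [CommRing A] [Algebra 𝕜 A]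

/-- `∂_x` as a linear operator. -/
def dxEnd (d : Derivation 𝕜 A A) : Module.End 𝕜 (MvPowerSeries ℕ+ A) where
  toFun := dx d
  map_add' _ _ := MvPowerSeries.ext fun _ => map_add d _ _
  map_smul' c _ := MvPowerSeries.ext fun _ => d.map_smul c _

theorem coeff_dxEnd (d : Derivation 𝕜 A A) (G : MvPowerSeries ℕ+ A) (n : ℕ+ →₀ ℕ) :
    MvPowerSeries.coeff n (dxEnd d G) = d (MvPowerSeries.coeff n G) := rfl

theorem constantCoeff_dxEnd_iterate (d : Derivation 𝕜 A A) (G : MvPowerSeries ℕ+ A) (l : ℕ) :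
    MvPowerSeries.constantCoeff ((dxEnd d)^[l] G) = d^[l] (MvPowerSeries.constantCoeff G) := by
  induction l with
  | zero => rfl
  | succ l ih =>
    rw [Function.iterate_succ_apply', Function.iterate_succ_apply', ← ih]
    exact coeff_dxEnd d _ 0

theorem commute_dxEnd_dt (d : Derivation 𝕜 A A) (k : ℕ+) : Commute (dxEnd d) (dt 𝕜 A k) := by
  refine LinearMap.ext fun G => MvPowerSeries.ext fun n => ?_
  rw [Module.End.mul_apply, Module.End.mul_apply, coeff_dxEnd, coeff_dt, coeff_dt, coeff_dxEnd,
    ← Nat.cast_succ, mul_comm, ← nsmul_eq_mul, map_nsmul, nsmul_eq_mul, mul_comm]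

theorem commute_dxEnd_hderiv (d : Derivation 𝕜 A A) (ħ : 𝕜) (k : ℕ) :
    Commute (dxEnd d) (hderiv A ħ k) := by
  rw [hderiv_eq]
  exact (commute_hD_of_forall (commute_dxEnd_dt d) ħ k).smul_right _

theorem dt_iterate_eq {d : Derivation 𝕜 A A} {G : MvPowerSeries ℕ+ A}
    (h : dxEnd d G = dt 𝕜 A 1 G) (l : ℕ) : (dt 𝕜 A 1)^[l] G = (dxEnd d)^[l] G := by
  induction l with
  | zero => rfl
  | succ l ih =>
    rw [Function.iterate_succ_apply', ih, Function.iterate_succ_apply, h, ← Module.End.pow_apply,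
      ← Module.End.pow_apply, ← Module.End.mul_apply, ← Module.End.mul_apply,
      ((commute_dxEnd_dt d 1).symm.pow_right l).eq]

theorem dxEnd_hderiv {d : Derivation 𝕜 A A} {ħ : 𝕜} {F : MvPowerSeries ℕ+ A}
    (hF : ∃ φ : A, dx d (F - MvPowerSeries.C φ) = dt 𝕜 A 1 (F - MvPowerSeries.C φ)) (k : ℕ) :
    dxEnd d (hderiv A ħ k F) = dt 𝕜 A 1 (hderiv A ħ k F) := by
  obtain ⟨φ, hφ⟩ := hF
  have h1 : hderiv A ħ k F = hderiv A ħ k (F - MvPowerSeries.C φ) := by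
    rw [map_sub, hderiv_eq, LinearMap.smul_apply, LinearMap.smul_apply, hD_C, smul_zero, sub_zero]
  rw [h1, ← Module.End.mul_apply, ← Module.End.mul_apply, (commute_dxEnd_hderiv d ħ k).eq,
    (commute_dt_hderiv ħ 1 k).eq, Module.End.mul_apply, Module.End.mul_apply]
  exact congrArg _ hφ

theorem constantCoeff_colProd {d : Derivation 𝕜 A A} {ħ : 𝕜} {F : MvPowerSeries ℕ+ A}
    {f : ℕ → A}
    (hF : ∃ φ : A, dx d (F - MvPowerSeries.C φ) = dt 𝕜 A 1 (F - MvPowerSeries.C φ))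
    (hf : ∀ k, 1 ≤ k → MvPowerSeries.constantCoeff (hderiv A ħ k F) = f k)
    {B : List (ℕ × ℕ)} (hB : ∀ c ∈ B, 1 ≤ c.1) :
    MvPowerSeries.constantCoeff (colProd ħ F B) = (B.map fun c => d^[c.2] (f c.1)).prod := by
  rw [colProd, map_list_prod, List.map_map]
  congr 1
  refine List.map_congr_left fun c hc => ?_
  rw [Function.comp_apply, dt_iterate_eq (dxEnd_hderiv hF c.1), constantCoeff_dxEnd_iterate,
    hf c.1 (hB c hc)]

theorem sum_colLists {N : Type*} [AddCommMonoid N] (g : List (ℕ × ℕ) → N) {n r : ℕ} (hn : 1 ≤ n)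
    (hg : ∀ xy, g xy ≠ 0 → ∀ c ∈ xy, c.2 ≤ r) :
    ∑ m ∈ Finset.Icc 1 n,
      ∑ sl ∈ (Fintype.piFinset fun _ : Fin m => Finset.Icc 1 n ×ˢ Finset.Icc 1 r).filter
          (fun sl => ∑ a, ((sl a).1 + (sl a).2) = n), g (List.ofFn sl) =
      ∑ xy ∈ colLists n, g xy := by
  rw [Finset.sum_sigma']
  refine Finset.sum_of_injOn (fun x => List.ofFn x.2) ?_ ?_ ?_ ?_
  · rintro ⟨m, sl⟩ _ ⟨m', sl'⟩ _ h
    exact List.ofFn_inj'.1 h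
  · rintro ⟨m, sl⟩ h
    simp only [Finset.coe_sigma, Set.mem_sigma_iff, Finset.mem_coe, Finset.mem_filter,
      Fintype.mem_piFinset, Finset.mem_product, Finset.mem_Icc] at h
    rw [Finset.mem_coe, mem_colLists, List.forall_mem_ofFn_iff, List.map_ofFn, List.sum_ofFn]
    exact ⟨fun a => ⟨(h.2.1 a).1.1, (h.2.1 a).2.1⟩, h.2.2⟩
  · intro xy hxy hne
    by_contra h0
    refine hne ⟨⟨xy.length, xy.get⟩, ?_, List.ofFn_get xy⟩
    obtain ⟨h1, h2⟩ := mem_colLists.1 hxy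
    obtain ⟨h3, h4⟩ := mem_listsIn.1 (Finset.mem_filter.1 hxy).1
    simp only [Finset.coe_sigma, Set.mem_sigma_iff, Finset.mem_coe, Finset.mem_filter,
      Fintype.mem_piFinset, Finset.mem_product, Finset.mem_Icc] at h4 ⊢
    refine ⟨⟨?_, h3⟩, fun a => ⟨(h4 _ (xy.get_mem a)).1, (h1 _ (xy.get_mem a)).2,
      hg xy h0 _ (xy.get_mem a)⟩, ?_⟩
    · rw [Nat.one_le_iff_ne_zero, Ne, List.length_eq_zero_iff]
      rintro rfl
      simp at h2
      omega
    · rw [← h2, sum_map_eq_sum_get]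
  · intro x _
    rfl

theorem prod_hderiv_eq_opsD (ħ : 𝕜) (l : List ℕ) :
    (l.map (hderiv A ħ)).prod = (l.prod : 𝕜) • opsD A ħ l := by
  induction l with
  | nil => simp
  | cons k l ih =>
    rw [List.map_cons, List.prod_cons, ih, opsD_cons, hderiv_eq, List.prod_cons, Nat.cast_mul,
      smul_mul_smul_comm]

/-- On a solution with data `f`, the deformed derivatives at `t = 0` are the `f_λ^ħ`. -/
theorem smul_constantCoeff_opsD {d : Derivation 𝕜 A A} {ħ : 𝕜} {F : MvPowerSeries ℕ+ A}
    {f : ℕ → A} (hF : IsSolution d ħ F) (hf : HasCauchyLikeData ħ f F) {n : ℕ} (hn : 1 ≤ n)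
    (p : n.Partition) :
    (rho p : 𝕜) • MvPowerSeries.constantCoeff (opsD A ħ (rows p) F) = fLam d ħ f p := by
  have hlen : 1 ≤ len p := by
    rw [← length_rows, Nat.one_le_iff_ne_zero, Ne, List.length_eq_zero_iff]
    intro h
    have := sum_rows p
    rw [h] at this
    simp at this
    omega
  unfold fLam
  split_ifs with h1
  · rw [← length_rows, List.length_eq_one_iff] at h1
    obtain ⟨k, hk⟩ := h1
    have h2 := sum_rows p
    rw [hk, List.sum_singleton] at h2
    subst h2
    rw [← prod_rows, hk, List.prod_singleton, ← hf.2 k hn, hderiv_eq, opsD_cons, opsD_nil, mul_one,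
      LinearMap.smul_apply]
    rfl
  · have h2 : 2 ≤ (rows p).reverse.length := by
      rw [List.length_reverse, length_rows]
      omega
    have h3 := prod_hderiv_eq_sum_colProd ((fay_iff ħ F).1 hF.fay) h2
      (fun i hi => (rows_pos (List.mem_reverse.1 hi)).ne')
    rw [prod_hderiv_eq_opsD, opsD_perm ħ (List.reverse_perm _), List.prod_reverse, prod_rows,
      List.sum_reverse, sum_rows, LinearMap.smul_apply] at h3
    have h4 := congrArg MvPowerSeries.constantCoeff h3
    have hsm (c : 𝕜) (G : MvPowerSeries ℕ+ A) : MvPowerSeries.constantCoeff (c • G) =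
      c • MvPowerSeries.constantCoeff G := rfl
    rw [hsm, map_sum] at h4
    rw [h4, ← sum_colLists (r := len p - 1) _ hn]
    · refine Finset.sum_congr rfl fun m _ => Finset.sum_congr rfl fun sl hsl => ?_
      rw [hsm, constantCoeff_colProd hF.form hf.2, Phbar, List.map_ofFn, List.prod_ofFn]
      · rfl
      · rw [List.forall_mem_ofFn_iff]
        intro a
        have := Fintype.mem_piFinset.1 (Finset.mem_filter.1 hsl).1 a
        exact (Finset.mem_Icc.1 (Finset.mem_product.1 this).1).1
    · intro xy hxy
      rw [← length_rows, ← List.length_reverse]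
      refine le_of_PhbarRev_ne_zero (ħ := ħ) fun h0 => hxy ?_
      rw [h0, zero_smul, map_zero]

theorem isExpansion_of_isSolution {d : Derivation 𝕜 A A} {ħ : 𝕜} {F : MvPowerSeries ℕ+ A}
    {f : ℕ → A} (hF : IsSolution d ħ F) (hf : HasCauchyLikeData ħ f F) : IsExpansion d ħ f F :=
  isExpansion_of_opsD d ħ f F hf.1 fun _ hn p => smul_constantCoeff_opsD hF hf hn p

theorem IsExpansion.unique {d : Derivation 𝕜 A A} {ħ : 𝕜} {F G : MvPowerSeries ℕ+ A}
    {f : ℕ → A} (hF : IsExpansion d ħ f F) (hG : IsExpansion d ħ f G) : F = G :=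
  MvPowerSeries.ext fun α => (hF _ α le_rfl).trans (hG _ α le_rfl).symm

end Solution

/-! ### Derivations of the logarithm -/

section Log

variable {𝕜 : Type*} [RCLike 𝕜] {B : Type*} [CommRing B] [Algebra 𝕜 B] {τ : Type*}

/-- A derivation acting on the coefficients of a power series. -/
def coeffDeriv (τ : Type*) (δ : Derivation 𝕜 B B) :
    Derivation 𝕜 (MvPowerSeries τ B) (MvPowerSeries τ B) :=
  Derivation.mk'
    { toFun := fun G => fun e => δ (MvPowerSeries.coeff e G)
      map_add' := fun G H => MvPowerSeries.ext fun e => map_add δ _ _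
      map_smul' := fun c G => MvPowerSeries.ext fun e => δ.map_smul c _ }
    fun G H => MvPowerSeries.ext fun e => by
      classical
      change δ (MvPowerSeries.coeff e (G * H)) = _
      rw [smul_eq_mul, smul_eq_mul, map_add, mul_comm H, MvPowerSeries.coeff_mul,
        MvPowerSeries.coeff_mul, MvPowerSeries.coeff_mul, map_sum, ← Finset.sum_add_distrib]
      refine Finset.sum_congr rfl fun p _ => ?_
      rw [Derivation.leibniz, smul_eq_mul, smul_eq_mul, mul_comm (MvPowerSeries.coeff p.2 H)]
      rfl

theorem coeff_coeffDeriv (δ : Derivation 𝕜 B B) (G : MvPowerSeries τ B) (e : τ →₀ ℕ) :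
    MvPowerSeries.coeff e (coeffDeriv τ δ G) = δ (MvPowerSeries.coeff e G) := rfl

theorem coeffDeriv_X (δ : Derivation 𝕜 B B) (a : τ) :
    coeffDeriv τ δ (MvPowerSeries.X a) = 0 := by
  classical
  ext e
  rw [coeff_coeffDeriv, MvPowerSeries.coeff_X]
  split_ifs <;> simp

variable (𝕜 B) in
/-- The Euler derivation `u_a ∂/∂u_a`. -/
def eulerDeriv (a : τ) : Derivation 𝕜 (MvPowerSeries τ B) (MvPowerSeries τ B) :=
  Derivation.mk'
    { toFun := fun G => fun e => e a • MvPowerSeries.coeff e G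
      map_add' := fun G H => MvPowerSeries.ext fun e => smul_add _ _ _
      map_smul' := fun c G => MvPowerSeries.ext fun e => smul_comm _ _ _ }
    fun G H => MvPowerSeries.ext fun e => by
      classical
      change e a • MvPowerSeries.coeff e (G * H) = _
      rw [smul_eq_mul, smul_eq_mul, map_add, mul_comm H, MvPowerSeries.coeff_mul,
        MvPowerSeries.coeff_mul, MvPowerSeries.coeff_mul, Finset.smul_sum,
        ← Finset.sum_add_distrib]
      refine Finset.sum_congr rfl fun p hp => ?_
      change _ = MvPowerSeries.coeff p.1 G * (p.2 a • MvPowerSeries.coeff p.2 H) +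
        (p.1 a • MvPowerSeries.coeff p.1 G) * MvPowerSeries.coeff p.2 H
      rw [← mem_antidiagonal.1 hp, Finsupp.add_apply, add_smul, mul_smul_comm, smul_mul_assoc,
        add_comm]

theorem coeff_eulerDeriv (a : τ) (G : MvPowerSeries τ B) (e : τ →₀ ℕ) :
    MvPowerSeries.coeff e (eulerDeriv 𝕜 B a G) = e a • MvPowerSeries.coeff e G := rfl

/-- The logarithmic derivative: `(1 + Y) θ(log (1 + Y)) = θ(Y)` for a derivation `θ` that does not
lower the order of a series. -/
theorem one_add_mul_derivation_log
    (θ : Derivation 𝕜 (MvPowerSeries τ B) (MvPowerSeries τ B))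
    (hθ : ∀ G, G.order ≤ (θ G).order) {Y : MvPowerSeries τ B}
    (hY : MvPowerSeries.constantCoeff Y = 0) :
    (1 + Y) * θ ((PowerSeries.log 𝕜).subst Y) = θ Y := by
  rw [← sub_eq_zero]
  ext e
  set N := Finsupp.degree e with hN
  let c (m : ℕ) : 𝕜 := PowerSeries.coeff m (PowerSeries.log 𝕜)
  set H := (PowerSeries.log 𝕜).subst Y with hH
  let S := ∑ m ∈ range (N + 2), c m • Y ^ m
  have hpow (m : ℕ) : (m : ℕ∞) ≤ (Y ^ m).order :=
    MvPowerSeries.le_order_pow_of_constantCoeff_eq_zero m hY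
  have hHS : ((N + 1 : ℕ) : ℕ∞) ≤ (H - S).order := by
    refine MvPowerSeries.nat_le_order fun e' he' => ?_
    rw [map_sub, hH, PowerSeries.coeff_subst (PowerSeries.HasSubst.of_constantCoeff_zero hY),
      finsum_eq_sum_of_support_subset (s := range (N + 2)), map_sum, sub_eq_zero]
    · rfl
    · intro m hm
      by_contra h
      refine hm ?_
      simp only [Finset.coe_range, Set.mem_Iio, not_lt] at h
      simp only
      rw [MvPowerSeries.coeff_of_lt_order, smul_zero]
      exact lt_of_lt_of_le (by exact_mod_cast (by omega : Finsupp.degree e' < m)) (hpow m)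
  have hθS : (1 + Y) * θ S = θ Y - θ Y * (-Y) ^ (N + 1) := by
    have h1 : θ S = θ Y * ∑ m ∈ range (N + 1), (-Y) ^ m := by
      rw [map_sum, Finset.sum_range_succ', Finset.mul_sum]
      have hc0 : θ (c 0 • Y ^ 0) = 0 := by simp
      rw [hc0, add_zero]
      refine Finset.sum_congr rfl fun m _ => ?_
      rw [Derivation.map_smul, Derivation.leibniz_pow, Nat.add_sub_cancel, smul_eq_mul,
        ← Nat.cast_smul_eq_nsmul 𝕜, smul_smul]
      have hc : c (m + 1) * ((m + 1 : ℕ) : 𝕜) = (-1) ^ m := by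
        have : ((m + 1 : ℕ) : 𝕜) ≠ 0 := by exact_mod_cast m.succ_ne_zero
        simp only [c, PowerSeries.coeff_log]
        rw [if_neg m.succ_ne_zero]
        simp only [map_div₀, map_pow, map_neg, map_one]
        push_cast at this ⊢
        rw [pow_add, pow_add]
        field_simp
      rw [hc, neg_pow Y, Algebra.smul_def, map_pow, map_neg, map_one]
      ring
    have h2 := mul_neg_geom_sum (-Y) (N + 1)
    rw [sub_neg_eq_add] at h2
    rw [h1, mul_left_comm, h2, mul_sub, mul_one]
  have h3 : (1 + Y) * θ H - θ Y = (1 + Y) * θ (H - S) - θ Y * (-Y) ^ (N + 1) := by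
    rw [map_sub, mul_sub, hθS]
    ring
  have hlt : ((Finsupp.degree e : ℕ) : ℕ∞) < ((N + 1 : ℕ) : ℕ∞) := by
    exact_mod_cast Nat.lt_succ_self N
  rw [h3, map_sub, map_zero, MvPowerSeries.coeff_of_lt_order, MvPowerSeries.coeff_of_lt_order,
    sub_zero]
  · refine lt_of_lt_of_le hlt (le_trans ?_ MvPowerSeries.le_order_mul)
    refine le_trans ?_ (self_le_add_left _ _)
    exact MvPowerSeries.le_order_pow_of_constantCoeff_eq_zero _ (by simp [hY])
  · refine lt_of_lt_of_le hlt (le_trans ?_ MvPowerSeries.le_order_mul)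
    exact le_trans (hHS.trans (hθ _)) (self_le_add_left _ _)

theorem order_le_order_coeffDeriv (δ : Derivation 𝕜 B B) (G : MvPowerSeries τ B) :
    G.order ≤ (coeffDeriv τ δ G).order :=
  MvPowerSeries.le_order fun e he => by
    rw [coeff_coeffDeriv, MvPowerSeries.coeff_of_lt_order he, map_zero]

theorem order_le_order_eulerDeriv (a : τ) (G : MvPowerSeries τ B) :
    G.order ≤ (eulerDeriv 𝕜 B a G).order :=
  MvPowerSeries.le_order fun e he => by
    rw [coeff_eulerDeriv, MvPowerSeries.coeff_of_lt_order he, smul_zero]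

end Log

/-! ### Symmetry and lowest terms of the logarithm of the Fay identity -/

section Symmetry

theorem Ptilde_comm (i j : ℕ) (l : List ℕ) : Ptilde i j l = Ptilde j i l := by
  unfold Ptilde
  refine Finset.card_bij' (fun q _ k => (q k).swap) (fun q _ k => (q k).swap) ?_ ?_ ?_ ?_
  all_goals
    simp only [Finset.mem_filter, Fintype.mem_piFinset, mem_antidiagonal, Prod.swap_swap,
      implies_true, Prod.fst_swap, Prod.snd_swap]
  all_goals
    rintro q ⟨h1, h2, h3, h4⟩
    exact ⟨fun a => by rw [← h1 a, add_comm], fun k => (h2 k).symm, h4, h3⟩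

variable {𝕜 : Type*} [RCLike 𝕜] {B : Type*} [CommRing B] [Algebra 𝕜 B]

variable (𝕜) in
/-- The coefficient `H_{ij} / (ij)` of `u^i v^j` in `log (1 + Y)`, `1 + Y` being the right hand
side of the Fay identity with `∂_1 ∂_s^ħ F = g_s`. -/
def logCoeff (g : ℕ → B) (i j : ℕ) : B :=
  MvPowerSeries.coeff (exp2 i j) ((PowerSeries.log 𝕜).subst (faySeries 𝕜 g))

theorem logCoeff_comm (g : ℕ → B) (i j : ℕ) : logCoeff 𝕜 g i j = logCoeff 𝕜 g j i := by
  rw [logCoeff, logCoeff, coeff_log_faySeries, coeff_log_faySeries, add_comm]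
  exact Finset.sum_congr rfl fun l _ => by rw [Ptilde_comm]

theorem logCoeff_zero_right (g : ℕ → B) (i : ℕ) : logCoeff 𝕜 g i 0 = 0 :=
  coeff_log_faySeries_eq_zero g (Or.inr rfl)

theorem logCoeff_one_right (g : ℕ → B) (i : ℕ) : logCoeff 𝕜 g i 1 = (i : 𝕜)⁻¹ • g i := by
  classical
  rcases Nat.eq_zero_or_pos i with rfl | hi
  · simp [logCoeff, coeff_log_faySeries_eq_zero]
  have h := congrArg (MvPowerSeries.coeff (exp2 i 1)) (one_add_mul_derivation_log
    (eulerDeriv 𝕜 B (1 : Fin 2)) (order_le_order_eulerDeriv 1) (constantCoeff_faySeries (𝕜 := 𝕜) g))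
  rw [add_mul, one_mul, map_add, coeff_eulerDeriv, coeff_eulerDeriv, coeff_faySeries,
    MvPowerSeries.coeff_mul, Finset.sum_eq_zero, add_zero, exp2_one, exp2_zero, one_smul, one_smul,
    if_pos ⟨hi, le_rfl⟩, Nat.add_sub_cancel] at h
  · exact h
  · intro p hp
    have h1 := DFunLike.congr_fun (mem_antidiagonal.1 hp) 1
    rw [Finsupp.add_apply, exp2_one] at h1
    rw [coeff_faySeries, coeff_eulerDeriv]
    rcases Nat.eq_zero_or_pos (p.1 1) with h2 | h2
    · rw [if_neg (by omega), zero_mul]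
    · rw [show p.2 1 = 0 by omega, zero_smul, mul_zero]

end Symmetry

/-! ### The symmetry of the third derivatives -/

section ThreeVariables

variable {𝕜 : Type*} [RCLike 𝕜] {R : Type*} [CommRing R] [Algebra 𝕜 R]

theorem coeff_rename_pair {a b : Fin 3} (hab : a ≠ b) (G : MvPowerSeries (Fin 2) R)
    (e : Fin 3 →₀ ℕ) : MvPowerSeries.coeff e (MvPowerSeries.rename ![a, b] G) =
      if ∀ c, c ≠ a → c ≠ b → e c = 0 then MvPowerSeries.coeff (exp2 (e a) (e b)) G else 0 := by
  have hinj : Function.Injective ![a, b] := by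
    intro x y h
    fin_cases x <;> fin_cases y <;> simp_all
  let ι : Fin 2 ↪ Fin 3 := ⟨![a, b], hinj⟩
  split_ifs with h
  · have he : Finsupp.embDomain ι (exp2 (e a) (e b)) = e := by
      ext c
      by_cases hca : c = a
      · subst hca
        exact Finsupp.embDomain_apply_self ι _ 0
      by_cases hcb : c = b
      · subst hcb
        exact Finsupp.embDomain_apply_self ι _ 1
      rw [Finsupp.embDomain_of_notMem_range, h c hca hcb]
      rintro ⟨x, rfl⟩
      fin_cases x
      · exact hca rfl
      · exact hcb rfl
    conv_lhs => rw [← he]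
    exact MvPowerSeries.coeff_embDomain_rename ι G _
  · refine MvPowerSeries.coeff_rename_eq_zero _ _ ?_
    rintro ⟨x, rfl⟩
    refine h fun c hca hcb => ?_
    refine Finsupp.mapDomain_of_notMem_range _ _ ?_
    rintro ⟨y, rfl⟩
    fin_cases y
    · exact hca rfl
    · exact hcb rfl

/-- The series `Δ(z_0) G` for a power series `G` in `u_1, u_2`, where `Δ(z) = ∑_k D_k u^k`. -/
def deltaThree (D : ℕ → R →ₗ[𝕜] R) (G : MvPowerSeries (Fin 2) R) : MvPowerSeries (Fin 3) R :=
  fun e => D (e 0) (MvPowerSeries.coeff (exp2 (e 1) (e 2)) G)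

theorem coeff_deltaThree (D : ℕ → R →ₗ[𝕜] R) (G : MvPowerSeries (Fin 2) R) (e : Fin 3 →₀ ℕ) :
    MvPowerSeries.coeff e (deltaThree D G) = D (e 0) (MvPowerSeries.coeff (exp2 (e 1) (e 2)) G) :=
  rfl

theorem finSuccEquiv_deltaThree (D : ℕ → R →ₗ[𝕜] R) (G : MvPowerSeries (Fin 2) R) (k : ℕ)
    (e : Fin 2 →₀ ℕ) : MvPowerSeries.coeff e (PowerSeries.coeff k
      (MvPowerSeries.finSuccEquiv R 2 (deltaThree D G))) = D k (MvPowerSeries.coeff e G) := by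
  rw [MvPowerSeries.coeff_coeff_finSuccEquiv, coeff_deltaThree]
  congr 2
  rw [← exp2_eta e]
  rfl

theorem finSuccEquiv_rename (G : MvPowerSeries (Fin 2) R) :
    MvPowerSeries.finSuccEquiv R 2 (MvPowerSeries.rename ![1, 2] G) = PowerSeries.C G := by
  ext k e
  rw [MvPowerSeries.coeff_coeff_finSuccEquiv, coeff_rename_pair (by decide), PowerSeries.coeff_C]
  have h : (∀ c : Fin 3, c ≠ 1 → c ≠ 2 → Finsupp.cons k e c = 0) ↔ k = 0 := by
    constructor
    · intro h
      exact h 0 (by decide) (by decide)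
    · rintro rfl c h1 h2
      obtain rfl : c = 0 := by omega
      rfl
  rw [if_congr h rfl rfl]
  split_ifs
  · congr 1
    rw [← exp2_eta e]
    rfl
  · rfl

theorem deltaThree_mul (ħ : 𝕜) {D : ℕ → R →ₗ[𝕜] R}
    (hmul : ∀ k a b, D k (a * b) = D k a * b + a * D k b +
      ħ • ∑ p ∈ antidiagonal k, D p.1 a * D p.2 b) (G H : MvPowerSeries (Fin 2) R) :
    deltaThree D (G * H) = deltaThree D G * MvPowerSeries.rename ![1, 2] H +
      MvPowerSeries.rename ![1, 2] G * deltaThree D H +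
        ħ • (deltaThree D G * deltaThree D H) := by
  classical
  apply (MvPowerSeries.finSuccEquiv R 2).injective
  have hsm (X : MvPowerSeries (Fin 3) R) : ħ • X = algebraMap 𝕜 R ħ • X :=
    (algebraMap_smul R ħ X).symm
  rw [hsm, map_add, map_add, map_mul, map_mul, map_smul, map_mul, finSuccEquiv_rename,
    finSuccEquiv_rename]
  ext k e
  simp only [map_add, PowerSeries.coeff_mul_C, PowerSeries.coeff_C_mul, PowerSeries.coeff_smul,
    finSuccEquiv_deltaThree]
  rw [MvPowerSeries.coeff_mul, MvPowerSeries.coeff_mul, MvPowerSeries.coeff_mul,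
    MvPowerSeries.coeff_smul, PowerSeries.coeff_mul, map_sum, map_sum]
  simp only [MvPowerSeries.coeff_mul, finSuccEquiv_deltaThree, hmul, Finset.sum_add_distrib]
  congr 1
  rw [← Finset.smul_sum, Finset.sum_comm, Algebra.smul_def]

/-- The power series in the single variable `u_a` with coefficients `g_s / s`. -/
def singleSeries (𝕜 : Type*) [RCLike 𝕜] [Algebra 𝕜 R] (g : ℕ → R) (a : Fin 3) :
    MvPowerSeries (Fin 3) R :=
  fun e => if ∀ c, c ≠ a → e c = 0 then (e a : 𝕜)⁻¹ • g (e a) else 0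

theorem coeffDeriv_rename (δ : Derivation 𝕜 R R) {a b : Fin 3} (hab : a ≠ b)
    (G : MvPowerSeries (Fin 2) R) : coeffDeriv _ δ (MvPowerSeries.rename ![a, b] G) =
      MvPowerSeries.rename ![a, b] (coeffDeriv _ δ G) := by
  ext e
  rw [coeff_coeffDeriv, coeff_rename_pair hab, coeff_rename_pair hab]
  split_ifs
  · rfl
  · exact map_zero δ

theorem rename_rename_pair (σ : Equiv.Perm (Fin 3)) (a b : Fin 3) (G : MvPowerSeries (Fin 2) R) :
    MvPowerSeries.rename σ (MvPowerSeries.rename ![a, b] G) =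
      MvPowerSeries.rename ![σ a, σ b] G := by
  rw [MvPowerSeries.rename_rename]
  congr 2
  funext x
  fin_cases x <;> rfl

theorem coeff_rename_perm (σ : Equiv.Perm (Fin 3)) (G : MvPowerSeries (Fin 3) R)
    (e : Fin 3 →₀ ℕ) : MvPowerSeries.coeff e (MvPowerSeries.rename σ G) =
      MvPowerSeries.coeff (e.equivMapDomain σ.symm) G := by
  have h : Finsupp.embDomain σ.toEmbedding (e.equivMapDomain σ.symm) = e := by
    rw [Finsupp.embDomain_eq_mapDomain, Equiv.coe_toEmbedding, ← Finsupp.equivMapDomain_eq_mapDomain,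
      ← Finsupp.equivMapDomain_trans, Equiv.symm_trans_self, Finsupp.equivMapDomain_refl]
  conv_lhs => rw [← h]
  exact MvPowerSeries.coeff_embDomain_rename σ.toEmbedding G _

/-- The identity behind the symmetry: a derivation that sends `w, e` to `dw, de` sends
`log (1 + h w / e) / h` to the `t` with `(e + h w) e t = e dw - w de`, so `t` depends only on the
ratio `w / e`. -/
theorem mul_eq_of_log_derivation {S : Type*} [CommRing S] [IsDomain S] {h : S}
    {e e' w w' de de' dw dw' t t' : S} (he : e ≠ 0) (he' : e' ≠ 0) (hew : e + h * w ≠ 0)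
    (hw : w' * e = w * e') (hdw : dw' * e + w' * de = dw * e' + w * de')
    (h1 : t * (e * (e + h * w)) = e * dw - w * de)
    (h2 : t' * (e' * (e' + h * w')) = e' * dw' - w' * de') : t = t' := by
  have key : (e * e' * e' * (e + h * w)) * (t - t') = 0 := by
    have h3 : e' * e' * (e * dw - w * de) = e * e * (e' * dw' - w' * de') := by
      linear_combination (-(e * e')) * hdw + (e' * de + e * de') * hw
    linear_combination (e' * e') * h1 - (e * e) * h2 + h3 + (t' * e * e' * h) * hw
  rcases mul_eq_zero.1 key with h4 | h4
  · exact absurd h4 (mul_ne_zero (mul_ne_zero (mul_ne_zero he he') he') hew)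
  · exact sub_eq_zero.1 h4

end ThreeVariables

section ThirdDerivatives

variable {𝕜 : Type*} [RCLike 𝕜] {R : Type*} [CommRing R] [Algebra 𝕜 R]

theorem deltaThree_add (D : ℕ → R →ₗ[𝕜] R) (G H : MvPowerSeries (Fin 2) R) :
    deltaThree D (G + H) = deltaThree D G + deltaThree D H :=
  MvPowerSeries.ext fun e => map_add (D (e 0)) _ _

theorem deltaThree_sub (D : ℕ → R →ₗ[𝕜] R) (G H : MvPowerSeries (Fin 2) R) :
    deltaThree D (G - H) = deltaThree D G - deltaThree D H :=
  MvPowerSeries.ext fun e => map_sub (D (e 0)) _ _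

theorem deltaThree_X {D : ℕ → R →ₗ[𝕜] R} (h1 : ∀ k, D k 1 = 0) (a : Fin 2) :
    deltaThree D (MvPowerSeries.X a) = 0 := by
  ext e
  rw [coeff_deltaThree, MvPowerSeries.coeff_X]
  split_ifs
  · rw [h1, map_zero]
  · rw [map_zero, map_zero]

theorem deltaThree_eulerDeriv (D : ℕ → R →ₗ[𝕜] R) (G : MvPowerSeries (Fin 2) R) :
    deltaThree D (eulerDeriv 𝕜 R 1 G) = eulerDeriv 𝕜 R 2 (deltaThree D G) :=
  MvPowerSeries.ext fun e => map_nsmul (D (e 0)) _ _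

theorem rename_eulerDeriv (G : MvPowerSeries (Fin 2) R) :
    MvPowerSeries.rename ![1, 2] (eulerDeriv 𝕜 R 1 G) =
      eulerDeriv 𝕜 R (2 : Fin 3) (MvPowerSeries.rename ![1, 2] G) := by
  ext e
  rw [coeff_eulerDeriv, coeff_rename_pair (by decide), coeff_rename_pair (by decide)]
  split_ifs
  · rfl
  · rw [smul_zero]

theorem rename_swap_eulerDeriv (G : MvPowerSeries (Fin 3) R) :
    MvPowerSeries.rename (Equiv.swap (0 : Fin 3) 1) (eulerDeriv 𝕜 R 2 G) =
      eulerDeriv 𝕜 R 2 (MvPowerSeries.rename (Equiv.swap (0 : Fin 3) 1) G) := by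
  ext e
  rw [coeff_eulerDeriv, coeff_rename_perm, coeff_rename_perm, coeff_eulerDeriv]
  rfl

theorem rename_singleSeries_left {g : ℕ → R} {a b : Fin 3} (hab : a ≠ b)
    {G : MvPowerSeries (Fin 2) R}
    (hG : ∀ i j, MvPowerSeries.coeff (exp2 i j) G = if j = 0 then (i : 𝕜)⁻¹ • g i else 0) :
    MvPowerSeries.rename ![a, b] G = singleSeries 𝕜 g a := by
  ext e
  rw [coeff_rename_pair hab, hG, ← ite_and]
  refine if_congr ⟨fun h c hc => ?_, fun h => ⟨fun c hc _ => h c hc, h b hab.symm⟩⟩ rfl rfl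
  rcases eq_or_ne c b with rfl | hcb
  · exact h.2
  · exact h.1 c hc hcb

theorem rename_singleSeries_right {g : ℕ → R} {a b : Fin 3} (hab : a ≠ b)
    {G : MvPowerSeries (Fin 2) R}
    (hG : ∀ i j, MvPowerSeries.coeff (exp2 i j) G = if i = 0 then (j : 𝕜)⁻¹ • g j else 0) :
    MvPowerSeries.rename ![a, b] G = singleSeries 𝕜 g b := by
  ext e
  rw [coeff_rename_pair hab, hG, ← ite_and]
  refine if_congr ⟨fun h c hc => ?_, fun h => ⟨fun c _ hc => h c hc, h a hab⟩⟩ rfl rfl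
  rcases eq_or_ne c a with rfl | hca
  · exact h.2
  · exact h.1 c hca hc

/-- Let `D_k` be commuting with `∂` and satisfy the quasi-Leibniz rule, and let
`D_i f_j = j H_{ij}` with `∑ H_{ij} u^i v^j` the logarithm of the right hand side of the Fay identity
for `g_s = ∂ f_s`. Then `D_a H_{bc}` is symmetric in `a` and `b`.

With `q_{ab} = (u_a - u_b) e^{H_{ab}} = u_a - u_b + u_a u_b (s_a - s_b)` and
`Δ_0 e^{H_{12}} = X e^{H_{12}}`, the series `X` equals
`u_1 u_2 (∂q_{01} / q_{01} - ∂q_{02} / q_{02}) / q_{12}`, which is symmetric in the three variables,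
and `X = (e^{ħ T} - 1) / ħ` for `T = Δ_0 H_{12}`. The last relation is used in the form
`(1 + ħ X) θ(T) = θ(X)` with the Euler derivation `θ` in `u_2`, so that `ħ = 0` is allowed. -/
theorem apply_logCoeff_comm [IsDomain R] (ħ : 𝕜) (δ : Derivation 𝕜 R R) {D : ℕ → R →ₗ[𝕜] R}
    (h0 : D 0 = 0) (h1 : ∀ k, D k 1 = 0)
    (hmul : ∀ k a b, D k (a * b) = D k a * b + a * D k b +
      ħ • ∑ p ∈ antidiagonal k, D p.1 a * D p.2 b)
    (hδ : ∀ k a, D k (δ a) = δ (D k a)) {f : ℕ → R}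
    (hf : ∀ i j, D i (f j) = (j : 𝕜) • logCoeff 𝕜 (fun s => δ (f s)) i j)
    (a b : ℕ) {c : ℕ} (hc : c ≠ 0) :
    D a (logCoeff 𝕜 (fun s => δ (f s)) b c) = D b (logCoeff 𝕜 (fun s => δ (f s)) a c) := by
  classical
  have : IsDomain (MvPowerSeries (Fin 3) R) := NoZeroDivisors.to_isDomain _
  set g : ℕ → R := fun s => δ (f s) with hg
  set Y := faySeries 𝕜 g with hY
  set H := (PowerSeries.log 𝕜).subst Y with hH
  have hY0 : MvPowerSeries.constantCoeff Y = 0 := constantCoeff_faySeries g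
  -- the one-variable series on the right hand side of the Fay identity
  let s2 : Fin 2 → MvPowerSeries (Fin 2) R := fun x e =>
    if x = 0 then (if e 1 = 0 then (e 0 : 𝕜)⁻¹ • g (e 0) else 0)
    else (if e 0 = 0 then (e 1 : 𝕜)⁻¹ • g (e 1) else 0)
  have hs0 (i j : ℕ) : MvPowerSeries.coeff (exp2 i j) (s2 0) =
      if j = 0 then (i : 𝕜)⁻¹ • g i else 0 := rfl
  have hs1 (i j : ℕ) : MvPowerSeries.coeff (exp2 i j) (s2 1) =
      if i = 0 then (j : 𝕜)⁻¹ • g j else 0 := rfl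
  have hfay := X_sub_X_mul_faySeries (𝕜 := 𝕜) g s2 hs0 hs1
  have hq : (MvPowerSeries.X 0 - MvPowerSeries.X 1) * (1 + Y) = MvPowerSeries.X 0 -
      MvPowerSeries.X 1 + MvPowerSeries.X 0 * MvPowerSeries.X 1 * (s2 0 - s2 1) := by
    rw [mul_add, mul_one, hfay]
  let x : Fin 3 → MvPowerSeries (Fin 3) R := MvPowerSeries.X
  let s := singleSeries (R := R) 𝕜 g
  let s' (a : Fin 3) := coeffDeriv _ δ (s a)
  let K := coeffDeriv _ δ H
  have hqr {a b : Fin 3} (hab : a ≠ b) : (x a - x b) * MvPowerSeries.rename ![a, b] (1 + Y) =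
      x a - x b + x a * x b * (s a - s b) := by
    have := congrArg (MvPowerSeries.rename (R := R) ![a, b]) hq
    simp only [map_mul, map_sub, map_add, MvPowerSeries.rename_X,
      rename_singleSeries_left hab hs0, rename_singleSeries_right hab hs1] at this
    simpa using this
  have hKr {a b : Fin 3} (hab : a ≠ b) : MvPowerSeries.rename ![a, b] K *
      (x a - x b + x a * x b * (s a - s b)) = x a * x b * (s' a - s' b) := by
    have h2 := congrArg (MvPowerSeries.rename (R := R) ![a, b])
      (one_add_mul_derivation_log (coeffDeriv _ δ) (order_le_order_coeffDeriv δ) hY0)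
    have h3 : coeffDeriv _ δ Y = coeffDeriv _ δ (1 + Y) := by
      rw [map_add, Derivation.map_one_eq_zero, zero_add]
    rw [map_mul, h3, ← coeffDeriv_rename δ hab (1 + Y)] at h2
    have h5 := hqr hab
    change _ * MvPowerSeries.rename ![a, b] K = _ at h2
    rw [← h5]
    generalize MvPowerSeries.rename ![a, b] (1 + Y) = E at h2 h5
    have h4 := congrArg (coeffDeriv _ δ) h5
    simp only [Derivation.leibniz, map_add, map_sub, smul_eq_mul, x, coeffDeriv_X, sub_zero,
      mul_zero, add_zero, zero_add] at h4
    linear_combination (x a - x b) * h2 + h4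
  -- the action of `Δ`
  let W := deltaThree D (1 + Y)
  have hmul' (G H) := deltaThree_mul ħ hmul G H
  have hd0 : deltaThree D (s2 0) = MvPowerSeries.rename ![0, 1] K := by
    ext e
    rw [coeff_deltaThree, hs0, coeff_rename_pair (by decide)]
    have h2 : (∀ c : Fin 3, c ≠ 0 → c ≠ 1 → e c = 0) ↔ e 2 = 0 :=
      ⟨fun h => h 2 (by decide) (by decide), fun h c h1 h2 => by
        obtain rfl : c = 2 := by omega
        exact h⟩
    rw [if_congr h2 rfl rfl]
    split_ifs
    · rw [map_smul, hδ, hf, Derivation.map_smul, smul_smul]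
      rcases eq_or_ne (e 1) 0 with h3 | h3
      · rw [h3, coeff_coeffDeriv]
        change _ = δ (logCoeff 𝕜 g _ 0)
        rw [logCoeff_zero_right]
        simp
      · rw [inv_mul_cancel₀ (by exact_mod_cast h3), one_smul]
        rfl
    · rw [map_zero]
  have hd1 : deltaThree D (s2 1) = MvPowerSeries.rename ![0, 2] K := by
    ext e
    rw [coeff_deltaThree, hs1, coeff_rename_pair (by decide)]
    have h2 : (∀ c : Fin 3, c ≠ 0 → c ≠ 2 → e c = 0) ↔ e 1 = 0 :=
      ⟨fun h => h 1 (by decide) (by decide), fun h c h1 h2 => by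
        obtain rfl : c = 1 := by omega
        exact h⟩
    rw [if_congr h2 rfl rfl]
    split_ifs
    · rw [map_smul, hδ, hf, Derivation.map_smul, smul_smul]
      rcases eq_or_ne (e 2) 0 with h3 | h3
      · rw [h3, coeff_coeffDeriv]
        change _ = δ (logCoeff 𝕜 g _ 0)
        rw [logCoeff_zero_right]
        simp
      · rw [inv_mul_cancel₀ (by exact_mod_cast h3), one_smul]
        rfl
    · rw [map_zero]
  have hW : (x 1 - x 2) * W = x 1 * x 2 *
      (MvPowerSeries.rename ![0, 1] K - MvPowerSeries.rename ![0, 2] K) := by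
    have h2 := congrArg (deltaThree D) hq
    have h3 : deltaThree D (MvPowerSeries.X 0 - MvPowerSeries.X 1) = 0 := by
      rw [deltaThree_sub, deltaThree_X h1, deltaThree_X h1, sub_zero]
    have h4 : deltaThree D (MvPowerSeries.X 0 * MvPowerSeries.X 1) = 0 := by
      rw [hmul', deltaThree_X h1, deltaThree_X h1]
      simp
    rw [hmul', deltaThree_add D (MvPowerSeries.X 0 - MvPowerSeries.X 1), h3, hmul', h4, deltaThree_sub, hd0, hd1] at h2
    simpa using h2
  let τ := MvPowerSeries.rename (R := R) (Equiv.swap (0 : Fin 3) 1)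
  have hτ (a b : Fin 3) (G : MvPowerSeries (Fin 2) R) : τ (MvPowerSeries.rename ![a, b] G) =
      MvPowerSeries.rename ![Equiv.swap 0 1 a, Equiv.swap 0 1 b] G := rename_rename_pair _ a b G
  have hτW : (x 0 - x 2) * τ W = x 0 * x 2 *
      (MvPowerSeries.rename ![1, 0] K - MvPowerSeries.rename ![1, 2] K) := by
    have h2 := congrArg τ hW
    simp only [map_mul, map_sub, hτ] at h2
    simpa [τ, x, MvPowerSeries.rename_X, Equiv.swap_apply_of_ne_of_ne] using h2
  let T := deltaThree D H
  let e : MvPowerSeries (Fin 3) R := MvPowerSeries.rename ![1, 2] (1 + Y)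
  have hτe : τ e = MvPowerSeries.rename ![0, 2] (1 + Y) := by
    rw [hτ]
    simp [Equiv.swap_apply_of_ne_of_ne]
  have hX {a b : Fin 3} (hab : a ≠ b) : x a - x b ≠ 0 := by
    rw [sub_ne_zero]
    intro h
    have h2 := congrArg (MvPowerSeries.coeff (Finsupp.single a 1)) h
    rw [MvPowerSeries.coeff_X, MvPowerSeries.coeff_X, if_pos rfl, if_neg] at h2
    · exact one_ne_zero h2
    · intro h3
      exact hab ((Finsupp.single_left_inj one_ne_zero).1 h3)
  have he1 (a b : Fin 3) :
      MvPowerSeries.constantCoeff (MvPowerSeries.rename ![a, b] (1 + Y)) = 1 := by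
    rw [MvPowerSeries.constantCoeff_rename, map_add, map_one, hY0, add_zero]
  have hne {G : MvPowerSeries (Fin 3) R} (h : MvPowerSeries.constantCoeff G = 1) : G ≠ 0 := by
    rintro rfl
    simp at h
  have hq01 : x 0 - x 1 + x 0 * x 1 * (s 0 - s 1) ≠ 0 := by
    rw [← hqr (by decide)]
    exact mul_ne_zero (hX (by decide)) (hne (he1 0 1))
  have hratio : τ W * e = W * τ e := by
    have hB01 := hKr (a := 0) (b := 1) (by decide)
    have hB10 := hKr (a := 1) (b := 0) (by decide)
    have hB12 := hKr (a := 1) (b := 2) (by decide)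
    have hB02 := hKr (a := 0) (b := 2) (by decide)
    have hA2 := hqr (a := 1) (b := 2) (by decide)
    have hA4 := hqr (a := 0) (b := 2) (by decide)
    have key : ((x 0 - x 2) * (x 1 - x 2) * (x 0 - x 1 + x 0 * x 1 * (s 0 - s 1))) *
        (τ W * e - W * τ e) = 0 := by
      rw [hτe]
      linear_combination ((x 1 - x 2) * e * (x 0 - x 1 + x 0 * x 1 * (s 0 - s 1))) * hτW +
        (x 0 * x 2 * (MvPowerSeries.rename ![1, 0] K - MvPowerSeries.rename ![1, 2] K) *
          (x 0 - x 1 + x 0 * x 1 * (s 0 - s 1))) * hA2 -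
        ((x 0 - x 2) * MvPowerSeries.rename ![0, 2] (1 + Y) *
          (x 0 - x 1 + x 0 * x 1 * (s 0 - s 1))) * hW -
        (x 1 * x 2 * (MvPowerSeries.rename ![0, 1] K - MvPowerSeries.rename ![0, 2] K) *
          (x 0 - x 1 + x 0 * x 1 * (s 0 - s 1))) * hA4 -
        (x 0 * x 2 * (x 1 - x 2 + x 1 * x 2 * (s 1 - s 2))) * hB10 -
        (x 0 * x 2 * (x 0 - x 1 + x 0 * x 1 * (s 0 - s 1))) * hB12 -
        (x 1 * x 2 * (x 0 - x 2 + x 0 * x 2 * (s 0 - s 2))) * hB01 +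
        (x 1 * x 2 * (x 0 - x 1 + x 0 * x 1 * (s 0 - s 1))) * hB02
    rcases mul_eq_zero.1 key with h2 | h2
    · exact absurd h2 (mul_ne_zero (mul_ne_zero (hX (by decide)) (hX (by decide))) hq01)
    · exact sub_eq_zero.1 h2
  let θ := eulerDeriv 𝕜 R (2 : Fin 3)
  let h : MvPowerSeries (Fin 3) R := MvPowerSeries.C (algebraMap 𝕜 R ħ)
  have hh (G : MvPowerSeries (Fin 3) R) : ħ • G = h * G := by
    rw [← MvPowerSeries.smul_eq_C_mul, algebraMap_smul]
  have hτθ (G : MvPowerSeries (Fin 3) R) : τ (θ G) = θ (τ G) := rename_swap_eulerDeriv G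
  have hT1 : θ T * (e * (e + h * W)) = e * θ W - W * θ e := by
    have h2 := one_add_mul_derivation_log (eulerDeriv 𝕜 R (1 : Fin 2))
      (order_le_order_eulerDeriv 1) hY0
    have h3 : eulerDeriv 𝕜 R (1 : Fin 2) Y = eulerDeriv 𝕜 R (1 : Fin 2) (1 + Y) := by
      rw [map_add, Derivation.map_one_eq_zero, zero_add]
    rw [h3] at h2
    have h4 := congrArg (MvPowerSeries.rename (R := R) ![(1 : Fin 3), 2]) h2
    have h5 := congrArg (deltaThree D) h2
    rw [map_mul, rename_eulerDeriv, rename_eulerDeriv] at h4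
    rw [hmul', rename_eulerDeriv, deltaThree_eulerDeriv, deltaThree_eulerDeriv, hh] at h5
    change e * _ = θ e at h4
    change W * _ + e * θ T + h * (W * θ T) = θ W at h5
    linear_combination e * h5 - W * h4
  have hT2 : θ (τ T) * (τ e * (τ e + h * τ W)) = τ e * θ (τ W) - τ W * θ (τ e) := by
    have h2 := congrArg τ hT1
    simp only [map_mul, map_sub, map_add, hτθ] at h2
    have h3 : τ h = h := MvPowerSeries.rename_C _ _
    rwa [h3] at h2
  have hdw : θ (τ W) * e + τ W * θ e = θ W * τ e + W * θ (τ e) := by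
    have h2 := congrArg θ hratio
    simp only [Derivation.leibniz, smul_eq_mul] at h2
    linear_combination h2
  have hW0 : MvPowerSeries.constantCoeff W = 0 := by
    rw [← MvPowerSeries.coeff_zero_eq_constantCoeff_apply, coeff_deltaThree]
    simp [h0]
  have hfin : θ T = θ (τ T) := by
    refine mul_eq_of_log_derivation (hne (he1 1 2)) ?_ ?_ hratio hdw hT1 hT2
    · rw [hτe]
      exact hne (he1 0 2)
    · refine hne ?_
      rw [map_add, map_mul, hW0, mul_zero, add_zero]
      exact he1 1 2
  have h2 := congrArg (MvPowerSeries.coeff (Finsupp.cons a (exp2 b c))) hfin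
  rw [coeff_eulerDeriv, coeff_eulerDeriv, coeff_rename_perm] at h2
  change c • D a (logCoeff 𝕜 g b c) = c • D b (logCoeff 𝕜 g a c) at h2
  rw [← Nat.cast_smul_eq_nsmul 𝕜, ← Nat.cast_smul_eq_nsmul 𝕜] at h2
  exact smul_right_injective _ (r := (c : 𝕜)) (by exact_mod_cast hc) h2

end ThirdDerivatives

/-! ### The universal solution -/

section Universal

variable (𝕜 : Type*) [RCLike 𝕜]

/-- The polynomial ring in which the universal solution lives: the variable `(0, l)` stands for
`∂^l F`, and the variable `(n + 1, l)` for `∂^l ∂_{n+2}^ħ F`. -/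
abbrev UnivRing : Type _ := MvPolynomial (ℕ × ℕ) 𝕜

/-- The derivation `∂` of the universal ring. -/
def univDeriv : Derivation 𝕜 (UnivRing 𝕜) (UnivRing 𝕜) :=
  MvPolynomial.mkDerivation 𝕜 fun v => MvPolynomial.X (v.1, v.2 + 1)

/-- The elements `∂_k^ħ F` of the universal ring, with `∂_1^ħ F = ∂ F`. -/
def univData : ℕ → UnivRing 𝕜
  | 0 => 0
  | 1 => MvPolynomial.X (0, 1)
  | n + 2 => MvPolynomial.X (n + 1, 0)

/-- The coefficients of the logarithm of the Fay identity in the universal ring. -/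
def univLog (i j : ℕ) : UnivRing 𝕜 := logCoeff 𝕜 (fun s => univDeriv 𝕜 (univData 𝕜 s)) i j

/-- The value of `D_j` on the variable `(n, 0)`. -/
def univBase (j : ℕ) : ℕ → UnivRing 𝕜
  | 0 => (j : 𝕜)⁻¹ • univData 𝕜 j
  | n + 1 => ((n + 2 : ℕ) : 𝕜) • univLog 𝕜 j (n + 2)

/-- The homomorphism `G ↦ G + w ∑_j (D_j G) u^j` to power series over the universal ring with
`w² = ħ w` adjoined. That it is multiplicative is the quasi-Leibniz rule for the `D_j`. -/
def univHom (ħ : 𝕜) : UnivRing 𝕜 →ₐ[𝕜]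
    QuadraticAlgebra (PowerSeries (UnivRing 𝕜)) 0 (algebraMap 𝕜 _ ħ) :=
  MvPolynomial.aeval fun v => ⟨PowerSeries.C (MvPolynomial.X v),
    PowerSeries.mk fun j => (univDeriv 𝕜)^[v.2] (univBase 𝕜 j v.1)⟩

/-- The operators `D_j` on the universal ring. -/
def univD (ħ : 𝕜) (j : ℕ) : UnivRing 𝕜 →ₗ[𝕜] UnivRing 𝕜 where
  toFun G := PowerSeries.coeff j (univHom 𝕜 ħ G).im
  map_add' G H := by rw [map_add]; rfl
  map_smul' c G := by rw [map_smul]; rfl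

variable {𝕜} (ħ : 𝕜)

theorem univDeriv_X (v : ℕ × ℕ) :
    univDeriv 𝕜 (MvPolynomial.X v) = MvPolynomial.X (v.1, v.2 + 1) :=
  MvPolynomial.mkDerivation_X _ _ _

theorem univHom_re (G : UnivRing 𝕜) : (univHom 𝕜 ħ G).re = PowerSeries.C G := by
  induction G using MvPolynomial.induction_on with
  | C c =>
    rw [← MvPolynomial.algebraMap_eq, AlgHom.commutes]
    change algebraMap 𝕜 (PowerSeries (UnivRing 𝕜)) c = _
    rw [PowerSeries.algebraMap_apply]
  | add p q hp hq => rw [map_add, QuadraticAlgebra.re_add, hp, hq, map_add]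
  | mul_X p v hp =>
    rw [map_mul, QuadraticAlgebra.re_mul, hp, map_mul, univHom, MvPolynomial.aeval_X, zero_mul,
      zero_mul, add_zero]

theorem univD_C (j : ℕ) (c : 𝕜) : univD 𝕜 ħ j (MvPolynomial.C c) = 0 := by
  change PowerSeries.coeff j (univHom 𝕜 ħ (MvPolynomial.C c)).im = 0
  rw [← MvPolynomial.algebraMap_eq, AlgHom.commutes]
  rfl

theorem univD_one (j : ℕ) : univD 𝕜 ħ j 1 = 0 := univD_C ħ j 1

theorem univD_X (j : ℕ) (v : ℕ × ℕ) :
    univD 𝕜 ħ j (MvPolynomial.X v) = (univDeriv 𝕜)^[v.2] (univBase 𝕜 j v.1) := by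
  change PowerSeries.coeff j (univHom 𝕜 ħ (MvPolynomial.X v)).im = _
  rw [univHom, MvPolynomial.aeval_X, PowerSeries.coeff_mk]

theorem univD_mul (k : ℕ) (a b : UnivRing 𝕜) :
    univD 𝕜 ħ k (a * b) = univD 𝕜 ħ k a * b + a * univD 𝕜 ħ k b +
      ħ • ∑ p ∈ antidiagonal k, univD 𝕜 ħ p.1 a * univD 𝕜 ħ p.2 b := by
  change PowerSeries.coeff k (univHom 𝕜 ħ (a * b)).im = _
  rw [map_mul, QuadraticAlgebra.im_mul, univHom_re, univHom_re, mul_assoc (algebraMap 𝕜 _ ħ),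
    ← Algebra.smul_def, map_add, map_add, PowerSeries.coeff_C_mul, PowerSeries.coeff_mul_C,
    PowerSeries.coeff_smul, PowerSeries.coeff_mul, add_comm (a * _)]
  rfl

theorem univD_univDeriv (k : ℕ) (a : UnivRing 𝕜) :
    univD 𝕜 ħ k (univDeriv 𝕜 a) = univDeriv 𝕜 (univD 𝕜 ħ k a) := by
  induction a using MvPolynomial.induction_on generalizing k with
  | C c => rw [univD_C ħ k c, MvPolynomial.derivation_C, map_zero, map_zero]
  | add p q hp hq => simp only [map_add, hp, hq]
  | mul_X p v hp =>
    have hv (k : ℕ) : univD 𝕜 ħ k (univDeriv 𝕜 (MvPolynomial.X v)) =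
        univDeriv 𝕜 (univD 𝕜 ħ k (MvPolynomial.X v)) := by
      rw [univDeriv_X, univD_X, univD_X, Function.iterate_succ_apply']
    simp only [Derivation.leibniz, smul_eq_mul, map_add, univD_mul, hp, hv, Derivation.map_smul,
      map_sum, Finset.sum_add_distrib, smul_add]
    have hswap : ∑ q ∈ antidiagonal k, univD 𝕜 ħ q.1 (MvPolynomial.X v) *
        univDeriv 𝕜 (univD 𝕜 ħ q.2 p) = ∑ q ∈ antidiagonal k,
          univD 𝕜 ħ q.2 (MvPolynomial.X v) * univDeriv 𝕜 (univD 𝕜 ħ q.1 p) :=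
      Finset.Nat.sum_antidiagonal_swap (f := fun q => univD 𝕜 ħ q.2 (MvPolynomial.X v) *
        univDeriv 𝕜 (univD 𝕜 ħ q.1 p))
    rw [hswap]
    ring

theorem univD_zero : univD 𝕜 ħ 0 = 0 := by
  refine LinearMap.ext fun a => ?_
  rw [LinearMap.zero_apply]
  have hb (n : ℕ) : univBase 𝕜 0 n = 0 := by
    rcases n with _ | n
    · simp [univBase]
    · rw [univBase, univLog, logCoeff_comm, logCoeff_zero_right, smul_zero]
  induction a using MvPolynomial.induction_on with
  | C c => exact univD_C ħ 0 c
  | add p q hp hq => rw [map_add, hp, hq, add_zero]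
  | mul_X p v hp =>
    have hX : univD 𝕜 ħ 0 (MvPolynomial.X v) = 0 := by
      rw [univD_X, hb, Function.iterate_fixed (map_zero _)]
    rw [univD_mul, hp, hX]
    simp [hp]

theorem univD_univData (i j : ℕ) :
    univD 𝕜 ħ i (univData 𝕜 j) = (j : 𝕜) • univLog 𝕜 i j := by
  match j with
  | 0 => simp [univData]
  | 1 =>
    rw [univData, univD_X, univLog, logCoeff_one_right, Nat.cast_one, one_smul, ← Derivation.map_smul]
    rfl
  | n + 2 => rw [univData, univD_X]; rfl

theorem univD_iterate_univDeriv (k l : ℕ) (b : UnivRing 𝕜) :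
    univD 𝕜 ħ k ((univDeriv 𝕜)^[l] b) = (univDeriv 𝕜)^[l] (univD 𝕜 ħ k b) := by
  induction l with
  | zero => rfl
  | succ l ih => rw [Function.iterate_succ_apply', univD_univDeriv, ih, Function.iterate_succ_apply']

theorem univD_univLog_comm (i j : ℕ) {k : ℕ} (hk : k ≠ 0) :
    univD 𝕜 ħ i (univLog 𝕜 j k) = univD 𝕜 ħ j (univLog 𝕜 i k) :=
  apply_logCoeff_comm ħ (univDeriv 𝕜) (D := univD 𝕜 ħ) (f := univData 𝕜) (univD_zero ħ)
    (univD_one ħ) (univD_mul ħ) (univD_univDeriv ħ) (univD_univData ħ) i j hk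

theorem univD_univBase_zero (i j : ℕ) : univD 𝕜 ħ i (univBase 𝕜 j 0) = univLog 𝕜 i j := by
  rw [univBase, LinearMap.map_smul, univD_univData, smul_smul]
  rcases eq_or_ne j 0 with rfl | hj
  · rw [univLog, logCoeff_zero_right, smul_zero]
  · rw [inv_mul_cancel₀ (by exact_mod_cast hj), one_smul]

theorem univD_univBase_comm (i j n : ℕ) :
    univD 𝕜 ħ i (univBase 𝕜 j n) = univD 𝕜 ħ j (univBase 𝕜 i n) := by
  rcases n with _ | n
  · rw [univD_univBase_zero, univD_univBase_zero, univLog, univLog, logCoeff_comm]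
  · rw [univBase, univBase, LinearMap.map_smul, LinearMap.map_smul,
      univD_univLog_comm ħ i j (by omega)]

theorem univD_comm_mul {p x : UnivRing 𝕜}
    (hp : ∀ i j, univD 𝕜 ħ i (univD 𝕜 ħ j p) = univD 𝕜 ħ j (univD 𝕜 ħ i p))
    (hX : ∀ i j, univD 𝕜 ħ i (univD 𝕜 ħ j x) = univD 𝕜 ħ j (univD 𝕜 ħ i x)) (i j : ℕ) :
    univD 𝕜 ħ i (univD 𝕜 ħ j (p * x)) = univD 𝕜 ħ j (univD 𝕜 ħ i (p * x)) := by
  have hexp (i j : ℕ) : univD 𝕜 ħ i (univD 𝕜 ħ j (p * x)) =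
      univD 𝕜 ħ i (univD 𝕜 ħ j p) * x + univD 𝕜 ħ j p * univD 𝕜 ħ i x +
        ħ • ∑ r ∈ antidiagonal i, univD 𝕜 ħ r.1 (univD 𝕜 ħ j p) * univD 𝕜 ħ r.2 x +
      (univD 𝕜 ħ i p * univD 𝕜 ħ j x + p * univD 𝕜 ħ i (univD 𝕜 ħ j x) +
        ħ • ∑ r ∈ antidiagonal i, univD 𝕜 ħ r.1 p * univD 𝕜 ħ r.2 (univD 𝕜 ħ j x)) +
      ħ • (∑ q ∈ antidiagonal j, univD 𝕜 ħ i (univD 𝕜 ħ q.1 p) * univD 𝕜 ħ q.2 x +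
        ∑ q ∈ antidiagonal j, univD 𝕜 ħ q.1 p * univD 𝕜 ħ i (univD 𝕜 ħ q.2 x) +
        ħ • ∑ q ∈ antidiagonal j, ∑ r ∈ antidiagonal i,
          univD 𝕜 ħ r.1 (univD 𝕜 ħ q.1 p) * univD 𝕜 ħ r.2 (univD 𝕜 ħ q.2 x)) := by
    rw [univD_mul ħ j, map_add, map_add, map_smul, map_sum, univD_mul ħ i, univD_mul ħ i]
    simp only [univD_mul ħ i, Finset.sum_add_distrib, Finset.smul_sum]
  have hA (i j : ℕ) : ∑ r ∈ antidiagonal i, univD 𝕜 ħ r.1 (univD 𝕜 ħ j p) * univD 𝕜 ħ r.2 x =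
      ∑ r ∈ antidiagonal i, univD 𝕜 ħ j (univD 𝕜 ħ r.1 p) * univD 𝕜 ħ r.2 x :=
    Finset.sum_congr rfl fun r _ => by rw [hp]
  have hB (i j : ℕ) : ∑ r ∈ antidiagonal i, univD 𝕜 ħ r.1 p * univD 𝕜 ħ r.2 (univD 𝕜 ħ j x) =
      ∑ r ∈ antidiagonal i, univD 𝕜 ħ r.1 p * univD 𝕜 ħ j (univD 𝕜 ħ r.2 x) :=
    Finset.sum_congr rfl fun r _ => by rw [hX]
  have hC : ∑ q ∈ antidiagonal j, ∑ r ∈ antidiagonal i,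
        univD 𝕜 ħ r.1 (univD 𝕜 ħ q.1 p) * univD 𝕜 ħ r.2 (univD 𝕜 ħ q.2 x) =
      ∑ r ∈ antidiagonal i, ∑ q ∈ antidiagonal j,
        univD 𝕜 ħ q.1 (univD 𝕜 ħ r.1 p) * univD 𝕜 ħ q.2 (univD 𝕜 ħ r.2 x) := by
    rw [Finset.sum_comm]
    exact Finset.sum_congr rfl fun r _ => Finset.sum_congr rfl fun q _ => by
      rw [hp r.1 q.1, hX r.2 q.2]
  rw [hexp i j, hexp j i, hA i j, hA j i, hB i j, hB j i, hC, hp i j, hX i j]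
  simp only [smul_add]
  ring

theorem univD_comm (i j : ℕ) (a : UnivRing 𝕜) :
    univD 𝕜 ħ i (univD 𝕜 ħ j a) = univD 𝕜 ħ j (univD 𝕜 ħ i a) := by
  induction a using MvPolynomial.induction_on generalizing i j with
  | C c =>
    have h0 (k : ℕ) : univD 𝕜 ħ k 0 = 0 := LinearMap.map_zero _
    exact (congrArg _ (univD_C ħ j c)).trans
      ((h0 i).trans ((h0 j).symm.trans (congrArg _ (univD_C ħ i c).symm)))
  | add p q hp hq => simp only [map_add, hp i j, hq i j]
  | mul_X p v hp =>
    have hX (i j : ℕ) : univD 𝕜 ħ i (univD 𝕜 ħ j (MvPolynomial.X v)) =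
        univD 𝕜 ħ j (univD 𝕜 ħ i (MvPolynomial.X v)) := by
      rw [univD_X, univD_X, univD_iterate_univDeriv, univD_iterate_univDeriv, univD_univBase_comm]
    exact univD_comm_mul ħ hp hX i j

end Universal

/-! ### Existence of solutions -/

section Existence

variable {𝕜 : Type*} [RCLike 𝕜] (ħ : 𝕜)

/-- The product of the operators `D_k`, `k ∈ l`, on the universal ring. -/
def univOps (l : List ℕ) : Module.End 𝕜 (UnivRing 𝕜) := (l.map (univD 𝕜 ħ)).prod

theorem univOps_cons (k : ℕ) (l : List ℕ) :
    univOps ħ (k :: l) = univD 𝕜 ħ k * univOps ħ l := by simp [univOps]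

theorem univOps_append (l l' : List ℕ) : univOps ħ (l ++ l') = univOps ħ l * univOps ħ l' := by
  simp [univOps]

theorem univOps_perm {l l' : List ℕ} (h : l.Perm l') : univOps ħ l = univOps ħ l' := by
  refine (h.map _).prod_eq' (List.Pairwise.imp_of_mem (R := fun _ _ => True) ?_
    (List.pairwise_of_forall fun _ _ => trivial))
  intro a b ha hb _
  obtain ⟨i, -, rfl⟩ := List.mem_map.1 ha
  obtain ⟨j, -, rfl⟩ := List.mem_map.1 hb
  exact LinearMap.ext fun x => univD_comm ħ i j x

theorem univOps_cons' (k : ℕ) (l : List ℕ) :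
    univOps ħ (k :: l) = univOps ħ l * univD 𝕜 ħ k := by
  rw [univOps_perm ħ (List.perm_append_singleton k l).symm, univOps_append]
  simp [univOps]

theorem univOps_univDeriv (l : List ℕ) (a : UnivRing 𝕜) :
    univOps ħ l (univDeriv 𝕜 a) = univDeriv 𝕜 (univOps ħ l a) := by
  induction l with
  | nil => rfl
  | cons k l ih => rw [univOps_cons, Module.End.mul_apply, Module.End.mul_apply, ih,
      univD_univDeriv]

variable {A : Type*} [CommRing A] [Algebra 𝕜 A] (d : Derivation 𝕜 A A)

/-- The evaluation of the universal ring at given data `f_k`, `k ≥ 1`, and a value `a` for `F`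
at `t = 0`. -/
def univEval (f : ℕ → A) (a : A) : UnivRing 𝕜 →ₐ[𝕜] A :=
  MvPolynomial.aeval fun v => d^[v.2] (if v.1 = 0 then a else f (v.1 + 1))

theorem univEval_univDeriv (f : ℕ → A) (a : A) (x : UnivRing 𝕜) :
    univEval d f a (univDeriv 𝕜 x) = d (univEval d f a x) := by
  induction x using MvPolynomial.induction_on with
  | C c => rw [MvPolynomial.derivation_C, map_zero, ← MvPolynomial.algebraMap_eq, AlgHom.commutes,
      Derivation.map_algebraMap]
  | add p q hp hq => simp only [map_add, hp, hq]
  | mul_X p v hp =>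
    have hv : univEval d f a (univDeriv 𝕜 (MvPolynomial.X v)) =
        d (univEval d f a (MvPolynomial.X v)) := by
      rw [univDeriv_X, univEval, MvPolynomial.aeval_X, MvPolynomial.aeval_X,
        Function.iterate_succ_apply']
    simp only [Derivation.leibniz, smul_eq_mul, map_add, map_mul, hp, hv]

theorem univEval_univData {f : ℕ → A} {a : A} (ha : d a = f 1) {k : ℕ} (hk : 1 ≤ k) :
    univEval d f a (univData 𝕜 k) = f k := by
  match k, hk with
  | 1, _ =>
    rw [univData, univEval, MvPolynomial.aeval_X]
    exact ha
  | n + 2, _ =>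
    rw [univData, univEval, MvPolynomial.aeval_X]
    rfl

variable (f : ℕ → A) (a : A)

theorem exists_univSeries (x : UnivRing 𝕜) : ∃ G : MvPowerSeries ℕ+ A,
    ∀ l : List ℕ, (∀ k ∈ l, 0 < k) → MvPowerSeries.constantCoeff (opsD A ħ l G) =
      univEval d f a (univOps ħ l x) := by
  obtain ⟨G, hG⟩ := exists_opsD_eq ħ fun m => univEval d f a (univOps ħ m.toList x)
  refine ⟨G, fun l hl => ?_⟩
  rw [hG l hl, univOps_perm ħ (Multiset.coe_eq_coe.1 (Multiset.coe_toList (l : Multiset ℕ)))]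

/-- The Taylor series of an element `x` of the universal ring: its deformed derivatives at `t = 0`
are the values of the `D_{k_1} ⋯ D_{k_r} x`. -/
def univSeries (x : UnivRing 𝕜) : MvPowerSeries ℕ+ A := (exists_univSeries ħ d f a x).choose

theorem constantCoeff_opsD_univSeries (x : UnivRing 𝕜) {l : List ℕ} (hl : ∀ k ∈ l, 0 < k) :
    MvPowerSeries.constantCoeff (opsD A ħ l (univSeries ħ d f a x)) =
      univEval d f a (univOps ħ l x) :=
  (exists_univSeries ħ d f a x).choose_spec l hl

theorem constantCoeff_univSeries (x : UnivRing 𝕜) :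
    MvPowerSeries.constantCoeff (univSeries ħ d f a x) = univEval d f a x :=
  constantCoeff_opsD_univSeries ħ d f a x (l := []) (by simp)

theorem univSeries_add (x y : UnivRing 𝕜) :
    univSeries ħ d f a (x + y) = univSeries ħ d f a x + univSeries ħ d f a y := by
  refine eq_of_opsD ħ fun l hl => ?_
  simp only [map_add, constantCoeff_opsD_univSeries ħ d f a _ hl]

theorem univSeries_smul (c : 𝕜) (x : UnivRing 𝕜) :
    univSeries ħ d f a (c • x) = c • univSeries ħ d f a x := by
  refine eq_of_opsD ħ fun l hl => ?_
  have hsm (G : MvPowerSeries ℕ+ A) : MvPowerSeries.constantCoeff (c • G) =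
    c • MvPowerSeries.constantCoeff G := rfl
  rw [map_smul, hsm]
  simp only [constantCoeff_opsD_univSeries ħ d f a _ hl, map_smul]

theorem hD_univSeries (k : ℕ) (x : UnivRing 𝕜) :
    hD A ħ k (univSeries ħ d f a x) = univSeries ħ d f a (univD 𝕜 ħ k x) := by
  rcases Nat.eq_zero_or_pos k with rfl | hk
  · rw [hD_zero, univD_zero, LinearMap.zero_apply, LinearMap.zero_apply]
    have := univSeries_smul ħ d f a 0 0
    rw [zero_smul, zero_smul] at this
    exact this.symm
  · refine eq_of_opsD ħ fun l hl => ?_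
    rw [← Module.End.mul_apply, ← opsD_cons', constantCoeff_opsD_univSeries ħ d f a _ hl,
      constantCoeff_opsD_univSeries ħ d f a _ (by simpa using ⟨hk, hl⟩), univOps_cons',
      Module.End.mul_apply]

theorem dxEnd_univSeries (x : UnivRing 𝕜) :
    dxEnd d (univSeries ħ d f a x) = univSeries ħ d f a (univDeriv 𝕜 x) := by
  refine eq_of_opsD ħ fun l hl => ?_
  have hcomm : Commute (opsD A ħ l) (dxEnd d) := by
    refine Commute.list_prod_left _ _ fun T hT => ?_
    obtain ⟨k, -, rfl⟩ := List.mem_map.1 hT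
    exact (commute_hD_of_forall (commute_dxEnd_dt d) ħ k).symm
  rw [← Module.End.mul_apply, hcomm.eq, Module.End.mul_apply,
    constantCoeff_opsD_univSeries ħ d f a _ hl, univOps_univDeriv, univEval_univDeriv,
    ← constantCoeff_opsD_univSeries ħ d f a _ hl]
  exact constantCoeff_dxEnd_iterate d _ 1

theorem univSeries_one : univSeries ħ d f a 1 = 1 := by
  refine eq_of_opsD ħ fun l hl => ?_
  rw [constantCoeff_opsD_univSeries ħ d f a _ hl]
  rcases l with _ | ⟨k, l⟩
  · simp [univOps]
  · rw [univOps_cons', opsD_cons', Module.End.mul_apply, Module.End.mul_apply, univD_one,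
      ← map_one (MvPowerSeries.C (σ := ℕ+) (R := A)), hD_C, map_zero, map_zero, map_zero, map_zero]

theorem univSeries_mul (x y : UnivRing 𝕜) :
    univSeries ħ d f a (x * y) = univSeries ħ d f a x * univSeries ħ d f a y := by
  have key (l : List ℕ) (hl : ∀ k ∈ l, 0 < k) : ∀ x y : UnivRing 𝕜,
      MvPowerSeries.constantCoeff (opsD A ħ l (univSeries ħ d f a x * univSeries ħ d f a y)) =
        univEval d f a (univOps ħ l (x * y)) := by
    induction l with
    | nil =>
      intro x y
      rw [opsD_nil, Module.End.one_apply, map_mul, constantCoeff_univSeries,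
        constantCoeff_univSeries, ← map_mul]
      rfl
    | cons k l ih =>
      intro x y
      have ih := ih fun j hj => hl j (List.mem_cons_of_mem _ hj)
      have hsm (c : 𝕜) (G : MvPowerSeries ℕ+ A) : MvPowerSeries.constantCoeff (c • G) =
        c • MvPowerSeries.constantCoeff G := rfl
      rw [opsD_cons', univOps_cons', Module.End.mul_apply, Module.End.mul_apply, hD_mul, univD_mul]
      simp only [hD_univSeries, map_add, map_smul, map_sum, ih, hsm]
  refine eq_of_opsD ħ fun l hl => ?_
  rw [key l hl, constantCoeff_opsD_univSeries ħ d f a _ hl]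

/-- The Taylor series as a homomorphism of algebras. -/
def univSeriesHom : UnivRing 𝕜 →ₐ[𝕜] MvPowerSeries ℕ+ A :=
  AlgHom.ofLinearMap
    { toFun := univSeries ħ d f a
      map_add' := univSeries_add ħ d f a
      map_smul' := univSeries_smul ħ d f a }
    (univSeries_one ħ d f a) (univSeries_mul ħ d f a)

variable {f a} in
/-- Any data are those of a solution, provided `f_1` has an antiderivative `a`: the solution is the
Taylor series of the universal solution, shifted by a function of `x`. -/
theorem exists_isSolution (ha : d a = f 1) :
    ∃ F : MvPowerSeries ℕ+ A, IsSolution d ħ F ∧ HasCauchyLikeData ħ f F := by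
  let Φ := univSeriesHom ħ d f a
  have hΦ (x) : Φ x = univSeries ħ d f a x := rfl
  let F₀ := Φ (MvPolynomial.X (0, 0))
  let φ := f 0 - a
  let F := F₀ + MvPowerSeries.C φ
  have hFC : F - MvPowerSeries.C φ = F₀ := add_sub_cancel_right _ _
  have hhD (k : ℕ) (x : UnivRing 𝕜) : hD A ħ k (Φ x) = Φ (univD 𝕜 ħ k x) :=
    hD_univSeries ħ d f a k x
  have hhd (k : ℕ) : hderiv A ħ k F = Φ (univData 𝕜 k) := by
    rw [hderiv_eq, LinearMap.smul_apply, map_add, hD_C, add_zero, hhD, univD_X,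
      Function.iterate_zero_apply, univBase, map_smul, smul_smul]
    rcases eq_or_ne k 0 with rfl | hk
    · simp [univData]
    · rw [mul_inv_cancel₀ (by exact_mod_cast hk), one_smul]
  have hD1 (s : ℕ) : univD 𝕜 ħ 1 (univData 𝕜 s) = univDeriv 𝕜 (univData 𝕜 s) := by
    rw [univD_univData, univLog, logCoeff_comm, logCoeff_one_right, smul_smul]
    rcases eq_or_ne s 0 with rfl | hs
    · simp [univData]
    · rw [mul_inv_cancel₀ (by exact_mod_cast hs), one_smul]
  refine ⟨F, ⟨⟨φ, ?_⟩, (fay_iff ħ F).2 fun i j => ?_⟩, ?_, fun k hk => ?_⟩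
  · rw [hFC, ← hD_one ħ, hhD, univD_X]
    refine (dxEnd_univSeries ħ d f a _).trans ?_
    rw [univDeriv_X, ← hΦ, Function.iterate_zero_apply, univBase, Nat.cast_one, inv_one, one_smul]
    rfl
  · have h1 : (fun s => dt 𝕜 A 1 (hderiv A ħ s F)) =
        fun s => Φ (univDeriv 𝕜 (univData 𝕜 s)) := by
      funext s
      rw [hhd, ← hD_one ħ, hhD, hD1]
    rw [h1, hhd, hderiv_eq, LinearMap.smul_apply, hhD, univD_univData, map_smul, smul_smul]
    have h2 := congrArg Φ (smul_coeff_log_faySeries (𝕜 := 𝕜)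
      (fun s => univDeriv 𝕜 (univData 𝕜 s)) i j)
    rw [map_smul] at h2
    refine h2.trans ?_
    simp only [hPoly, map_sum, map_smul, map_list_prod, List.map_map]
    rfl
  · change MvPowerSeries.constantCoeff (F₀ + MvPowerSeries.C φ) = f 0
    rw [map_add, MvPowerSeries.constantCoeff_C]
    change MvPowerSeries.constantCoeff (univSeries ħ d f a _) + _ = _
    rw [constantCoeff_univSeries, univEval, MvPolynomial.aeval_X]
    exact add_sub_cancel a (f 0)
  · rw [hhd, hΦ, constantCoeff_univSeries, univEval_univData d ha hk]

/-- Existence, uniqueness and the explicit formula, over any algebra with a surjective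
derivation. -/
theorem existsUnique_isSolution (hd : Function.Surjective d) (f : ℕ → A) :
    (∃! F : MvPowerSeries ℕ+ A, IsSolution d ħ F ∧ HasCauchyLikeData ħ f F) ∧
      ∀ F : MvPowerSeries ℕ+ A, IsSolution d ħ F → HasCauchyLikeData ħ f F →
        IsExpansion d ħ f F := by
  obtain ⟨a, ha⟩ := hd (f 1)
  obtain ⟨F, hF⟩ := exists_isSolution ħ d ha
  exact ⟨⟨F, hF, fun G hG => (isExpansion_of_isSolution hG.1 hG.2).unique
    (isExpansion_of_isSolution hF.1 hF.2)⟩, fun G h h' => isExpansion_of_isSolution h h'⟩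

end Existence

/-! ### Antiderivatives -/

section Antiderivative

variable {𝕜 : Type*} [RCLike 𝕜]

theorem derivative_surjective : Function.Surjective (PowerSeries.derivative 𝕜) := fun g => by
  refine ⟨PowerSeries.mk fun n => PowerSeries.coeff (n - 1) g / n, ?_⟩
  ext n
  have h : ((n : 𝕜) + 1) ≠ 0 := by exact_mod_cast n.succ_ne_zero
  rw [PowerSeries.coeff_derivative, PowerSeries.coeff_mk, Nat.add_sub_cancel, Nat.cast_succ,
    div_mul_cancel₀ _ h]

theorem smoothDeriv_surjective {I : TopologicalSpace.Opens ℝ} (hI : (I : Set ℝ).OrdConnected) :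
    Function.Surjective (smoothDeriv 𝕜 I) := fun g => by
  rcases isEmpty_or_nonempty I with hE | ⟨⟨x₀, hx₀⟩⟩
  · exact ⟨0, Subtype.ext (Subsingleton.elim _ _)⟩
  set h := extendZero g.1 with hh
  have hcont : ContinuousOn h I := ContDiffOn.continuousOn g.2
  let G : ℝ → 𝕜 := fun x => ∫ t in x₀..x, h t
  have hG (x : ℝ) (hx : x ∈ I) : HasDerivAt G (h x) x :=
    intervalIntegral.integral_hasDerivAt_right
      ((hcont.mono (hI.uIcc_subset hx₀ hx)).intervalIntegrable)
      (hcont.stronglyMeasurableAtFilter I.2 x hx) (hcont.continuousAt (I.2.mem_nhds hx))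
  have hGsmooth : ContDiffOn ℝ ∞ G I :=
    (contDiffOn_infty_iff_deriv_of_isOpen I.2).2
      ⟨fun x hx => (hG x hx).differentiableAt.differentiableWithinAt,
        ContDiffOn.congr g.2 fun x hx => (hG x hx).deriv⟩
  refine ⟨⟨fun x => G x, contDiffOn_of_eq hGsmooth fun _ => rfl⟩, Subtype.ext (funext fun x => ?_)⟩
  refine (deriv_extendZero_congr (g := fun x : I => G x) (f := G) (fun _ => rfl) x).trans ?_
  rw [(hG x x.2).deriv, hh, extendZero_apply]

end Antiderivative

end HKP

end

theorem theorem4 {𝕜 : Type*} [RCLike 𝕜] (ħ : 𝕜) :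
    -- smooth functions on an open interval
    (∀ I : TopologicalSpace.Opens ℝ, (I : Set ℝ).OrdConnected →
      ∀ f : ℕ → HKP.SmoothFun 𝕜 I,
        (∃! F : MvPowerSeries ℕ+ (HKP.SmoothFun 𝕜 I),
          HKP.IsSolution (HKP.smoothDeriv 𝕜 I) ħ F ∧ HKP.HasCauchyLikeData ħ f F) ∧
        ∀ F : MvPowerSeries ℕ+ (HKP.SmoothFun 𝕜 I),
          HKP.IsSolution (HKP.smoothDeriv 𝕜 I) ħ F → HKP.HasCauchyLikeData ħ f F →
            HKP.IsExpansion (HKP.smoothDeriv 𝕜 I) ħ f F) ∧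
    -- formal functions, i.e. formal power series in `x`
    (∀ f : ℕ → PowerSeries 𝕜,
      (∃! F : MvPowerSeries ℕ+ (PowerSeries 𝕜),
        HKP.IsSolution (PowerSeries.derivative 𝕜) ħ F ∧ HKP.HasCauchyLikeData ħ f F) ∧
      ∀ F : MvPowerSeries ℕ+ (PowerSeries 𝕜),
        HKP.IsSolution (PowerSeries.derivative 𝕜) ħ F → HKP.HasCauchyLikeData ħ f F →
          HKP.IsExpansion (PowerSeries.derivative 𝕜) ħ f F) := by
  exact ⟨fun I hI f => HKP.existsUnique_isSolution ħ _ (HKP.smoothDeriv_surjective hI) f,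
    fun f => HKP.existsUnique_isSolution ħ _ HKP.derivative_surjective f⟩
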